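/- **Setting.** Let $p\ge 1$, let $\mathrm T\subset\mathbb R$ be a compact interval and $\mathrm Z\subset\mathbb R^p$ a compact box (both with nonempty interior). Let $X(t,\boldsymbol{z})$ be a jointly measurable random function with mean $\mu(t,\boldsymbol{z})$ and covariance function $\Gamma(s,t,\boldsymbol{z})=\sum_{k\ge1}\lambda_k(\boldsymbol{z})\phi_k(s)\phi_k(t)$ for $s,t\in\mathrm T$, $\boldsymbol{z}\in\mathrm Z$, where $(\phi_k)$ is orthonormal in $L^2(\mathrm T)$, $\lambda_1(\boldsymbol{z})\ge\lambda_2(\boldsymbol{z})\ge\dots\ge0$ and $\sum_k\lambda_k(\boldsymbol{z})<\infty$; $\Gamma$ is bounded on $\mathrm T\times\mathrm T\times\mathrm Z$. For i.i.d. subjects $i=1,2,\dots$ let $X_i$ be a copy of $X$, $\boldsymbol{Z}_i\in\mathrm Z$ the covariate, $(T_{ij})_{j\ge1}$ the observation times in $\mathrm T$, and $(\varepsilon_{ij})_{j\ge1}$ i.i.d. errors with mean $0$ and variance $\sigma^2$, where $X_i$, $(\boldsymbol{Z}_i,(T_{ij})_j)$ and $(\varepsilon_{ij})_j$ are independent of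 each other and each $(T_{ij},\boldsymbol{Z}_i)$ has density $g$ on $\mathrm T\times\mathrm Z$. For sample size $n$ one observes $(T_{ij},\boldsymbol{Z}_i,Y_{ij})$, $1\le j\le N_i$, $1\le i\le n$, where $Y_{ij}=X_i(T_{ij},\boldsymbol{Z}_i)+\varepsilon_{ij}$ and the deterministic numbers $N_i=N_{n,i}\ge1$ may depend on $n$. Put $U_{ij}=Y_{ij}-\mu(T_{ij},\boldsymbol{Z}_i)$ and $\gamma_{n1}=(n^{-1}\sum_{i\le n}N_i^{-1})^{-1}$. Let $h_t>0$ and $h_z^{(1)},\dots,h_z^{(p)}>0$ be bandwidth sequences, all $h_z^{(k)}$ of the same order as $h_z>0$, let $K_h(u)=K(u/h)/h$, and let $\hat\mu(t,\boldsymbol{z})=\hat b_0$, where $(\hat b_0,\hat b_1,\hat{\boldsymbol{b}}_2)$ is a minimizer over $\mathbb R\times\mathbb R\times\mathbb R^p$ of $$\frac1n\sum_{i=1}^n\frac1{N_i}\sum_{j=1}^{N_i}\{Y_{ij}-b_0-b_1(T_{ij}-t)-\boldsymbol{b}_2^{T}(\boldsymbol{Z}_i-\boldsymbol{z})\}^2K_{h_t}(T_{ij}-t)\prod_{k=1}^pK_{h_z^{(k)}}(Z_i^{(k)}-z^{(k)}).$$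 Write $a_n\approx b_n$ for "of the same order" and $a_n\lesssim b_n$ for $a_n=O(b_n)$. **Assumptions.** (A.1) $g$ is bounded away from $0$ and $\infty$ and differentiable with bounded derivative on $\mathrm T\times\mathrm Z$. (A.2) $K$ is a symmetric probability density on $[-1,1]$ of bounded variation there. (B.1) $\mu$ is twice differentiable with bounded second derivative on $\mathrm T\times\mathrm Z$. (B.2) For some $\lambda\in(2,\infty)$: $E|U_{ij}|^{\lambda}<\infty$, $E\sup_{t\in\mathrm T}|X_i(t,\boldsymbol{Z}_i)|^{\lambda}<\infty$, $h_t\to0$ and $\big(h_t^2\prod_kh_z^{(k)}+h_t\prod_kh_z^{(k)}/\gamma_{n1}\big)^{-1}(\log n/n)^{1-2/\lambda}\to0$. **Conclusion.** (a) If $\max_{i\le n}N_i\le\mathcal M$ for some $\mathcal M<\infty$ not depending on $n$, and $h_t\approx h_z\approx h$, then $$\sup_{t\in\mathrm T,\,\boldsymbol{z}\in\mathrm Z}|\hat\mu(t,\boldsymbol{z})-\mu(t,\boldsymbol{z})|=O\big(h^2+\{\log n/(nh^{p+1})\}^{1/2}\big)\quad\text{a.s.}$$ The optimal order of this rate is $(\log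 n/n)^{2/(p+5)}$: for every positive sequence $h$, $(\log n/n)^{2/(p+5)}=O\big(h^2+\{\log n/(nh^{p+1})\}^{1/2}\big)$; the two sides are of the same order if and only if $h\approx(\log n/n)^{1/(p+5)}$; and if the bandwidths in (a) are of this order, then the supremum is $O\big((\log n/n)^{2/(p+5)}\big)$ a.s. (b) Suppose that the triples $(T_{ij},T_{ik},\boldsymbol{Z}_i)$, $j\ne k$, have joint densities that are uniformly bounded (as is the case when, given $\boldsymbol{Z}_i$, the $T_{ij}$ are independent). If $\min_{1\le i\le n}N_i\ge\mathcal M_n>0$, where $\mathcal M_n^{-1}\approx h_t\lesssim h_z\approx(\log n/n)^{1/(p+4)}$, then $$\sup_{t\in\mathrm T,\,\boldsymbol{z}\in\mathrm Z}|\hat\mu(t,\boldsymbol{z})-\mu(t,\boldsymbol{z})|=O\big((\log n/n)^{2/(p+4)}\big)\quad\text{a.s.}$$ -/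

import Mathlib

open MeasureTheory ProbabilityTheory Filter Asymptotics Set
open scoped Topology ENNReal NNReal

/-- The objects of the covariate-adjusted functional model: a compact time interval, a compact box of
covariates, the random function `X`, and the raw ingredients of the observations.

The random function is `s ↦ X s t z`, defined on a space `S` of outcomes; `ξ i` is the outcome drawn for
subject `i`, so that the latent trajectory of subject `i` is `t ↦ X (ξ i ω) t (Z i ω)`. -/
structure FunctionalModel (p : ℕ) (Ω S : Type*) where
  /-- end points of the time interval -/
  tlo : ℝ
  thi : ℝ
  /-- end points of the sides of the covariate box -/
  zlo : Fin p → ℝ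
  zhi : Fin p → ℝ
  /-- mean function, of (time, covariate) -/
  mean : ℝ × (Fin p → ℝ) → ℝ
  /-- covariate-specific eigenvalues -/
  eigval : ℕ → (Fin p → ℝ) → ℝ
  /-- common eigenfunctions -/
  eigfun : ℕ → ℝ → ℝ
  /-- standard deviation of the measurement errors -/
  σ : ℝ
  /-- density of (time, covariate) -/
  dens : ℝ × (Fin p → ℝ) → ℝ
  /-- the random function of time and covariate -/
  X : S → ℝ → (Fin p → ℝ) → ℝ
  /-- outcome drawn for each subject -/
  ξ : ℕ → Ω → S
  /-- covariate of each subject -/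
  Z : ℕ → Ω → Fin p → ℝ
  /-- `j`-th observation time of subject `i` -/
  T : ℕ → ℕ → Ω → ℝ
  /-- measurement error of the `j`-th observation of subject `i` -/
  err : ℕ → ℕ → Ω → ℝ

namespace FunctionalModel

variable {p : ℕ} {Ω S : Type*}

/-- The time interval. -/
def timeSet (m : FunctionalModel p Ω S) : Set ℝ := Icc m.tlo m.thi

/-- The covariate box. -/
def covSet (m : FunctionalModel p Ω S) : Set (Fin p → ℝ) := Icc m.zlo m.zhi

/-- Time interval times covariate box. -/
def dom (m : FunctionalModel p Ω S) : Set (ℝ × (Fin p → ℝ)) := m.timeSet ×ˢ m.covSet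

/-- The `j`-th observation of subject `i`: the latent trajectory at the observation time, plus error.
(By the Karhunen–Loève expansion the trajectory is the mean function plus the sum of the scores times
the eigenfunctions.) -/
def Y (m : FunctionalModel p Ω S) (i j : ℕ) (ω : Ω) : ℝ :=
  m.X (m.ξ i ω) (m.T i j ω) (m.Z i ω) + m.err i j ω

/-- The centred observation. -/
def U (m : FunctionalModel p Ω S) (i j : ℕ) (ω : Ω) : ℝ :=
  m.Y i j ω - m.mean (m.T i j ω, m.Z i ω)

/-- `sup_t |X(t, z)|`, as an extended nonnegative number. -/
noncomputable def supX (m : FunctionalModel p Ω S) (q : S × (Fin p → ℝ)) : ℝ≥0∞ :=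
  ⨆ t ∈ m.timeSet, ENNReal.ofReal |m.X q.1 t q.2|

/-- All the random ingredients of subject `i`. -/
def subject (m : FunctionalModel p Ω S) (i : ℕ) (ω : Ω) :
    S × (Fin p → ℝ) × (ℕ → ℝ) × (ℕ → ℝ) :=
  (m.ξ i ω, m.Z i ω, fun j => m.T i j ω, fun j => m.err i j ω)

/-- The design density is bounded away from zero and infinity on the domain, and differentiable there
with a bounded derivative. -/
def DensityRegular (m : FunctionalModel p Ω S) : Prop :=
  (∃ lo hi : ℝ, 0 < lo ∧ ∀ x ∈ m.dom, lo ≤ m.dens x ∧ m.dens x ≤ hi) ∧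
  DifferentiableOn ℝ m.dens m.dom ∧
  ∃ C : ℝ, ∀ x ∈ m.dom, ‖fderivWithin ℝ m.dens m.dom x‖ ≤ C

/-- The mean function is twice differentiable on the domain with a bounded second derivative. -/
def MeanRegular (m : FunctionalModel p Ω S) : Prop :=
  DifferentiableOn ℝ m.mean m.dom ∧
  DifferentiableOn ℝ (fderivWithin ℝ m.mean m.dom) m.dom ∧
  ∃ C : ℝ, ∀ x ∈ m.dom, ‖fderivWithin ℝ (fderivWithin ℝ m.mean m.dom) m.dom x‖ ≤ C

variable [MeasurableSpace Ω] [MeasurableSpace S]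

/-- The laws of the eigen-adjusted functional model with i.i.d. subjects. -/
structure IsEigenAdjusted (m : FunctionalModel p Ω S) (P : Measure Ω) : Prop where
  time_nondeg : m.tlo < m.thi
  cov_nondeg : ∀ k, m.zlo k < m.zhi k
  -- measurability
  meas_X : Measurable fun q : S × ℝ × (Fin p → ℝ) => m.X q.1 q.2.1 q.2.2
  meas_ξ : ∀ i, Measurable (m.ξ i)
  meas_Z : ∀ i, Measurable (m.Z i)
  meas_T : ∀ i j, Measurable (m.T i j)
  meas_err : ∀ i j, Measurable (m.err i j)
  -- subjects are independent and identically distributed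
  subjects_indep : iIndepFun m.subject P
  subjects_ident : ∀ i, IdentDistrib (m.subject i) (m.subject 0) P P
  -- the random function is independent of the covariate and the observation times
  indep_design : ∀ i, IndepFun (m.ξ i) (fun ω => (m.Z i ω, fun j => m.T i j ω)) P
  -- the errors are i.i.d., centred, with variance `σ ^ 2`, and independent of everything else
  indep_err : ∀ i, IndepFun (fun ω => (m.ξ i ω, m.Z i ω, fun j => m.T i j ω))
    (fun ω j => m.err i j ω) P
  err_indep : ∀ i, iIndepFun (m.err i) P
  err_ident : ∀ i j, IdentDistrib (m.err i j) (m.err i 0) P P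
  err_memLp : ∀ i j, MemLp (m.err i j) 2 P
  err_mean : ∀ i j, ∫ ω, m.err i j ω ∂P = 0
  err_var : ∀ i j, Var[m.err i j; P] = m.σ ^ 2
  -- (time, covariate) has density `dens` on the domain
  law_design : ∀ i j, P.map (fun ω => (m.T i j ω, m.Z i ω)) =
    (volume.restrict m.dom).withDensity fun x => ENNReal.ofReal (m.dens x)
  -- the random function has mean function `mean` ...
  X_memLp : ∀ i, ∀ t ∈ m.timeSet, ∀ z ∈ m.covSet, MemLp (fun ω => m.X (m.ξ i ω) t z) 2 P
  X_mean : ∀ i, ∀ t ∈ m.timeSet, ∀ z ∈ m.covSet, ∫ ω, m.X (m.ξ i ω) t z ∂P = m.mean (t, z)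
  -- ... and covariance function `∑ k, eigval k z * eigfun k s * eigfun k t`
  eigfun_memLp : ∀ k, MemLp (m.eigfun k) 2 (volume.restrict m.timeSet)
  eigfun_orthonormal : ∀ k l,
    ∫ t in m.timeSet, m.eigfun k t * m.eigfun l t = if k = l then 1 else 0
  eigval_nonneg : ∀ k, ∀ z ∈ m.covSet, 0 ≤ m.eigval k z
  eigval_anti : ∀ k, ∀ z ∈ m.covSet, m.eigval (k + 1) z ≤ m.eigval k z
  eigval_summable : ∀ z ∈ m.covSet, Summable fun k => m.eigval k z
  X_cov : ∀ i, ∀ s ∈ m.timeSet, ∀ t ∈ m.timeSet, ∀ z ∈ m.covSet,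
    HasSum (fun k => m.eigval k z * m.eigfun k s * m.eigfun k t)
      cov[fun ω => m.X (m.ξ i ω) s z, fun ω => m.X (m.ξ i ω) t z; P]
  -- the covariance function is bounded (equivalently, bounded on the diagonal)
  X_var_bdd : ∃ C : ℝ, ∀ i, ∀ t ∈ m.timeSet, ∀ z ∈ m.covSet,
    Var[fun ω => m.X (m.ξ i ω) t z; P] ≤ C

end FunctionalModel

/-- A symmetric probability density on `[-1, 1]` of bounded variation there. -/
structure IsKernel (K : ℝ → ℝ) : Prop where
  nonneg : ∀ u, 0 ≤ K u
  symm : ∀ u, K (-u) = K u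
  support : ∀ u, u ∉ Icc (-1 : ℝ) 1 → K u = 0
  integral_eq_one : ∫ u in Icc (-1 : ℝ) 1, K u = 1
  bv : BoundedVariationOn K (Icc (-1) 1)

/-- The rescaled kernel `K_h(u) = K(u / h) / h`. -/
noncomputable def scaledKernel (K : ℝ → ℝ) (h u : ℝ) : ℝ := K (u / h) / h

/-- `γ_{n1}`, the harmonic mean of the numbers of observations of the first `n` subjects. Here `N n i`
is the number of observations of subject `i` when `n` subjects are observed. -/
noncomputable def harmonicCount (N : ℕ → ℕ → ℕ) (n : ℕ) : ℝ :=
  ((n : ℝ)⁻¹ * ∑ i ∈ Finset.range n, ((N n i : ℝ))⁻¹)⁻¹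

/-- `log n / n`. -/
noncomputable def logRatio (n : ℕ) : ℝ := Real.log n / n

/-- Moment condition on the data, with exponent `r ∈ (2, ∞)`, and the matching bandwidth condition. -/
def MomentBandwidth {p : ℕ} {Ω S : Type*} [MeasurableSpace Ω] [MeasurableSpace S]
    (m : FunctionalModel p Ω S) (P : Measure Ω) (N : ℕ → ℕ → ℕ)
    (ht : ℕ → ℝ) (hz : ℕ → Fin p → ℝ) : Prop :=
  ∃ r : ℝ, 2 < r ∧
    (∀ i j, Integrable (fun ω => |m.U i j ω| ^ r) P) ∧
    (∀ i, AEMeasurable m.supX (P.map fun ω => (m.ξ i ω, m.Z i ω)) ∧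
      ∫⁻ ω, m.supX (m.ξ i ω, m.Z i ω) ^ r ∂P < ∞) ∧
    Tendsto ht atTop (𝓝 0) ∧
    Tendsto (fun n => ((ht n) ^ 2 * ∏ k, hz n k + ht n * (∏ k, hz n k) / harmonicCount N n)⁻¹ *
      logRatio n ^ (1 - 2 / r)) atTop (𝓝 0)

/-- The weighted least squares criterion of the local linear smoother at `(t, z)`. -/
noncomputable def localLinearLoss {p : ℕ} {Ω S : Type*} (m : FunctionalModel p Ω S) (K : ℝ → ℝ)
    (N : ℕ → ℕ → ℕ) (ht : ℕ → ℝ) (hz : ℕ → Fin p → ℝ) (n : ℕ) (ω : Ω) (t : ℝ) (z : Fin p → ℝ)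
    (b : ℝ × ℝ × (Fin p → ℝ)) : ℝ :=
  (1 / (n : ℝ)) * ∑ i ∈ Finset.range n, (1 / (N n i : ℝ)) * ∑ j ∈ Finset.range (N n i),
    (m.Y i j ω - b.1 - b.2.1 * (m.T i j ω - t) - ∑ k, b.2.2 k * (m.Z i ω k - z k)) ^ 2 *
      scaledKernel K (ht n) (m.T i j ω - t) * ∏ k, scaledKernel K (hz n k) (m.Z i ω k - z k)

/-- `muhat` is a local linear estimator of the mean function: at every point it is the intercept of a
minimizer of the local linear criterion. (A minimizer always exists; any one may be chosen where it is
not unique.) -/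
def IsLocalLinearEstimator {p : ℕ} {Ω S : Type*} (m : FunctionalModel p Ω S) (K : ℝ → ℝ)
    (N : ℕ → ℕ → ℕ) (ht : ℕ → ℝ) (hz : ℕ → Fin p → ℝ)
    (muhat : ℕ → Ω → ℝ → (Fin p → ℝ) → ℝ) : Prop :=
  ∀ n ω, ∀ t ∈ m.timeSet, ∀ z ∈ m.covSet, ∃ (b₁ : ℝ) (b₂ : Fin p → ℝ),
    ∀ b, localLinearLoss m K N ht hz n ω t z (muhat n ω t z, b₁, b₂) ≤
      localLinearLoss m K N ht hz n ω t z b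

/-- The uniform error of `muhat`. -/
noncomputable def supError {p : ℕ} {Ω S : Type*} (m : FunctionalModel p Ω S)
    (muhat : ℕ → Ω → ℝ → (Fin p → ℝ) → ℝ) (n : ℕ) (ω : Ω) : ℝ≥0∞ :=
  ⨆ t ∈ m.timeSet, ⨆ z ∈ m.covSet, ENNReal.ofReal |muhat n ω t z - m.mean (t, z)|

/-- The uniform error is `O(rate n)` almost surely. -/
def HasUniformRate {p : ℕ} {Ω S : Type*} [MeasurableSpace Ω] (m : FunctionalModel p Ω S)
    (P : Measure Ω) (muhat : ℕ → Ω → ℝ → (Fin p → ℝ) → ℝ) (rate : ℕ → ℝ) : Prop :=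
  ∀ᵐ ω ∂P, ∃ C : ℝ, ∀ᶠ n in atTop, supError m muhat n ω ≤ ENNReal.ofReal (C * rate n)

/-- `h² + {log n / (n h^{p+1})}^{1/2}`. -/
noncomputable def sparseRate (p : ℕ) (h : ℕ → ℝ) (n : ℕ) : ℝ :=
  h n ^ 2 + (Real.log n / (n * h n ^ (p + 1))) ^ (1 / 2 : ℝ)

/-- Two different observation times of a subject and its covariate have a joint density, bounded
uniformly in the pair of times. -/
def PairDensityBounded {p : ℕ} {Ω S : Type*} [MeasurableSpace Ω] (m : FunctionalModel p Ω S)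
    (P : Measure Ω) : Prop :=
  ∃ B : ℝ≥0, ∀ i j k, j ≠ k →
    P.map (fun ω => (m.T i j ω, m.T i k ω, m.Z i ω)) ≤ (B : ℝ≥0∞) • volume

/-! Write ρ = log n / n and π for the product of all p + 1 bandwidths.

Deterministic part. Subtract from the observations the tangent plane of the mean at (t, z). What
remains is the noise `U` plus a Taylor remainder of second order (`norm_sub_fderivWithin_le`), and
the minimizer, after the same subtraction, fits it at least as well as zero does. Expanding the
squares, the weighted quadratic form of the fitted coefficients is at most twice their pairing with
the score at zero. That form is coercive because design mass of order π sits in every corner box of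
an orthant pointing into the domain, also when (t, z) lies on the boundary
(`weighted_sq_lower_bound`, `le_sum_kernel_mul_corner`). Hence the error is at most a constant times
score / π, in which the remainder accounts for the squared bandwidths (`exists_abs_intercept_le`). A
kernel of bounded variation is a difference of monotone functions, whose superlevel sets are
intervals; by the layer-cake formula kernel sums are therefore controlled by sums over boxes with
sides at most twice the bandwidths (`abs_sum_mul_prod_rescaled_le`).

Probabilistic part. It remains to show that counts and noise averages over such boxes deviate from
their means by O(√(vρ)), uniformly over boxes, where v is the order of the second moment of one
subject's average. Each box is squeezed between two grid boxes of mesh 1/n; these are polynomially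
many, so a Bernstein bound, a union bound and Borel–Cantelli suffice
(`ae_eventually_box_deviation_le`). Bernstein needs weights at most Q with Q²ρ = O(v). Truncation at
Q = ρ^(-1/r) turns this into the bandwidth condition, and the part cut off costs O(Qρ) = O(√(vρ)).
For the latent process, and for boundedly many errors, an i.i.d. envelope and the strong law control
the part cut off; for unboundedly many errors a Chernoff bound for capped exceedances replaces the
envelope (`ae_excess_le_of_dense`).

The regimes. With few observations per subject v = π, which gives √(ρ / π). With many, two points of
one subject share the covariate but have separate times, so v gains a factor h_t, both off the
diagonal (pair densities) and on it (1 / N = O(h_t)); then h_t cancels and √(ρ / ∏ h_z) remains. The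
optimal order in (a) comes from balancing h² against √(ρ / h^(p+1)). -/

set_option linter.unusedSectionVars false

/-! ### Layer-cake bounds for weighted sums -/

/-- Weighted sums of `f` are controlled by weighted counts over the subintervals of `s`. -/
def LayeredOn (s : Set ℝ) (B : ℝ) (f : ℝ → ℝ) : Prop :=
  ∀ (ι : Type) (F : Finset ι) (c x : ι → ℝ) (ε : ℝ),
    (∀ I : Set ℝ, I.OrdConnected → I ⊆ s → |∑ i ∈ F, c i * I.indicator 1 (x i)| ≤ ε) →
      |∑ i ∈ F, c i * f (x i)| ≤ B * ε

theorem LayeredOn.sub {s : Set ℝ} {B B' : ℝ} {f g : ℝ → ℝ} (hf : LayeredOn s B f)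
    (hg : LayeredOn s B' g) : LayeredOn s (B + B') (f - g) := by
  intro ι F c x ε h
  have h1 := hf ι F c x ε h
  have h2 := hg ι F c x ε h
  have : ∑ i ∈ F, c i * (f - g) (x i) = ∑ i ∈ F, c i * f (x i) - ∑ i ∈ F, c i * g (x i) := by
    rw [← Finset.sum_sub_distrib]
    exact Finset.sum_congr rfl fun i _ => by simp [mul_sub]
  rw [this]
  calc _ ≤ |∑ i ∈ F, c i * f (x i)| + |∑ i ∈ F, c i * g (x i)| := abs_sub _ _
    _ ≤ _ := by linarith

/-- Layer cake: on `s` the value `g y` is the integral over levels `a` in [0, B] of the indicator of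
`a < g y`. Superlevel sets of a monotone function are order-connected, so the integrand is bounded
by `ε` at every level. -/
theorem LayeredOn.of_monotoneOn {s : Set ℝ} (hs : s.OrdConnected) {B : ℝ} {g : ℝ → ℝ}
    (hB : 0 ≤ B) (hg : MonotoneOn g s) (h0 : ∀ x ∈ s, 0 ≤ g x) (h1 : ∀ x ∈ s, g x ≤ B) :
    LayeredOn s B (s.indicator g) := by
  intro ι F c x ε h
  let I : ℝ → Set ℝ := fun a => {y | y ∈ s ∧ a < g y}
  have hI : ∀ a, (I a).OrdConnected := by
    intro a
    refine ⟨fun u hu v hv w hw => ?_⟩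
    have hws : w ∈ s := hs.out hu.1 hv.1 hw
    exact ⟨hws, hu.2.trans_le (hg hu.1 hws hw.1)⟩
  have key : ∀ y, s.indicator g y = ∫ a in (0 : ℝ)..B, (I a).indicator 1 y := by
    intro y
    by_cases hy : y ∈ s
    · have h2 : (fun a => (I a).indicator (1 : ℝ → ℝ) y) = (Iio (g y)).indicator 1 := by
        funext a
        by_cases ha : a < g y
        · rw [indicator_of_mem (show y ∈ I a from ⟨hy, ha⟩), indicator_of_mem (mem_Iio.2 ha)]; rfl
        · rw [indicator_of_notMem (fun hh : y ∈ I a => ha hh.2),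
            indicator_of_notMem (by simpa using ha)]
      rw [indicator_of_mem hy, h2, intervalIntegral.integral_of_le hB,
        ← integral_Icc_eq_integral_Ioc, integral_Icc_eq_integral_Ico,
        integral_indicator_one measurableSet_Iio,
        measureReal_restrict_apply measurableSet_Iio]
      have : Iio (g y) ∩ Ico 0 B = Ico 0 (g y) := by
        ext a; simp only [mem_inter_iff, mem_Iio, mem_Ico]
        have := h1 y hy
        constructor
        · rintro ⟨a1, a2, a3⟩; exact ⟨a2, a1⟩
        · rintro ⟨a1, a2⟩; exact ⟨a2, a1, by linarith⟩
      rw [this, measureReal_def, Real.volume_Ico, sub_zero, ENNReal.toReal_ofReal (h0 y hy)]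
    · have h2 : ∀ a, (I a).indicator (1 : ℝ → ℝ) y = 0 := fun a =>
        indicator_of_notMem (fun hh : y ∈ I a => hy hh.1) _
      simp [indicator_of_notMem hy, h2]
  have hint : ∀ y, IntervalIntegrable (fun a => (I a).indicator (1 : ℝ → ℝ) y) volume 0 B := by
    intro y
    have hanti : Antitone fun a => (I a).indicator (1 : ℝ → ℝ) y := by
      intro a b hab
      refine indicator_le_indicator_of_subset ?_ (fun _ => zero_le_one) y
      exact fun w hw => ⟨hw.1, hab.trans_lt hw.2⟩
    exact hanti.intervalIntegrable
  have : ∑ i ∈ F, c i * s.indicator g (x i) =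
      ∫ a in (0 : ℝ)..B, ∑ i ∈ F, c i * (I a).indicator 1 (x i) := by
    rw [intervalIntegral.integral_finsetSum]
    · refine Finset.sum_congr rfl fun i _ => ?_
      rw [intervalIntegral.integral_const_mul, key]
    · exact fun i _ => (hint _).const_mul _
  rw [this]
  have h3 := intervalIntegral.norm_integral_le_of_norm_le_const (a := (0 : ℝ)) (b := B) (C := ε)
    (f := fun a => ∑ i ∈ F, c i * (I a).indicator 1 (x i))
    (fun a _ => by
      rw [Real.norm_eq_abs]
      exact h _ (hI a) fun w hw => hw.1)
  rw [Real.norm_eq_abs, sub_zero, abs_of_nonneg hB, mul_comm] at h3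
  exact h3

/-- Jordan decomposition into two monotone functions. Subtracting the same constant from both makes
them nonnegative on the interval and leaves their difference unchanged. -/
theorem BoundedVariationOn.exists_layeredOn {f : ℝ → ℝ} (hf : BoundedVariationOn f (Icc (-1) 1))
    (h0 : ∀ x, x ∉ Icc (-1 : ℝ) 1 → f x = 0) :
    ∃ B, 0 ≤ B ∧ LayeredOn (Icc (-1) 1) B f := by
  obtain ⟨p, q, hp, hq, rfl⟩ := hf.locallyBoundedVariationOn.exists_monotoneOn_sub_monotoneOn
  have hm : (-1 : ℝ) ∈ Icc (-1 : ℝ) 1 := by simp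
  have hM : (1 : ℝ) ∈ Icc (-1 : ℝ) 1 := by simp
  set a : ℝ := min (p (-1)) (q (-1)) with ha
  set b : ℝ := max (p 1) (q 1) with hb
  have hpb : ∀ x ∈ Icc (-1 : ℝ) 1, a ≤ p x ∧ p x ≤ b := fun x hx =>
    ⟨(min_le_left _ _).trans (hp hm hx hx.1), (hp hx hM hx.2).trans (le_max_left _ _)⟩
  have hqb : ∀ x ∈ Icc (-1 : ℝ) 1, a ≤ q x ∧ q x ≤ b := fun x hx =>
    ⟨(min_le_right _ _).trans (hq hm hx hx.1), (hq hx hM hx.2).trans (le_max_right _ _)⟩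
  have hab : 0 ≤ b - a := by have := hpb 1 hM; linarith
  refine ⟨(b - a) + (b - a), by linarith, ?_⟩
  have e : p - q = (Icc (-1) 1).indicator (fun x => p x - a) -
      (Icc (-1) 1).indicator (fun x => q x - a) := by
    funext x
    by_cases hx : x ∈ Icc (-1 : ℝ) 1
    · simp only [Pi.sub_apply, indicator_of_mem hx]; ring
    · rw [h0 x hx]; simp only [Pi.sub_apply, indicator_of_notMem hx]; ring
  rw [e]
  refine LayeredOn.sub (LayeredOn.of_monotoneOn ordConnected_Icc hab ?_ ?_ ?_)
    (LayeredOn.of_monotoneOn ordConnected_Icc hab ?_ ?_ ?_)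
  · exact fun x hx y hy hxy => by have := hp hx hy hxy; linarith
  · exact fun x hx => by linarith [(hpb x hx).1]
  · exact fun x hx => by linarith [(hpb x hx).2]
  · exact fun x hx y hy hxy => by have := hq hx hy hxy; linarith
  · exact fun x hx => by linarith [(hqb x hx).1]
  · exact fun x hx => by linarith [(hqb x hx).2]

/-- Weighted sums of tensor products are controlled by weighted counts over boxes. -/
theorem abs_sum_mul_prod_le_of_layeredOn {d : ℕ} {s : Set ℝ} {B : Fin d → ℝ} {f : Fin d → ℝ → ℝ}
    (hf : ∀ k, LayeredOn s (B k) (f k)) {ι : Type} (F : Finset ι) (c : ι → ℝ)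
    (x : ι → Fin d → ℝ) (ε : ℝ)
    (h : ∀ I : Fin d → Set ℝ, (∀ k, (I k).OrdConnected) → (∀ k, I k ⊆ s) →
      |∑ i ∈ F, c i * ∏ k, (I k).indicator 1 (x i k)| ≤ ε) :
    |∑ i ∈ F, c i * ∏ k, f k (x i k)| ≤ (∏ k, B k) * ε := by
  classical
  -- Indicators are exchanged for the functions `f k` one coordinate at a time. When coordinate `k₀`
  -- is exchanged, the remaining factors are absorbed into the weights.
  have main : ∀ S : Finset (Fin d), ∀ I : Fin d → Set ℝ, (∀ k, (I k).OrdConnected) →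
      (∀ k, I k ⊆ s) →
      |∑ i ∈ F, c i * ∏ k, (if k ∈ S then f k (x i k) else (I k).indicator 1 (x i k))| ≤
        (∏ k ∈ S, B k) * ε := by
    intro S
    induction S using Finset.induction_on with
    | empty => intro I h1 h2; simpa using h I h1 h2
    | insert k₀ S hk ih =>
      intro I h1 h2
      have e : ∀ (J : Fin d → Set ℝ) (S' : Finset (Fin d)) i,
          (∏ k, (if k ∈ S' then f k (x i k) else (J k).indicator 1 (x i k))) =
          (if k₀ ∈ S' then f k₀ (x i k₀) else (J k₀).indicator 1 (x i k₀)) *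
          ∏ k ∈ Finset.univ.erase k₀,
            (if k ∈ S' then f k (x i k) else (J k).indicator 1 (x i k)) := fun J S' i =>
        (Finset.mul_prod_erase _ _ (Finset.mem_univ k₀)).symm
      set r : ι → ℝ := fun i => ∏ k ∈ Finset.univ.erase k₀,
            (if k ∈ S then f k (x i k) else (I k).indicator 1 (x i k)) with hr
      have := hf k₀ ι F (fun i => c i * r i) (fun i => x i k₀) ((∏ k ∈ S, B k) * ε) ?_
      · rw [Finset.prod_insert hk, mul_assoc]
        convert this using 3 with i hi
        rw [e, if_pos (Finset.mem_insert_self _ _), mul_assoc, mul_comm (f k₀ _)]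
        congr 2
        refine Finset.prod_congr rfl fun k hk' => ?_
        have : k ≠ k₀ := Finset.ne_of_mem_erase hk'
        simp [Finset.mem_insert, this]
      · intro J hJ hJs
        have := ih (Function.update I k₀ J) ?_ ?_
        · convert this using 3 with i hi
          rw [e, if_neg hk, Function.update_self, mul_assoc, mul_comm (J.indicator _ _)]
          congr 2
          refine Finset.prod_congr rfl fun k hk' => ?_
          have : k ≠ k₀ := Finset.ne_of_mem_erase hk'
          rw [Function.update_of_ne this]
        · intro k
          by_cases hkk : k = k₀
          · subst hkk; simpa using hJ
          · simpa [Function.update_of_ne hkk] using h1 k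
        · intro k
          by_cases hkk : k = k₀
          · subst hkk; simpa using hJs
          · simpa [Function.update_of_ne hkk] using h2 k
  have := main Finset.univ (fun _ => ∅) (fun _ => ordConnected_empty) (fun _ => empty_subset _)
  simpa using this

/-! ### Kernels -/

/-- The score of a linear coefficient carries the factor `K u * u`, also of bounded variation. One
common constant serves for tensor products that mix both functions. -/
theorem IsKernel.exists_layeredOn {K : ℝ → ℝ} (hK : IsKernel K) :
    ∃ B, 0 ≤ B ∧ LayeredOn (Icc (-1) 1) B K ∧ LayeredOn (Icc (-1) 1) B fun u => K u * u := by
  obtain ⟨B₁, h1, h1'⟩ := hK.bv.exists_layeredOn hK.support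
  obtain ⟨B₂, h2, h2'⟩ := (hK.bv.mul (BoundedVariationOn.id_Icc (-1) 1)).exists_layeredOn
    (fun x hx => by simp [hK.support x hx])
  refine ⟨max B₁ B₂, h1.trans (le_max_left _ _), ?_, ?_⟩
  · intro ι F c x ε h
    -- The empty set is an admissible test set, which forces `ε` to be nonnegative.
    have hε : 0 ≤ ε := (abs_nonneg _).trans (h ∅ ordConnected_empty (empty_subset _))
    exact (h1' ι F c x ε h).trans (mul_le_mul_of_nonneg_right (le_max_left _ _) hε)
  · intro ι F c x ε h
    have hε : 0 ≤ ε := (abs_nonneg _).trans (h ∅ ordConnected_empty (empty_subset _))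
    exact (h2' ι F c x ε h).trans (mul_le_mul_of_nonneg_right (le_max_right _ _) hε)

/-- A function of bounded variation is differentiable, hence continuous, almost everywhere; having
integral one, `K` is positive at some interior continuity point `x ≠ 0`. It stays above `K x / 2`
nearby, and symmetry carries this to `-x`. As `K` may vanish around zero, the bound holds on an
annulus only. -/
theorem IsKernel.exists_pos_lower_bound {K : ℝ → ℝ} (hK : IsKernel K) :
    ∃ α β c : ℝ, 0 ≤ α ∧ α < β ∧ β ≤ 1 ∧ 0 < c ∧ ∀ u, α ≤ |u| → |u| ≤ β → c ≤ K u := by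
  have hd : ∀ᵐ x, x ∈ Icc (-1 : ℝ) 1 → DifferentiableWithinAt ℝ K (Icc (-1) 1) x :=
    hK.bv.locallyBoundedVariationOn.ae_differentiableWithinAt_of_mem
  have hne : ∀ a : ℝ, ∀ᵐ x : ℝ, x ≠ a := fun a => by
    simp [ae_iff, measure_singleton]
  have hex : ∃ x ∈ Ioo (-1 : ℝ) 1, x ≠ 0 ∧ 0 < K x ∧ DifferentiableWithinAt ℝ K (Icc (-1) 1) x := by
    by_contra hcon
    push Not at hcon
    have h0 : ∫ u in Icc (-1 : ℝ) 1, K u = 0 := by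
      refine setIntegral_eq_zero_of_ae_eq_zero (f := K) (t := Icc (-1 : ℝ) 1) ?_
      filter_upwards [hd, hne 0, hne 1, hne (-1)] with x h1 h2 h3 h4 hx
      by_contra hx0
      have hpos : 0 < K x := lt_of_le_of_ne (hK.nonneg x) (Ne.symm hx0)
      exact hcon x ⟨lt_of_le_of_ne hx.1 (Ne.symm h4), lt_of_le_of_ne hx.2 h3⟩ h2 hpos (h1 hx)
    rw [hK.integral_eq_one] at h0
    exact one_ne_zero h0
  obtain ⟨x, hx, hx0, hKx, hdx⟩ := hex
  have hc : ContinuousAt K x := hdx.continuousWithinAt.continuousAt (Icc_mem_nhds hx.1 hx.2)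
  have hev : ∀ᶠ u in 𝓝 x, K x / 2 < K u := hc.eventually (lt_mem_nhds (by linarith))
  obtain ⟨δ, hδ, hball⟩ := Metric.eventually_nhds_iff.1 hev
  have hxa : 0 < |x| := abs_pos.2 hx0
  have hx1 : |x| < 1 := abs_lt.2 hx
  refine ⟨|x|, min 1 (|x| + δ / 2), K x / 2, hxa.le, ?_, min_le_left _ _, by linarith, ?_⟩
  · exact lt_min hx1 (by linarith)
  · intro u h1 h2
    have h3 : |u| ≤ |x| + δ / 2 := h2.trans (min_le_right _ _)
    by_cases hs : dist u x < δ
    · exact (hball hs).le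
    · rw [← hK.symm u]
      refine (hball ?_).le
      rw [Real.dist_eq] at hs ⊢
      push Not at hs
      rcases abs_cases u with ⟨a, b⟩ | ⟨a, b⟩ <;> rcases abs_cases x with ⟨a', b'⟩ | ⟨a', b'⟩ <;>
        rw [a, a'] at h1 h3 <;> rw [abs_lt] <;> (try constructor) <;>
        (first | linarith | (exfalso; rw [le_abs'] at hs; rcases hs with hs | hs <;> linarith))

/-! ### The optimal order of the sparse rate -/

theorem logRatio_pos {n : ℕ} (hn : 2 ≤ n) : 0 < logRatio n := by
  have : (1 : ℝ) < n := by exact_mod_cast hn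
  exact div_pos (Real.log_pos this) (by linarith)

theorem logRatio_nonneg (n : ℕ) : 0 ≤ logRatio n :=
  div_nonneg (Real.log_natCast_nonneg n) (Nat.cast_nonneg n)

theorem tendsto_logRatio : Tendsto logRatio atTop (𝓝 0) := by
  have h := (Real.isLittleO_log_id_atTop.tendsto_div_nhds_zero).comp
    (tendsto_natCast_atTop_atTop (R := ℝ))
  exact h

theorem sparseRate_eq (p : ℕ) (h : ℕ → ℝ) (n : ℕ) :
    sparseRate p h n = h n ^ 2 + √(logRatio n / h n ^ (p + 1)) := by
  rw [sparseRate, ← Real.sqrt_eq_rpow, logRatio, div_div]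

theorem rpow_one_div_pow {x : ℝ} (hx : 0 ≤ x) (a : ℝ) (k : ℕ) :
    (x ^ (1 / a)) ^ k = x ^ (k / a) := by
  rw [← Real.rpow_mul_natCast hx]
  congr 1; ring

/-- At the bandwidth ρ^(1/(p+5)) the stochastic term equals the squared bandwidth: (1 - (p+1)/(p+5))
/ 2 = 2/(p+5). -/
theorem sqrt_div_rpow {p : ℕ} {ρ : ℝ} (hρ : 0 < ρ) :
    √(ρ / (ρ ^ (1 / ((p : ℝ) + 5))) ^ (p + 1)) = ρ ^ (2 / ((p : ℝ) + 5)) := by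
  have hp : (0 : ℝ) < p + 5 := by positivity
  rw [rpow_one_div_pow hρ.le]
  nth_rewrite 1 [← Real.rpow_one ρ]
  rw [← Real.rpow_sub hρ, Real.sqrt_eq_rpow, ← Real.rpow_mul hρ.le]
  congr 1
  push_cast
  field_simp
  ring

/-- The bias term increases and the stochastic term decreases in `h`, and they agree at the balanced
bandwidth. On either side of it one of the two alone dominates the balanced value. -/
theorem rpow_le_sparseRate {p : ℕ} {h : ℕ → ℝ} {n : ℕ} (hh : 0 < h n) (hn : 2 ≤ n) :
    logRatio n ^ (2 / ((p : ℝ) + 5)) ≤ sparseRate p h n := by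
  have hρ := logRatio_pos hn
  set ρ := logRatio n
  have hp : (0 : ℝ) < p + 5 := by positivity
  rw [sparseRate_eq]
  by_cases hc : ρ ^ (1 / ((p : ℝ) + 5)) ≤ h n
  · have h1 : ρ ^ (2 / ((p : ℝ) + 5)) = (ρ ^ (1 / ((p : ℝ) + 5))) ^ 2 := by
      rw [rpow_one_div_pow hρ.le]; norm_num
    have h2 : (ρ ^ (1 / ((p : ℝ) + 5))) ^ 2 ≤ h n ^ 2 := by gcongr
    rw [h1]
    linarith [Real.sqrt_nonneg (ρ / h n ^ (p + 1))]
  · push Not at hc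
    rw [← sqrt_div_rpow hρ]
    have : √(ρ / (ρ ^ (1 / ((p : ℝ) + 5))) ^ (p + 1)) ≤ √(ρ / h n ^ (p + 1)) := by
      gcongr
    nlinarith [sq_nonneg (h n)]

theorem sparseRate_nonneg (p : ℕ) (h : ℕ → ℝ) (n : ℕ) : 0 ≤ sparseRate p h n := by
  rw [sparseRate_eq]; positivity

theorem rpow_isBigO_sparseRate {p : ℕ} {h : ℕ → ℝ} (hh : ∀ n, 0 < h n) :
    (fun n => logRatio n ^ (2 / ((p : ℝ) + 5))) =O[atTop] sparseRate p h := by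
  refine IsBigO.of_bound 1 ?_
  filter_upwards [eventually_ge_atTop 2] with n hn
  rw [one_mul, Real.norm_of_nonneg (Real.rpow_nonneg (logRatio_nonneg n) _),
    Real.norm_of_nonneg (sparseRate_nonneg p h n)]
  exact rpow_le_sparseRate (hh n) hn

theorem sparseRate_isBigO_of_isTheta {p : ℕ} {h : ℕ → ℝ} (hh : ∀ n, 0 < h n)
    (H : h =Θ[atTop] fun n => logRatio n ^ (1 / ((p : ℝ) + 5))) :
    sparseRate p h =O[atTop] fun n => logRatio n ^ (2 / ((p : ℝ) + 5)) := by
  obtain ⟨C, hC, h1⟩ := H.1.exists_pos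
  obtain ⟨D, hD, h2⟩ := H.2.exists_pos
  refine IsBigO.of_bound (C ^ 2 + √(D ^ (p + 1))) ?_
  filter_upwards [h1.bound, h2.bound, eventually_ge_atTop 2] with n h3 h4 hn
  have hρ := logRatio_pos hn
  set ρ := logRatio n
  rw [Real.norm_of_nonneg (sparseRate_nonneg p h n), Real.norm_of_nonneg (by positivity),
    sparseRate_eq]
  rw [Real.norm_of_nonneg (hh n).le, Real.norm_of_nonneg (by positivity)] at h3 h4
  have e1 : ρ ^ (2 / ((p : ℝ) + 5)) = (ρ ^ (1 / ((p : ℝ) + 5))) ^ 2 := by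
      rw [rpow_one_div_pow hρ.le]; norm_num
  have a1 : h n ^ 2 ≤ C ^ 2 * ρ ^ (2 / ((p : ℝ) + 5)) := by
    rw [e1, ← mul_pow]
    have := (hh n).le
    gcongr
  have a2 : √(ρ / h n ^ (p + 1)) ≤ √(D ^ (p + 1)) * ρ ^ (2 / ((p : ℝ) + 5)) := by
    rw [← sqrt_div_rpow hρ, ← Real.sqrt_mul (by positivity)]
    apply Real.sqrt_le_sqrt
    have hhn := hh n
    rw [mul_div_assoc', div_le_div_iff₀ (by positivity) (by positivity), mul_comm (D ^ _), mul_assoc, ← mul_pow]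
    gcongr
  linarith

/-- If the sum is of the optimal order, so is each summand from above: the square bounds `h` from
above, and the stochastic term, being decreasing in `h`, bounds it from below. -/
theorem sparseRate_isTheta_iff {p : ℕ} {h : ℕ → ℝ} (hh : ∀ n, 0 < h n) :
    sparseRate p h =Θ[atTop] (fun n => logRatio n ^ (2 / ((p : ℝ) + 5))) ↔
      h =Θ[atTop] (fun n => logRatio n ^ (1 / ((p : ℝ) + 5))) := by
  refine ⟨fun H => ?_, fun H => ⟨sparseRate_isBigO_of_isTheta hh H, rpow_isBigO_sparseRate hh⟩⟩
  obtain ⟨C, hC, h1⟩ := H.1.exists_pos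
  have key : ∀ᶠ n in atTop, 2 ≤ n ∧
      sparseRate p h n ≤ C * logRatio n ^ (2 / ((p : ℝ) + 5)) := by
    filter_upwards [h1.bound, eventually_ge_atTop 2] with n h3 hn
    refine ⟨hn, ?_⟩
    rwa [Real.norm_of_nonneg (sparseRate_nonneg p h n),
      Real.norm_of_nonneg (Real.rpow_nonneg (logRatio_nonneg n) _)] at h3
  constructor
  · refine IsBigO.of_bound (√C) ?_
    filter_upwards [key] with n ⟨hn, h3⟩
    have hρ := logRatio_pos hn
    set ρ := logRatio n
    rw [Real.norm_of_nonneg (hh n).le, Real.norm_of_nonneg (by positivity)]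
    have e1 : ρ ^ (2 / ((p : ℝ) + 5)) = (ρ ^ (1 / ((p : ℝ) + 5))) ^ 2 := by
      rw [rpow_one_div_pow hρ.le]; norm_num
    rw [sparseRate_eq, e1] at h3
    refine abs_le_of_sq_le_sq' ?_ (by positivity) |>.2
    rw [mul_pow, Real.sq_sqrt hC.le]
    linarith [Real.sqrt_nonneg (ρ / h n ^ (p + 1))]
  -- The estimate obtained is `g ^ (p + 1) ≤ C ^ 2 * h n ^ (p + 1)`. Since `C ^ 2 + 1 ≥ 1`, it is at
  -- most its own power of order `p + 1`, so no root of `C ^ 2` is needed.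
  · refine IsBigO.of_bound (C ^ 2 + 1) ?_
    filter_upwards [key] with n ⟨hn, h3⟩
    have hρ := logRatio_pos hn
    set ρ := logRatio n
    have hhn := hh n
    rw [Real.norm_of_nonneg (hh n).le, Real.norm_of_nonneg (by positivity)]
    set g := ρ ^ (1 / ((p : ℝ) + 5)) with hg
    have hg0 : 0 < g := by positivity
    rw [sparseRate_eq, ← sqrt_div_rpow hρ] at h3
    have h4 : √(ρ / h n ^ (p + 1)) ≤ √(C ^ 2 * (ρ / g ^ (p + 1))) := by
      rw [Real.sqrt_mul (by positivity), Real.sqrt_sq hC.le]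
      linarith [sq_nonneg (h n)]
    rw [Real.sqrt_le_sqrt_iff (by positivity), mul_div_assoc',
      div_le_div_iff₀ (by positivity) (by positivity), mul_comm (C ^ 2), mul_assoc,
      mul_le_mul_iff_right₀ hρ] at h4
    have h5 : g ^ (p + 1) ≤ ((C ^ 2 + 1) * h n) ^ (p + 1) := by
      rw [mul_pow]
      refine h4.trans ?_
      gcongr
      exact (by linarith : C ^ 2 ≤ C ^ 2 + 1).trans
        (le_self_pow₀ (by nlinarith [sq_nonneg C]) (by omega))
    exact le_of_pow_le_pow_left₀ (by omega) (by positivity) h5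

/-! ### Weighted least squares -/

/-- If the mass of the weights is spread over the corner boxes of an orthant, an affine function with
small weighted least squares loss has small coefficients. -/
theorem weighted_sq_lower_bound {d : ℕ} {ι : Type} (F : Finset ι) (w : ι → ℝ) (u : ι → Fin d → ℝ)
    (hw : ∀ i ∈ F, 0 ≤ w i) (s : Fin d → ℝ) (hs : ∀ k, s k * s k = 1) {α κ η : ℝ}
    (hα : 0 ≤ α) (hκ : 0 < κ) (hκ1 : α + 3 * κ ≤ 1)
    (hmass : ∀ e : Fin d → Bool, η ≤ ∑ i ∈ F, w i * ∏ k,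
      (if e k then Icc (α + 2 * κ) (α + 3 * κ) else Icc α (α + κ)).indicator 1 (s k * u i k))
    (θ₀ : ℝ) (θ : Fin d → ℝ) :
    η * (κ / 6) ^ 2 * (|θ₀| + ∑ k, |θ k|) ^ 2 ≤ ∑ i ∈ F, w i * (θ₀ + ∑ k, θ k * u i k) ^ 2 := by
  set J : Bool → Set ℝ := fun b => if b then Icc (α + 2 * κ) (α + 3 * κ) else Icc α (α + κ) with hJ
  have hJ1 : ∀ b, ∀ y ∈ J b, |y| ≤ 1 := by
    intro b y hy
    cases b <;> simp only [hJ, if_true, Bool.false_eq_true, if_false, mem_Icc] at hy <;> rw [abs_le] <;>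
      constructor <;> linarith [hy.1, hy.2]
  set S := ∑ k, |θ k| with hS
  have hS0 : 0 ≤ S := Finset.sum_nonneg fun _ _ => abs_nonneg _
  set τ : Fin d → ℝ := fun k => s k * θ k with hτ
  have hsabs : ∀ k, |s k| = 1 := fun k => by
    have h1 : |s k| * |s k| = 1 := by rw [← abs_mul, hs, abs_one]
    nlinarith [abs_nonneg (s k)]
  have hτabs : ∀ k, |τ k| = |θ k| := fun k => by rw [hτ]; simp [abs_mul, hsabs]
  -- Of the two opposite corner boxes, `e₁` makes every term of the linear part large and `e₂` makes
  -- it small. The threshold `m k` separates the values of the `k`-th term on the two, with a gap of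
  -- at least `κ * |θ k|`.
  let e₁ : Fin d → Bool := fun k => decide (0 ≤ τ k)
  let e₂ : Fin d → Bool := fun k => !decide (0 ≤ τ k)
  let m : Fin d → ℝ := fun k => τ k * (if 0 ≤ τ k then α + 2 * κ else α + κ)
  have hm1 : ∀ k, ∀ y ∈ J (e₁ k), m k ≤ τ k * y := by
    intro k y hy
    by_cases h : 0 ≤ τ k
    · simp only [hJ, e₁, h, decide_true, if_true, mem_Icc, m] at hy ⊢
      exact mul_le_mul_of_nonneg_left hy.1 h
    · simp only [hJ, e₁, h, decide_false, Bool.false_eq_true, if_false, mem_Icc, m] at hy ⊢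
      exact mul_le_mul_of_nonpos_left hy.2 (not_le.1 h).le
  have hm2 : ∀ k, ∀ y ∈ J (e₂ k), τ k * y ≤ m k - κ * |θ k| := by
    intro k y hy
    rw [← hτabs]
    by_cases h : 0 ≤ τ k
    · simp only [hJ, e₂, h, decide_true, Bool.not_true, if_true, Bool.false_eq_true, if_false, mem_Icc, m] at hy ⊢
      rw [abs_of_nonneg h]
      nlinarith [mul_le_mul_of_nonneg_left hy.2 h]
    · simp only [hJ, e₂, h, decide_false, Bool.not_false, if_true, if_false, mem_Icc, m] at hy ⊢
      rw [abs_of_neg (not_le.1 h)]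
      nlinarith [mul_le_mul_of_nonpos_left hy.1 (not_le.1 h).le]
  have hℓ : ∀ i, θ₀ + ∑ k, θ k * u i k = θ₀ + ∑ k, τ k * (s k * u i k) := by
    intro i
    congr 1
    refine Finset.sum_congr rfl fun k _ => ?_
    rw [hτ]; simp only
    calc θ k * u i k = (s k * s k) * (θ k * u i k) := by rw [hs, one_mul]
      _ = _ := by ring
  have hfar : ∀ (e : Fin d → Bool) (y : Fin d → ℝ), (∀ k, y k ∈ J (e k)) →
      |θ₀| - S ≤ |θ₀ + ∑ k, τ k * y k| := by
    intro e y hy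
    have h1 : |∑ k, τ k * y k| ≤ S := by
      refine (Finset.abs_sum_le_sum_abs _ _).trans (Finset.sum_le_sum fun k _ => ?_)
      rw [abs_mul, hτabs]
      exact mul_le_of_le_one_right (abs_nonneg _) (hJ1 _ _ (hy k))
    have h2 := abs_sub_abs_le_abs_sub θ₀ (-∑ k, τ k * y k)
    rw [sub_neg_eq_add, abs_neg] at h2
    linarith
  -- If `|θ₀| ≥ 2 * S`, the intercept dominates on every box. Otherwise the values on the boxes `e₁`
  -- and `e₂` are at least `κ * S` apart, so on one of them the affine function exceeds `κ / 2 * S`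
  -- in absolute value; as `|θ₀| + S < 3 * S`, this is where `κ / 6` comes from.
  have hbox : ∃ e : Fin d → Bool, ∀ y : Fin d → ℝ, (∀ k, y k ∈ J (e k)) →
      κ / 6 * (|θ₀| + S) ≤ |θ₀ + ∑ k, τ k * y k| := by
    have hκ3 : κ ≤ 1 / 3 := by linarith
    by_cases hc : 2 * S ≤ |θ₀|
    · refine ⟨e₁, fun y hy => le_trans ?_ (hfar e₁ y hy)⟩
      nlinarith [abs_nonneg θ₀]
    · have hlt : κ / 6 * (|θ₀| + S) ≤ κ / 2 * S := by nlinarith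
      by_cases hs2 : κ / 2 * S ≤ θ₀ + ∑ k, m k
      · refine ⟨e₁, fun y hy => ?_⟩
        have : ∑ k, m k ≤ ∑ k, τ k * y k := Finset.sum_le_sum fun k _ => hm1 k _ (hy k)
        exact hlt.trans ((by linarith : κ / 2 * S ≤ θ₀ + ∑ k, τ k * y k).trans (le_abs_self _))
      · refine ⟨e₂, fun y hy => ?_⟩
        have : ∑ k, τ k * y k ≤ ∑ k, (m k - κ * |θ k|) :=
          Finset.sum_le_sum fun k _ => hm2 k _ (hy k)
        rw [Finset.sum_sub_distrib, ← Finset.mul_sum, ← hS] at this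
        exact hlt.trans ((by linarith : κ / 2 * S ≤ -(θ₀ + ∑ k, τ k * y k)).trans (neg_le_abs _))
  obtain ⟨e, he⟩ := hbox
  have hG : 0 ≤ κ / 6 * (|θ₀| + S) := by positivity
  calc η * (κ / 6) ^ 2 * (|θ₀| + S) ^ 2 = η * (κ / 6 * (|θ₀| + S)) ^ 2 := by ring
    _ ≤ (∑ i ∈ F, w i * ∏ k, (J (e k)).indicator 1 (s k * u i k)) * (κ / 6 * (|θ₀| + S)) ^ 2 := by
        gcongr
        exact hmass e
    _ = ∑ i ∈ F, (w i * ∏ k, (J (e k)).indicator 1 (s k * u i k)) * (κ / 6 * (|θ₀| + S)) ^ 2 :=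
        Finset.sum_mul _ _ _
    _ ≤ _ := by
        refine Finset.sum_le_sum fun i hi => ?_
        by_cases hin : ∀ k, s k * u i k ∈ J (e k)
        · have : ∏ k, (J (e k)).indicator (1 : ℝ → ℝ) (s k * u i k) = 1 :=
            Finset.prod_eq_one fun k _ => by simp [hin k]
          rw [this, mul_one]
          refine mul_le_mul_of_nonneg_left ?_ (hw i hi)
          rw [hℓ, ← sq_abs (θ₀ + _)]
          exact pow_le_pow_left₀ hG (he _ hin) 2
        · push Not at hin
          obtain ⟨k, hk⟩ := hin
          have : ∏ k, (J (e k)).indicator (1 : ℝ → ℝ) (s k * u i k) = 0 :=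
            Finset.prod_eq_zero (Finset.mem_univ k) (by simp [hk])
          rw [this, mul_zero, zero_mul]
          exact mul_nonneg (hw i hi) (sq_nonneg _)

/-- A fit that is at least as good as zero has coefficients controlled by the score at zero. -/
theorem abs_intercept_le_of_loss_le {d : ℕ} {ι : Type} (F : Finset ι) (w ρ : ι → ℝ)
    (u : ι → Fin d → ℝ)
    (hw : ∀ i ∈ F, 0 ≤ w i) (s : Fin d → ℝ) (hs : ∀ k, s k * s k = 1) {α κ η R : ℝ}
    (hα : 0 ≤ α) (hκ : 0 < κ) (hκ1 : α + 3 * κ ≤ 1) (hη : 0 < η)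
    (hmass : ∀ e : Fin d → Bool, η ≤ ∑ i ∈ F, w i * ∏ k,
      (if e k then Icc (α + 2 * κ) (α + 3 * κ) else Icc α (α + κ)).indicator 1 (s k * u i k))
    (θ₀ : ℝ) (θ : Fin d → ℝ)
    (h0 : |∑ i ∈ F, w i * ρ i| ≤ R) (h1 : ∀ k, |∑ i ∈ F, w i * ρ i * u i k| ≤ R)
    (hloss : ∑ i ∈ F, w i * (ρ i - (θ₀ + ∑ k, θ k * u i k)) ^ 2 ≤ ∑ i ∈ F, w i * ρ i ^ 2) :
    |θ₀| ≤ 2 * R / (η * (κ / 6) ^ 2) := by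
  have hlow := weighted_sq_lower_bound F w u hw s hs hα hκ hκ1 hmass θ₀ θ
  set G := |θ₀| + ∑ k, |θ k| with hG
  have hGθ : |θ₀| ≤ G := le_add_of_nonneg_right (Finset.sum_nonneg fun _ _ => abs_nonneg _)
  have hR : 0 ≤ R := (abs_nonneg _).trans h0
  have e1 : ∑ i ∈ F, w i * (ρ i - (θ₀ + ∑ k, θ k * u i k)) ^ 2 = ∑ i ∈ F, w i * ρ i ^ 2 -
      2 * (θ₀ * ∑ i ∈ F, w i * ρ i + ∑ k, θ k * ∑ i ∈ F, w i * ρ i * u i k) +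
      ∑ i ∈ F, w i * (θ₀ + ∑ k, θ k * u i k) ^ 2 := by
    have : ∑ k, θ k * ∑ i ∈ F, w i * ρ i * u i k = ∑ i ∈ F, w i * ρ i * ∑ k, θ k * u i k := by
      simp_rw [Finset.mul_sum]
      rw [Finset.sum_comm]
      exact Finset.sum_congr rfl fun i _ => Finset.sum_congr rfl fun k _ => by ring
    rw [this, Finset.mul_sum, ← Finset.sum_add_distrib, Finset.mul_sum, ← Finset.sum_sub_distrib,
      ← Finset.sum_add_distrib]
    exact Finset.sum_congr rfl fun i _ => by ring
  have e2 : θ₀ * ∑ i ∈ F, w i * ρ i + ∑ k, θ k * ∑ i ∈ F, w i * ρ i * u i k ≤ R * G := by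
    rw [hG, mul_add, Finset.mul_sum Finset.univ (fun k => |θ k|) R]
    refine add_le_add ?_ (Finset.sum_le_sum fun k _ => ?_)
    · refine (le_abs_self _).trans ?_
      rw [abs_mul, mul_comm]; gcongr
    · refine (le_abs_self _).trans ?_
      rw [abs_mul, mul_comm]; gcongr; exact h1 k
  -- Coercivity from below, and from above the cross term left after cancelling the common sum of
  -- squares; dividing by `G` bounds all coefficients at once.
  have e3 : η * (κ / 6) ^ 2 * G ^ 2 ≤ 2 * R * G := by linarith
  have hc : 0 < η * (κ / 6) ^ 2 := by positivity
  refine hGθ.trans ?_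
  rw [le_div_iff₀ hc]
  rcases (by positivity : 0 ≤ G).eq_or_lt with h | h
  · rw [← h]; linarith
  · nlinarith

/-- Taylor's formula with second order remainder on a convex set, within derivatives. -/
theorem norm_sub_fderivWithin_le {E : Type*} [NormedAddCommGroup E] [NormedSpace ℝ E] {f : E → ℝ}
    {s : Set E} (hs : Convex ℝ s) (h1 : DifferentiableOn ℝ f s)
    (h2 : DifferentiableOn ℝ (fderivWithin ℝ f s) s) {C : ℝ}
    (hC : ∀ x ∈ s, ‖fderivWithin ℝ (fderivWithin ℝ f s) s x‖ ≤ C) {x y : E} (hx : x ∈ s)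
    (hy : y ∈ s) : |f y - f x - fderivWithin ℝ f s x (y - x)| ≤ C * ‖y - x‖ ^ 2 := by
  have hC0 : 0 ≤ C := le_trans (norm_nonneg (fderivWithin ℝ (fderivWithin ℝ f s) s x)) (hC x hx)
  have hlip : ∀ z ∈ s, ‖fderivWithin ℝ f s z - fderivWithin ℝ f s x‖ ≤ C * ‖z - x‖ :=
    fun z hz => hs.norm_image_sub_le_of_norm_fderivWithin_le h2 hC hx hz
  -- On this convex set the derivative differs from the one at `x` by at most `C * ‖y - x‖`, so the
  -- mean value inequality yields the remainder with constant `C`; the sharper `C / 2` is not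
  -- needed.
  have hconv : Convex ℝ (s ∩ Metric.closedBall x ‖y - x‖) := hs.inter (convex_closedBall _ _)
  have := hconv.norm_image_sub_le_of_norm_hasFDerivWithin_le' (f := f)
    (f' := fderivWithin ℝ f s) (φ := fderivWithin ℝ f s x) (C := C * ‖y - x‖)
    (fun z hz => (h1 z hz.1).hasFDerivWithinAt.mono inter_subset_left)
    (fun z hz => (hlip z hz.1).trans (mul_le_mul_of_nonneg_left
      (by simpa [dist_eq_norm] using hz.2) hC0)) (x := x) (y := y)
    ⟨hx, by simp⟩ ⟨hy, by simp [dist_eq_norm]⟩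
  rw [Real.norm_eq_abs] at this
  linarith [this]

/-! ### Exponential inequalities -/

section Concentration

variable {Ω : Type*} [MeasurableSpace Ω] {P : Measure Ω} [IsProbabilityMeasure P]

/-- Borel–Cantelli. The events are emptied below `n₀`, since the probability bound is only available
for large `n`. -/
theorem ae_eventually_of_summable {q : ℕ → Ω → Prop} {f : ℕ → ℝ} (hf : Summable f)
    (h : ∀ᶠ n in atTop, P.real {ω | ¬ q n ω} ≤ f n) : ∀ᵐ ω ∂P, ∀ᶠ n in atTop, q n ω := by
  obtain ⟨n₀, hn₀⟩ := eventually_atTop.1 h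
  have hs : ∑' n, P {ω | n₀ ≤ n ∧ ¬ q n ω} ≠ ∞ := by
    have hle : ∀ n, P {ω | n₀ ≤ n ∧ ¬ q n ω} ≤ ENNReal.ofReal |f n| := by
      intro n
      by_cases hn : n₀ ≤ n
      · simp only [hn, true_and]
        rw [← ofReal_measureReal]
        exact ENNReal.ofReal_le_ofReal ((hn₀ n hn).trans (le_abs_self _))
      · simp [hn]
    refine ne_top_of_le_ne_top ?_ (ENNReal.tsum_le_tsum hle)
    exact hf.abs.tsum_ofReal_ne_top
  filter_upwards [ae_eventually_notMem hs] with ω hω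
  filter_upwards [hω, eventually_ge_atTop n₀] with n h1 h2
  by_contra hc
  exact h1 ⟨h2, hc⟩

/-- Chernoff's method with exp x ≤ 1 + x + x² for |x| ≤ 1: a centred bounded variable then has
moment generating function at most 1 + t²v ≤ exp (t²v). -/
theorem measureReal_sum_ge_le {X : ℕ → Ω → ℝ} (hind : iIndepFun X P) (hX : ∀ i, Measurable (X i))
    {n : ℕ} {Q v t : ℝ} (hQ : ∀ i < n, ∀ ω, |X i ω| ≤ Q) (h0 : ∀ i < n, ∫ ω, X i ω ∂P = 0)
    (hv : ∀ i < n, ∫ ω, X i ω ^ 2 ∂P ≤ v) (ht : 0 ≤ t) (htQ : t * Q ≤ 1) (ε : ℝ) :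
    P.real {ω | ε ≤ ∑ i ∈ Finset.range n, X i ω} ≤ Real.exp (-t * ε + n * (t ^ 2 * v)) := by
  have hbd : ∀ i < n, ∀ ω, |t * X i ω| ≤ 1 := fun i hi ω => by
    rw [abs_mul, abs_of_nonneg ht]
    exact (mul_le_mul_of_nonneg_left (hQ i hi ω) ht).trans htQ
  have hint : ∀ i < n, Integrable (X i) P := fun i hi =>
    Integrable.of_bound (hX i).aestronglyMeasurable Q (ae_of_all _ (hQ i hi))
  have hint2 : ∀ i < n, Integrable (fun ω => X i ω ^ 2) P := fun i hi =>
    Integrable.of_bound ((hX i).pow_const 2).aestronglyMeasurable (Q ^ 2) (ae_of_all _ fun ω => by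
      rw [Real.norm_eq_abs, abs_pow]
      exact pow_le_pow_left₀ (abs_nonneg _) (hQ i hi ω) 2)
  have hexp : ∀ i < n, Integrable (fun ω => Real.exp (t * X i ω)) P := fun i hi =>
    Integrable.of_bound (by fun_prop) (Real.exp 1) (ae_of_all _ fun ω => by
      rw [Real.norm_eq_abs, Real.abs_exp]
      exact Real.exp_le_exp.2 ((le_abs_self _).trans (hbd i hi ω)))
  have hmgf : ∀ i < n, mgf (X i) P t ≤ Real.exp (t ^ 2 * v) := by
    intro i hi
    have h1 : mgf (X i) P t ≤ ∫ ω, (1 + t * X i ω + t ^ 2 * X i ω ^ 2) ∂P := by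
      refine integral_mono (hexp i hi) ?_ fun ω => ?_
      · exact ((integrable_const _).add ((hint i hi).const_mul t)).add ((hint2 i hi).const_mul _)
      · have := Real.abs_exp_sub_one_sub_id_le (hbd i hi ω)
        have := (le_abs_self _).trans this
        simp only
        nlinarith [this]
    have h2 : ∫ ω, (1 + t * X i ω + t ^ 2 * X i ω ^ 2) ∂P = 1 + t ^ 2 * ∫ ω, X i ω ^ 2 ∂P := by
      have i1 : Integrable (fun ω => 1 + t * X i ω) P :=
        (integrable_const _).add ((hint i hi).const_mul t)
      rw [integral_add i1 ((hint2 i hi).const_mul _), integral_add (integrable_const _) ((hint i hi).const_mul t),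
        integral_const_mul, integral_const_mul, h0 i hi]
      simp
    rw [h2] at h1
    have h3 := Real.add_one_le_exp (t ^ 2 * v)
    have h4 := mul_le_mul_of_nonneg_left (hv i hi) (sq_nonneg t)
    linarith
  have hsum : mgf (∑ i ∈ Finset.range n, X i) P t ≤ Real.exp (n * (t ^ 2 * v)) := by
    rw [hind.mgf_sum hX]
    calc _ ≤ ∏ i ∈ Finset.range n, Real.exp (t ^ 2 * v) :=
          Finset.prod_le_prod (fun _ _ => mgf_nonneg) fun i hi => hmgf i (Finset.mem_range.1 hi)
      _ = _ := by rw [Finset.prod_const, Finset.card_range, ← Real.exp_nat_mul]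
  have hsumint : Integrable (fun ω => Real.exp (t * (∑ i ∈ Finset.range n, X i) ω)) P :=
    hind.integrable_exp_mul_sum hX fun i hi => hexp i (Finset.mem_range.1 hi)
  have := measure_ge_le_exp_mul_mgf (μ := P) (X := ∑ i ∈ Finset.range n, X i) ε ht hsumint
  rw [Real.exp_add]
  simp only [Finset.sum_apply] at this
  exact this.trans (mul_le_mul_of_nonneg_left hsum (Real.exp_pos _).le)

/-- A Bernstein type inequality for averages of bounded nonnegative variables. -/
theorem measureReal_avg_deviation_le {Y : ℕ → Ω → ℝ} (hind : iIndepFun Y P)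
    (hY : ∀ i, Measurable (Y i)) {n : ℕ} (hn : 0 < n) {Q v L : ℝ} (h0 : ∀ i < n, ∀ ω, 0 ≤ Y i ω)
    (hQ : ∀ i < n, ∀ ω, Y i ω ≤ Q) (hv : ∀ i < n, ∫ ω, Y i ω ^ 2 ∂P ≤ v) (hv0 : 0 < v)
    (hL : 0 ≤ L) (hQL : Q ^ 2 * L ≤ n * v) (C : ℝ) :
    P.real {ω | C * √(v * L / n) ≤ |1 / (n : ℝ) * ∑ i ∈ Finset.range n, (Y i ω - ∫ ω', Y i ω' ∂P)|}
      ≤ 2 * Real.exp ((1 - C) * L) := by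
  have hn' : (0 : ℝ) < n := by exact_mod_cast hn
  -- With this `t` the variance term `n * t ^ 2 * v` equals `L`, the linear term equals `C * L`, and
  -- `t * Q ≤ 1` is the hypothesis `Q ^ 2 * L ≤ n * v`.
  set t := √(L / (n * v)) with ht
  have htsq : t ^ 2 = L / (n * v) := Real.sq_sqrt (by positivity)
  have htε : t * (C * n * √(v * L / n)) = C * L := by
    have : t * √(v * L / n) = L / n := by
      rw [ht, ← Real.sqrt_mul (by positivity), show L / (n * v) * (v * L / n) = (L / n) ^ 2 by
        field_simp, Real.sqrt_sq (by positivity)]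
    calc _ = C * n * (t * √(v * L / n)) := by ring
      _ = _ := by rw [this]; field_simp
  have hmeanb : ∀ i < n, 0 ≤ ∫ ω, Y i ω ∂P ∧ ∫ ω, Y i ω ∂P ≤ Q := fun i hi => by
    have hi' : Integrable (Y i) P := Integrable.of_bound (hY i).aestronglyMeasurable Q
      (ae_of_all _ fun ω => by rw [Real.norm_of_nonneg (h0 i hi ω)]; exact hQ i hi ω)
    refine ⟨integral_nonneg (h0 i hi), ?_⟩
    calc ∫ ω, Y i ω ∂P ≤ ∫ _, Q ∂P := integral_mono hi' (integrable_const _) (hQ i hi)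
      _ = Q := by simp
  have hQ0 : 0 ≤ Q := (hmeanb 0 hn).1.trans (hmeanb 0 hn).2
  have htQ : t * Q ≤ 1 := by
    refine abs_le_of_sq_le_sq' ?_ zero_le_one |>.2
    rw [mul_pow, htsq, one_pow, div_mul_eq_mul_div, div_le_one (by positivity)]
    linarith
  have hone : ∀ s : ℝ, |s| = 1 → P.real {ω | C * n * √(v * L / n) ≤
      ∑ i ∈ Finset.range n, s * (Y i ω - ∫ ω', Y i ω' ∂P)} ≤ Real.exp ((1 - C) * L) := by
    intro s hs
    have h1 := measureReal_sum_ge_le (P := P) (X := fun i ω => s * (Y i ω - ∫ ω', Y i ω' ∂P))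
      (n := n) (Q := Q) (v := v) (t := t)
      (hind.comp (fun i y => s * (y - ∫ ω', Y i ω' ∂P)) (fun i => by fun_prop))
      (fun i => by have := hY i; fun_prop) ?_ ?_ ?_ (Real.sqrt_nonneg _) htQ (C * n * √(v * L / n))
    · refine h1.trans (Real.exp_le_exp.2 (le_of_eq ?_))
      rw [neg_mul, htε, htsq]
      field_simp
      ring
    · intro i hi ω
      rw [abs_mul, hs, one_mul, abs_le]
      have := hmeanb i hi
      constructor <;> linarith [h0 i hi ω, hQ i hi ω]
    · intro i hi
      have hi' : Integrable (Y i) P := Integrable.of_bound (hY i).aestronglyMeasurable Q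
        (ae_of_all _ fun ω => by rw [Real.norm_of_nonneg (h0 i hi ω)]; exact hQ i hi ω)
      rw [integral_const_mul, integral_sub hi' (integrable_const _)]
      simp
    · intro i hi
      have hs2 : s ^ 2 = 1 := by rw [← sq_abs, hs, one_pow]
      have hi' : MemLp (Y i) 2 P := MemLp.of_bound (hY i).aestronglyMeasurable Q
        (ae_of_all _ fun ω => by rw [Real.norm_of_nonneg (h0 i hi ω)]; exact hQ i hi ω)
      simp_rw [mul_pow, hs2, one_mul]
      have h2 := variance_le_expectation_sq (hY i).aestronglyMeasurable (μ := P)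
      rw [variance_eq_integral (hY i).aemeasurable] at h2
      exact h2.trans (hv i hi)
  have hsub : {ω | C * √(v * L / n) ≤ |1 / (n : ℝ) * ∑ i ∈ Finset.range n, (Y i ω - ∫ ω', Y i ω' ∂P)|}
      ⊆ {ω | C * n * √(v * L / n) ≤ ∑ i ∈ Finset.range n, 1 * (Y i ω - ∫ ω', Y i ω' ∂P)} ∪
        {ω | C * n * √(v * L / n) ≤ ∑ i ∈ Finset.range n, (-1) * (Y i ω - ∫ ω', Y i ω' ∂P)} := by
    intro ω hω
    simp only [mem_ofPred_eq, mem_union, ← Finset.mul_sum] at hω ⊢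
    rw [abs_mul, abs_of_pos (by positivity : (0 : ℝ) < 1 / n), one_div, ← div_eq_inv_mul,
      le_div_iff₀ hn'] at hω
    have : C * n * √(v * L / n) = C * √(v * L / n) * n := by ring
    rw [this]
    rcases le_abs.1 hω with h | h
    · left; linarith
    · right; linarith
  calc _ ≤ _ := measureReal_mono hsub
    _ ≤ _ := measureReal_union_le _ _
    _ ≤ _ := by linarith [hone 1 (by simp), hone (-1) (by simp)]

end Concentration

/-! ### Uniform deviations over boxes -/

/-- Average of the weights of those points that lie in `A`. -/
noncomputable def boxAvg {E : Type*} {d : ℕ} (N : ℕ) (w : ℕ → E → ℝ) (x : ℕ → E → Fin d → ℝ)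
    (A : Set (Fin d → ℝ)) (e : E) : ℝ :=
  (1 / (N : ℝ)) * ∑ j ∈ Finset.range N, A.indicator (fun _ => w j e) (x j e)

/-- The points whose coordinates, in units of `1 / n`, have integer parts between `a` and `b`. -/
def gridBox {d : ℕ} (n : ℕ) (a b : Fin d → ℤ) : Set (Fin d → ℝ) :=
  {y | ∀ k, a k ≤ ⌊n * y k⌋ ∧ ⌊n * y k⌋ ≤ b k}

theorem measurableSet_gridBox {d : ℕ} (n : ℕ) (a b : Fin d → ℤ) :
    MeasurableSet (gridBox n a b) := by
  have : gridBox n a b = ⋂ k, {y : Fin d → ℝ | ⌊n * y k⌋ ∈ Icc (a k) (b k)} := by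
    ext y; simp [gridBox]
  rw [this]
  refine MeasurableSet.iInter fun k => ?_
  have : Measurable fun y : Fin d → ℝ => ⌊(n : ℝ) * y k⌋ := by
    exact Int.measurable_floor.comp (by fun_prop)
  exact this measurableSet_Icc

/-- Take the cells of the infimum and the supremum of `I`. A point of a cell strictly in between
lies strictly between infimum and supremum, hence in `I`. The inner and outer approximations thus
differ by the two end cells only. -/
theorem exists_grid_sandwich {I : Set ℝ} (hI : I.OrdConnected) (hne : I.Nonempty) {R : ℕ}
    (hR : I ⊆ Icc (-(R : ℝ)) R) {h : ℝ} (hh : ∀ y ∈ I, ∀ z ∈ I, z - y ≤ 2 * h) (n : ℕ) :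
    ∃ a b : ℤ, -((n : ℤ) * R) ≤ a ∧ b ≤ (n : ℤ) * R ∧ a ≤ b ∧ (b - a + 1 : ℝ) ≤ 2 * (n * h) + 2 ∧
      (∀ y ∈ I, a ≤ ⌊n * y⌋ ∧ ⌊n * y⌋ ≤ b) ∧
      ∀ y : ℝ, a + 1 ≤ ⌊n * y⌋ → ⌊n * y⌋ ≤ b - 1 → y ∈ I := by
  have hbb : BddBelow I := ⟨_, fun y hy => (hR hy).1⟩
  have hba : BddAbove I := ⟨_, fun y hy => (hR hy).2⟩
  have hn : (0 : ℝ) ≤ n := Nat.cast_nonneg n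
  have h1 : -(R : ℝ) ≤ sInf I := le_csInf hne fun y hy => (hR hy).1
  have h2 : sSup I ≤ R := csSup_le hne fun y hy => (hR hy).2
  have h3 : sSup I - sInf I ≤ 2 * h := by
    have : sSup I ≤ sInf I + 2 * h := by
      refine csSup_le hne fun z hz => ?_
      have : z - 2 * h ≤ sInf I := le_csInf hne fun y hy => by linarith [hh y hy z hz]
      linarith
    linarith
  have h4 : sInf I ≤ sSup I := csInf_le_csSup hne hbb hba
  refine ⟨⌊n * sInf I⌋, ⌊n * sSup I⌋, ?_, ?_, ?_, ?_, ?_, ?_⟩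
  · rw [Int.le_floor]; push_cast; nlinarith
  · have : (⌊n * sSup I⌋ : ℝ) ≤ (n : ℝ) * R := (Int.floor_le _).trans (by nlinarith)
    exact_mod_cast this
  · exact Int.floor_le_floor (by nlinarith)
  · have := Int.floor_le (n * sSup I)
    have := Int.lt_floor_add_one (n * sInf I)
    nlinarith
  · intro y hy
    have := csInf_le hbb hy
    have := le_csSup hba hy
    exact ⟨Int.floor_le_floor (by nlinarith), Int.floor_le_floor (by nlinarith)⟩
  · intro y ha hb
    have g1 : n * sInf I < n * y := by
      have e1 := Int.lt_floor_add_one (n * sInf I)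
      have e2 : ((⌊n * sInf I⌋ + 1 : ℤ) : ℝ) ≤ n * y := Int.le_floor.1 ha
      push_cast at e2; linarith
    have g2 : n * y < n * sSup I := by
      have e1 := Int.floor_le (n * sSup I)
      have e2 := Int.lt_floor_add_one ((n : ℝ) * y)
      have e3 : (⌊(n : ℝ) * y⌋ : ℝ) ≤ ⌊n * sSup I⌋ - 1 := by exact_mod_cast hb
      linarith
    have g3 : sInf I < y := lt_of_mul_lt_mul_left g1 hn
    have g4 : y < sSup I := lt_of_mul_lt_mul_left g2 hn
    obtain ⟨u, hu, hu'⟩ := exists_lt_of_csInf_lt hne g3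
    obtain ⟨z, hz, hz'⟩ := exists_lt_of_lt_csSup hne g4
    exact hI.out hu hz ⟨hu'.le, hz'.le⟩

theorem boxAvg_nonneg {E : Type*} {d : ℕ} {N : ℕ} {w : ℕ → E → ℝ} {x : ℕ → E → Fin d → ℝ} {e : E}
    (hw : ∀ j, 0 ≤ w j e) (A : Set (Fin d → ℝ)) : 0 ≤ boxAvg N w x A e :=
  mul_nonneg (by positivity) (Finset.sum_nonneg fun _ _ => indicator_nonneg (fun _ _ => hw _) _)

theorem boxAvg_mono {E : Type*} {d : ℕ} {N : ℕ} {w : ℕ → E → ℝ} {x : ℕ → E → Fin d → ℝ} {e : E}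
    (hw : ∀ j, 0 ≤ w j e) {A B : Set (Fin d → ℝ)} (h : A ⊆ B) :
    boxAvg N w x A e ≤ boxAvg N w x B e :=
  mul_le_mul_of_nonneg_left (Finset.sum_le_sum fun _ _ =>
    indicator_le_indicator_of_subset h (fun _ => hw _) _) (by positivity)

/-- The sign condition on `c` covers the empty average, which is 0. -/
theorem one_div_mul_sum_le {N : ℕ} {f : ℕ → ℝ} {c : ℝ} (hc : 0 ≤ c) (h : ∀ j < N, f j ≤ c) :
    (1 / (N : ℝ)) * ∑ j ∈ Finset.range N, f j ≤ c := by
  rcases Nat.eq_zero_or_pos N with rfl | hN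
  · simpa using hc
  · have hN' : (0 : ℝ) < N := by exact_mod_cast hN
    rw [one_div, inv_mul_le_iff₀ hN']
    refine (Finset.sum_le_sum fun j hj => h j (Finset.mem_range.1 hj)).trans ?_
    simp

theorem boxAvg_le {E : Type*} {d : ℕ} {N : ℕ} {w : ℕ → E → ℝ} {x : ℕ → E → Fin d → ℝ} {e : E} {Q : ℝ}
    (hw : ∀ j, 0 ≤ w j e) (hQ : ∀ j, w j e ≤ Q) (A : Set (Fin d → ℝ)) :
    boxAvg N w x A e ≤ Q :=
  one_div_mul_sum_le ((hw 0).trans (hQ 0)) fun j _ =>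
    (indicator_le_self' (fun _ _ => hw j) _).trans (hQ j)

section BoxDeviation

variable {Ω E : Type*} [MeasurableSpace Ω] [MeasurableSpace E] {P : Measure Ω}
  [IsProbabilityMeasure P] {d : ℕ}

theorem measurable_boxAvg {N : ℕ} {w : ℕ → E → ℝ} {x : ℕ → E → Fin d → ℝ}
    (hw : ∀ j, Measurable (w j)) (hx : ∀ j, Measurable (x j)) {A : Set (Fin d → ℝ)}
    (hA : MeasurableSet A) : Measurable (boxAvg N w x A) := by
  refine measurable_const.mul (Finset.measurable_sum _ fun j _ => ?_)
  have : (fun e => A.indicator (fun _ => w j e) (x j e)) = (x j ⁻¹' A).indicator (w j) := by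
    funext e; by_cases h : x j e ∈ A <;> simp [h]
  rw [this]
  exact (hw j).indicator (hx j hA)

/-- Deviations of weighted averages over small boxes from their means, uniformly over the boxes. -/
theorem ae_eventually_box_deviation_le {subj : ℕ → Ω → E} (hsubj : ∀ i, Measurable (subj i))
    (hind : iIndepFun subj P) (N : ℕ → ℕ → ℕ) {x : ℕ → E → Fin d → ℝ} (hx : ∀ j, Measurable (x j))
    {w : ℕ → ℕ → E → ℝ} (hw : ∀ n j, Measurable (w n j)) {Q v : ℕ → ℝ}
    (hw0 : ∀ n j e, 0 ≤ w n j e) (hwQ : ∀ n j e, w n j e ≤ Q n) {side : ℕ → Fin d → ℝ}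
    (hv : ∀ᶠ n in atTop, 0 < v n) (hside : ∀ᶠ n : ℕ in atTop, ∀ k, 1 ≤ n * side n k)
    (hQ : ∀ᶠ n : ℕ in atTop, Q n ^ 2 * Real.log n ≤ n * v n)
    (hmom : ∀ᶠ n : ℕ in atTop, ∀ i < n, ∀ a b : Fin d → ℤ,
      (∀ k, (b k - a k + 1 : ℝ) ≤ 4 * (n * side n k)) →
        ∫ ω, boxAvg (N n i) (w n) x (gridBox n a b) (subj i ω) ^ 2 ∂P ≤ v n)
    {C : ℝ} (hslab : ∀ᶠ n : ℕ in atTop, ∀ i < n, ∀ j k (c : ℤ),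
      P.real {ω | ⌊n * x j (subj i ω) k⌋ = c} ≤ C / n) (R : ℕ) :
    ∃ C', ∀ᵐ ω ∂P, ∀ᶠ n : ℕ in atTop, ∀ I : Fin d → Set ℝ, (∀ k, (I k).OrdConnected) →
      (∀ k, I k ⊆ Icc (-(R : ℝ)) R) → (∀ k, ∀ y ∈ I k, ∀ z ∈ I k, z - y ≤ 2 * side n k) →
      |1 / (n : ℝ) * ∑ i ∈ Finset.range n, (boxAvg (N n i) (w n) x (univ.pi I) (subj i ω) -
        ∫ ω', boxAvg (N n i) (w n) x (univ.pi I) (subj i ω') ∂P)| ≤ C' * √(v n * Real.log n / n) := by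
  classical
  set G : ℕ → Set (Fin d → ℝ) → Ω → ℝ := fun n A ω =>
    1 / (n : ℝ) * ∑ i ∈ Finset.range n, (boxAvg (N n i) (w n) x A (subj i ω) -
        ∫ ω', boxAvg (N n i) (w n) x A (subj i ω') ∂P) with hG
  -- The margin of 1 on both sides leaves room for the inner box, whose corners are moved inwards by
  -- one cell and may cross.
  let D : ℕ → Finset (Fin d → ℤ) := fun n =>
    Fintype.piFinset fun _ => Finset.Icc (-((n : ℤ) * R + 1)) (n * R + 1)
  -- There are of order `n ^ (2 * d)` pairs of corners, and this constant gives each a deviation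
  -- probability of order `n ^ (-(2 * d + 2))`; the union bound is then summable.
  set C₀ : ℝ := 2 * d + 3 with hC₀
  let good : ℕ → Ω → Prop := fun n ω => ∀ ab ∈ D n ×ˢ D n,
    (∀ k, ((ab.2 k : ℝ) - ab.1 k + 1 : ℝ) ≤ 4 * (n * side n k)) →
      |G n (gridBox n ab.1 ab.2) ω| < C₀ * √(v n * Real.log n / n)
  have hmeas : ∀ n i {A : Set (Fin d → ℝ)}, MeasurableSet A →
      Measurable fun ω => boxAvg (N n i) (w n) x A (subj i ω) := fun n i A hA =>
    (measurable_boxAvg (hw n) hx hA).comp (hsubj i)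
  have hgood : ∀ᵐ ω ∂P, ∀ᶠ n in atTop, good n ω := by
    refine ae_eventually_of_summable
      (f := fun n : ℕ => 2 * (2 * (R : ℝ) + 3) ^ (2 * d) * (1 / (n : ℝ) ^ 2))
      ((Real.summable_one_div_nat_pow.2 (by norm_num)).mul_left _) ?_
    filter_upwards [hv, hQ, hmom, eventually_ge_atTop 1] with n h1 h2 h3 hn
    have hn' : (0 : ℝ) < n := by exact_mod_cast hn
    set T := (D n ×ˢ D n).filter fun ab =>
      ∀ k, ((ab.2 k : ℝ) - ab.1 k + 1 : ℝ) ≤ 4 * (n * side n k) with hT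
    have hsub : {ω | ¬ good n ω} ⊆ ⋃ ab ∈ T,
        {ω | C₀ * √(v n * Real.log n / n) ≤ |G n (gridBox n ab.1 ab.2) ω|} := by
      intro ω hω
      simp only [good, mem_ofPred_eq] at hω
      push Not at hω
      obtain ⟨ab, hab, h4, h5⟩ := hω
      exact mem_iUnion₂.2 ⟨ab, by rw [hT, Finset.mem_filter]; exact ⟨hab, h4⟩, h5⟩
    have hexp : Real.exp ((1 - C₀) * Real.log n) = 1 / (n : ℝ) ^ (2 * d + 2) := by
      rw [mul_comm, ← Real.rpow_def_of_pos hn', one_div, ← Real.rpow_natCast, ← Real.rpow_neg hn'.le]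
      congr 1
      rw [hC₀]; push_cast; ring
    have hcard : (T.card : ℝ) ≤ ((2 * (R : ℝ) + 3) * n) ^ (2 * d) := by
      have h5 : T.card ≤ (2 * (n * R + 1) + 1) ^ d * (2 * (n * R + 1) + 1) ^ d := by
        refine (Finset.card_filter_le _ _).trans (le_of_eq ?_)
        have : (D n).card = (2 * (n * R + 1) + 1) ^ d := by
          simp only [D, Fintype.card_piFinset_const, Int.card_Icc]
          congr 1
          zify
          have : (0 : ℤ) ≤ (n : ℤ) * R := by positivity
          rw [Int.toNat_of_nonneg (by linarith)]
          ring
        rw [Finset.card_product, this]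
      have h6 : (T.card : ℝ) ≤ ((2 * (n * R + 1) + 1) ^ d * (2 * (n * R + 1) + 1) ^ d : ℕ) := by
        exact_mod_cast h5
      refine h6.trans ?_
      push_cast
      rw [← pow_add, ← two_mul]
      have : (1 : ℝ) ≤ n := by exact_mod_cast hn
      gcongr
      nlinarith
    calc P.real {ω | ¬ good n ω} ≤ _ := measureReal_mono hsub (measure_ne_top _ _)
      _ ≤ ∑ ab ∈ T, P.real {ω | C₀ * √(v n * Real.log n / n) ≤ |G n (gridBox n ab.1 ab.2) ω|} :=
        measureReal_biUnion_finset_le _ _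
      _ ≤ ∑ ab ∈ T, 2 * (1 / (n : ℝ) ^ (2 * d + 2)) := by
        refine Finset.sum_le_sum fun ab hab => ?_
        have hab' := (Finset.mem_filter.1 hab).2
        rw [← hexp]
        exact measureReal_avg_deviation_le
          (Y := fun i ω => boxAvg (N n i) (w n) x (gridBox n ab.1 ab.2) (subj i ω))
          (hind.comp (fun i => boxAvg (N n i) (w n) x (gridBox n ab.1 ab.2))
            fun i => measurable_boxAvg (hw n) hx (measurableSet_gridBox _ _ _))
          (fun i => hmeas n i (measurableSet_gridBox _ _ _)) hn
          (fun i _ ω => boxAvg_nonneg (fun j => hw0 n j _) _)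
          (fun i _ ω => boxAvg_le (fun j => hw0 n j _) (fun j => hwQ n j _) _)
          (fun i hi => h3 i hi _ _ hab') h1 (Real.log_natCast_nonneg n) h2 C₀
      _ = T.card * (2 * (1 / (n : ℝ) ^ (2 * d + 2))) := by rw [Finset.sum_const, nsmul_eq_mul]
      _ ≤ ((2 * (R : ℝ) + 3) * n) ^ (2 * d) * (2 * (1 / (n : ℝ) ^ (2 * d + 2))) := by gcongr
      _ = _ := by rw [mul_pow, pow_add]; field_simp
  refine ⟨C₀ + 2 * d * |C|, ?_⟩
  filter_upwards [hgood] with ω hω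
  filter_upwards [hω, hv, hside, hQ, hslab, eventually_ge_atTop 3] with n h1 h2 h3 h4 h5 hn I hI hIR hIs
  have hn' : (0 : ℝ) < n := by exact_mod_cast (by omega : 0 < n)
  set η := √(v n * Real.log n / n) with hη
  have hη0 : 0 ≤ η := Real.sqrt_nonneg _
  have hlog : 1 ≤ Real.log n := by
    rw [Real.le_log_iff_exp_le hn']
    have : (3 : ℝ) ≤ n := by exact_mod_cast hn
    linarith [Real.exp_one_lt_d9]
  have hCη : 0 ≤ C₀ + 2 * d * |C| := by positivity
  by_cases hne : ∀ k, (I k).Nonempty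
  swap
  · push Not at hne
    obtain ⟨k, hk⟩ := hne
    have : univ.pi I = ∅ := univ_pi_eq_empty hk
    simp only [this, boxAvg, indicator_empty]
    simp only [Finset.sum_const_zero, mul_zero, integral_zero, sub_self, abs_zero]
    positivity
  have hex : ∀ k, _ := fun k => exists_grid_sandwich (hI k) (hne k) (hIR k) (hIs k) n
  choose a b ha hb hab hs hin hout using hex
  have hQ0 : 0 ≤ Q n := by
    have : Nonempty Ω := P.nonempty_of_neZero
    exact (hw0 n 0 (subj 0 (Classical.arbitrary Ω))).trans (hwQ n 0 _)
  -- One cell slab has probability of order `1 / n` and the weights are at most `Q n`, so passing to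
  -- the grid costs a multiple of `Q n / n`; `log n ≥ 1` makes this negligible against `η`.
  have hQη : Q n / n ≤ η := by
    rw [hη]
    refine Real.le_sqrt_of_sq_le ?_
    rw [div_pow, div_le_div_iff₀ (by positivity) hn']
    have : Q n ^ 2 * 1 ≤ Q n ^ 2 * Real.log n := by gcongr
    have : n * v n * 1 ≤ n * v n * Real.log n := by gcongr
    nlinarith
  set A := univ.pi I with hA
  set Ao := gridBox n a b with hAo
  set Ai := gridBox n (fun k => a k + 1) (fun k => b k - 1) with hAi
  have hAm : MeasurableSet A := MeasurableSet.univ_pi fun k => (hI k).measurableSet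
  have hsubo : A ⊆ Ao := fun y hy k => hin k _ (hy k (mem_univ k))
  have hsubi : Ai ⊆ A := fun y hy k _ => hout k _ (hy k).1 (hy k).2
  have hmo : MeasurableSet Ao := measurableSet_gridBox _ _ _
  have hmi : MeasurableSet Ai := measurableSet_gridBox _ _ _
  -- The outer box has at most `2 * (n * side) + 2` cells per side; `1 ≤ n * side` absorbs the
  -- rounding into the factor 4.
  have hside4 : ∀ k, (b k - a k + 1 : ℝ) ≤ 4 * (n * side n k) := fun k => by linarith [hs k, h3 k]
  have gO : |G n Ao ω| < C₀ * η := by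
    refine h1 (a, b) ?_ hside4
    simp only [D, Finset.mem_product, Fintype.mem_piFinset, Finset.mem_Icc]
    constructor <;> intro k <;> have := ha k <;> have := hb k <;> have := hab k <;> constructor <;> omega
  have gI : |G n Ai ω| < C₀ * η := by
    refine h1 (fun k => a k + 1, fun k => b k - 1) ?_ ?_
    · simp only [D, Finset.mem_product, Fintype.mem_piFinset, Finset.mem_Icc]
      constructor <;> intro k <;> have := ha k <;> have := hb k <;> have := hab k <;>
        constructor <;> omega
    · intro k; push_cast; linarith [hside4 k]
  have hint : ∀ i {A : Set (Fin d → ℝ)}, MeasurableSet A →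
      Integrable (fun ω => boxAvg (N n i) (w n) x A (subj i ω)) P := fun i A hA =>
    Integrable.of_bound (hmeas n i hA).aestronglyMeasurable (Q n) (ae_of_all _ fun ω => by
      rw [Real.norm_of_nonneg (boxAvg_nonneg (fun j => hw0 n j _) _)]
      exact boxAvg_le (fun j => hw0 n j _) (fun j => hwQ n j _) _)
  -- A design point in the outer but not in the inner box has some coordinate in one of the end
  -- cells `a k`, `b k`, so the difference of the averages is dominated by the slab indicators
  -- summed in `g`.
  have hgap : ∀ i < n, ∫ ω, boxAvg (N n i) (w n) x Ao (subj i ω) ∂P -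
      ∫ ω, boxAvg (N n i) (w n) x Ai (subj i ω) ∂P ≤ 2 * d * |C| * η := by
    intro i hi
    set S : ℕ → Fin d → ℤ → Set Ω := fun j k c => {ω | ⌊n * x j (subj i ω) k⌋ = c} with hS
    have hSm : ∀ j k c, MeasurableSet (S j k c) := fun j k c => by
      have : Measurable fun ω => ⌊n * x j (subj i ω) k⌋ := by
        refine Int.measurable_floor.comp (measurable_const.mul ?_)
        exact (measurable_pi_apply k).comp ((hx j).comp (hsubj i))
      exact this (measurableSet_singleton c)
    let g : ℕ → Ω → ℝ := fun j ω => Q n * ∑ k, ((S j k (a k)).indicator 1 ω + (S j k (b k)).indicator 1 ω)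
    have hSint : ∀ j k c, Integrable ((S j k c).indicator (1 : Ω → ℝ)) P := fun j k c =>
      (integrable_const (1 : ℝ)).indicator (hSm j k c)
    have hSint' : ∀ j k, Integrable (fun ω => (S j k (a k)).indicator (1 : Ω → ℝ) ω +
        (S j k (b k)).indicator 1 ω) P := fun j k => (hSint j k _).add (hSint j k _)
    have hgint : ∀ j, Integrable (g j) P := fun j =>
      (integrable_finsetSum _ fun k _ => hSint' j k).const_mul _
    have hgle : ∀ j, ∫ ω, g j ω ∂P ≤ 2 * d * |C| * η := by
      intro j
      simp only [g]
      rw [integral_const_mul, integral_finsetSum _ fun k _ => hSint' j k]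
      have hk : ∀ k ∈ Finset.univ, ∫ ω, ((S j k (a k)).indicator (1 : Ω → ℝ) ω +
          (S j k (b k)).indicator (1 : Ω → ℝ) ω) ∂P ≤ 2 * |C| / n := by
        intro k _
        rw [integral_add (hSint j k _) (hSint j k _), integral_indicator_one (hSm _ _ _),
          integral_indicator_one (hSm _ _ _)]
        have := h5 i hi j k (a k)
        have := h5 i hi j k (b k)
        have : C / n ≤ |C| / n := by gcongr; exact le_abs_self C
        rw [two_mul, add_div]
        linarith
      calc _ ≤ Q n * ∑ k : Fin d, 2 * |C| / n := by gcongr with k hk'; exact hk k hk'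
        _ = 2 * d * |C| * (Q n / n) := by simp; ring
        _ ≤ _ := by gcongr
    have hpt : ∀ ω, boxAvg (N n i) (w n) x Ao (subj i ω) - boxAvg (N n i) (w n) x Ai (subj i ω) ≤
        1 / (N n i : ℝ) * ∑ j ∈ Finset.range (N n i), g j ω := by
      intro ω
      rw [boxAvg, boxAvg, ← mul_sub, ← Finset.sum_sub_distrib]
      refine mul_le_mul_of_nonneg_left (Finset.sum_le_sum fun j _ => ?_) (by positivity)
      have hg0 : ∀ k, 0 ≤ (S j k (a k)).indicator (1 : Ω → ℝ) ω + (S j k (b k)).indicator 1 ω :=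
        fun k => add_nonneg (indicator_nonneg (fun _ _ => zero_le_one) _)
          (indicator_nonneg (fun _ _ => zero_le_one) _)
      have hg0' : 0 ≤ g j ω := mul_nonneg hQ0 (Finset.sum_nonneg fun k _ => hg0 k)
      by_cases hi' : x j (subj i ω) ∈ Ai
      · have : x j (subj i ω) ∈ Ao := hsubo (hsubi hi')
        rw [indicator_of_mem hi', indicator_of_mem this, sub_self]
        exact hg0'
      by_cases ho : x j (subj i ω) ∈ Ao
      swap
      · rw [indicator_of_notMem hi', indicator_of_notMem ho, sub_self]
        exact hg0'
      rw [indicator_of_notMem hi', indicator_of_mem ho, sub_zero]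
      have hi2 : ∃ k, ⌊n * x j (subj i ω) k⌋ = a k ∨ ⌊n * x j (subj i ω) k⌋ = b k := by
        by_contra hcon
        push Not at hcon
        refine hi' fun k => ?_
        have := ho k
        have := hcon k
        change a k + 1 ≤ _ ∧ _ ≤ b k - 1
        constructor <;> omega
      obtain ⟨k, hk⟩ := hi2
      have h6 : 1 ≤ (S j k (a k)).indicator (1 : Ω → ℝ) ω + (S j k (b k)).indicator 1 ω := by
        rcases hk with hk | hk
        · rw [indicator_of_mem (show ω ∈ S j k (a k) from hk)]
          have : 0 ≤ (S j k (b k)).indicator (1 : Ω → ℝ) ω := indicator_nonneg (fun _ _ => zero_le_one) _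
          simp only [Pi.one_apply]; linarith
        · rw [indicator_of_mem (show ω ∈ S j k (b k) from hk)]
          have : 0 ≤ (S j k (a k)).indicator (1 : Ω → ℝ) ω := indicator_nonneg (fun _ _ => zero_le_one) _
          simp only [Pi.one_apply]; linarith
      have h7 := h6.trans (Finset.single_le_sum (f := fun k => (S j k (a k)).indicator (1 : Ω → ℝ) ω +
        (S j k (b k)).indicator 1 ω) (fun k _ => hg0 k) (Finset.mem_univ k))
      calc w n j (subj i ω) ≤ Q n * 1 := by rw [mul_one]; exact hwQ n j _
        _ ≤ _ := by simp only [g]; gcongr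
    rw [← integral_sub (hint i hmo) (hint i hmi)]
    calc _ ≤ ∫ ω, 1 / (N n i : ℝ) * ∑ j ∈ Finset.range (N n i), g j ω ∂P :=
          integral_mono ((hint i hmo).sub (hint i hmi))
            ((integrable_finsetSum _ fun j _ => hgint j).const_mul _) hpt
      _ = 1 / (N n i : ℝ) * ∑ j ∈ Finset.range (N n i), ∫ ω, g j ω ∂P := by
          rw [integral_const_mul, integral_finsetSum _ fun j _ => hgint j]
      _ ≤ _ := one_div_mul_sum_le (by positivity) fun j _ => hgle j
  have hmeanO : ∀ i, ∫ ω, boxAvg (N n i) (w n) x A (subj i ω) ∂P ≤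
      ∫ ω, boxAvg (N n i) (w n) x Ao (subj i ω) ∂P := fun i =>
    integral_mono (hint i hAm) (hint i hmo) fun ω => boxAvg_mono (fun j => hw0 n j _) hsubo
  have hmeanI : ∀ i, ∫ ω, boxAvg (N n i) (w n) x Ai (subj i ω) ∂P ≤
      ∫ ω, boxAvg (N n i) (w n) x A (subj i ω) ∂P := fun i =>
    integral_mono (hint i hmi) (hint i hAm) fun ω => boxAvg_mono (fun j => hw0 n j _) hsubi
  -- With nonnegative weights the averages are monotone in the box. The centred average over `A`
  -- therefore lies between those over `Ai` and `Ao`, up to the gap of the means.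
  have key : ∀ {A₁ A₂ : Set (Fin d → ℝ)}, (∀ i < n, boxAvg (N n i) (w n) x A₁ (subj i ω) -
      ∫ ω', boxAvg (N n i) (w n) x A₁ (subj i ω') ∂P ≤ (boxAvg (N n i) (w n) x A₂ (subj i ω) -
      ∫ ω', boxAvg (N n i) (w n) x A₂ (subj i ω') ∂P) + 2 * d * |C| * η) →
      G n A₁ ω ≤ G n A₂ ω + 2 * d * |C| * η := by
    intro A₁ A₂ h
    have h8 := one_div_mul_sum_le (N := n) (c := 2 * d * |C| * η)
      (f := fun i => (boxAvg (N n i) (w n) x A₁ (subj i ω) -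
      ∫ ω', boxAvg (N n i) (w n) x A₁ (subj i ω') ∂P) - (boxAvg (N n i) (w n) x A₂ (subj i ω) -
      ∫ ω', boxAvg (N n i) (w n) x A₂ (subj i ω') ∂P)) (by positivity)
      (fun i hi => by linarith [h i hi])
    rw [Finset.sum_sub_distrib, mul_sub] at h8
    simp only [hG]
    linarith
  have up : G n A ω ≤ G n Ao ω + 2 * d * |C| * η := key fun i hi => by
    have := hgap i hi
    have := hmeanI i
    have := boxAvg_mono (N := N n i) (x := x) (fun j => hw0 n j (subj i ω)) hsubo
    linarith
  have lo : G n Ai ω ≤ G n A ω + 2 * d * |C| * η := key fun i hi => by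
    have := hgap i hi
    have := hmeanO i
    have := boxAvg_mono (N := N n i) (x := x) (fun j => hw0 n j (subj i ω)) hsubi
    linarith
  change |G n A ω| ≤ _
  rw [abs_lt] at gO gI
  rw [abs_le, add_mul]
  constructor <;> linarith [gO.1, gO.2, gI.1, gI.2]

end BoxDeviation

/-! ### Truncation -/

/-- The truncation level attached to a moment of order `r`. -/
noncomputable def truncLevel (r : ℝ) (n : ℕ) : ℝ := logRatio n ^ (-(1 / r))

/-- The part of `y` exceeding the level `Q`. -/
noncomputable def excess (Q y : ℝ) : ℝ := if y ≤ Q then 0 else y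

theorem excess_nonneg {Q y : ℝ} (hy : 0 ≤ y) : 0 ≤ excess Q y := by
  unfold excess; split_ifs <;> [exact le_rfl; exact hy]

theorem excess_le {Q y : ℝ} (hy : 0 ≤ y) : excess Q y ≤ y := by
  unfold excess; split_ifs <;> [exact hy; exact le_rfl]

theorem sub_excess_le {Q y : ℝ} (hQ : 0 ≤ Q) : y - excess Q y ≤ Q := by
  unfold excess; split_ifs with h <;> [simpa using h; simpa using hQ]

theorem measurable_excess (Q : ℝ) : Measurable (excess Q) :=
  Measurable.ite measurableSet_Iic measurable_const measurable_id

theorem excess_le_rpow {Q y r : ℝ} (hQ : 0 < Q) (hr : 1 ≤ r) (hy : 0 ≤ y) :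
    excess Q y ≤ Q ^ (1 - r) * y ^ r := by
  unfold excess
  split_ifs with h
  · positivity
  · push Not at h
    have hy' : 0 < y := hQ.trans h
    calc y = y ^ (1 - r) * y ^ r := by rw [← Real.rpow_add hy']; simp
      _ ≤ _ := mul_le_mul_of_nonneg_right
        (Real.rpow_le_rpow_of_nonpos hQ h.le (by linarith)) (by positivity)

theorem truncLevel_nonneg (r : ℝ) (n : ℕ) : 0 ≤ truncLevel r n :=
  Real.rpow_nonneg (logRatio_nonneg n) _

theorem truncLevel_pos (r : ℝ) {n : ℕ} (hn : 2 ≤ n) : 0 < truncLevel r n :=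
  Real.rpow_pos_of_pos (logRatio_pos hn) _

theorem truncLevel_rpow {r : ℝ} (hr : r ≠ 0) (n : ℕ) :
    truncLevel r n ^ r = (logRatio n)⁻¹ := by
  rw [truncLevel, ← Real.rpow_mul (logRatio_nonneg n)]
  rw [show -(1 / r) * r = -1 by field_simp, Real.rpow_neg_one]

/-- This is the order Qρ of the mean excess over the truncation level Q, since Q^r = 1/ρ. It is
O(√(vρ)) as soon as Q²ρ = O(v). -/
theorem truncLevel_rpow_one_sub {r : ℝ} (hr : r ≠ 0) {n : ℕ} (hn : 2 ≤ n) :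
    truncLevel r n ^ (1 - r) = truncLevel r n * logRatio n := by
  have h := truncLevel_pos r hn
  rw [Real.rpow_sub h, Real.rpow_one, truncLevel_rpow hr n, div_inv_eq_mul]

theorem tendsto_truncLevel {r : ℝ} (hr : 0 < r) : Tendsto (truncLevel r) atTop atTop := by
  have h1 : Tendsto logRatio atTop (𝓝[>] 0) := by
    refine tendsto_nhdsWithin_iff.2 ⟨tendsto_logRatio, ?_⟩
    filter_upwards [eventually_ge_atTop 2] with n hn using logRatio_pos hn
  have : (0 : ℝ) < 1 / r := by positivity
  have : -(1 / r) < 0 := by linarith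
  exact (tendsto_rpow_neg_nhdsGT_zero this).comp h1

theorem integral_excess_le {Ω : Type*} [MeasurableSpace Ω] {P : Measure Ω} {X : Ω → ℝ} {Q r m : ℝ} (hX : Measurable X) (h0 : ∀ ω, 0 ≤ X ω)
    (hint : Integrable (fun ω => X ω ^ r) P) (hm : ∫ ω, X ω ^ r ∂P ≤ m) (hQ : 0 < Q) (hr : 1 ≤ r) :
    ∫ ω, excess Q (X ω) ∂P ≤ Q ^ (1 - r) * m := by
  have hle : ∀ ω, excess Q (X ω) ≤ Q ^ (1 - r) * X ω ^ r := fun ω => excess_le_rpow hQ hr (h0 ω)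
  have h1 : Integrable (fun ω => Q ^ (1 - r) * X ω ^ r) P := hint.const_mul _
  have h2 : Integrable (fun ω => excess Q (X ω)) P :=
    h1.mono' ((measurable_excess Q).comp hX).aestronglyMeasurable (ae_of_all _ fun ω => by
      rw [Real.norm_of_nonneg (excess_nonneg (h0 ω))]; exact hle ω)
  calc _ ≤ ∫ ω, Q ^ (1 - r) * X ω ^ r ∂P := integral_mono h2 h1 hle
    _ = Q ^ (1 - r) * ∫ ω, X ω ^ r ∂P := integral_const_mul _ _
    _ ≤ _ := mul_le_mul_of_nonneg_left hm (by positivity)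

/-! ### Averages of the exceedances over the truncation level -/

section Residuals

variable {Ω : Type*} [MeasurableSpace Ω] {P : Measure Ω} [IsProbabilityMeasure P]

/-- Exceedances of variables dominated by an i.i.d. envelope with a moment of order `r`. -/
theorem ae_excess_le_of_envelope {a : ℕ → ℕ → Ω → ℝ} {M : ℕ → Ω → ℝ} (N : ℕ → ℕ → ℕ) {r : ℝ}
    (hr : 1 ≤ r) (ha : ∀ i j ω, 0 ≤ a i j ω)
    (haM : ∀ᵐ ω ∂P, ∀ n, ∀ i < n, ∀ j < N n i, a i j ω ≤ M i ω)
    (hind : Pairwise fun i j => IndepFun (M i) (M j) P) (hid : ∀ i, IdentDistrib (M i) (M 0) P P)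
    (hint : Integrable (fun ω => |M 0 ω| ^ r) P) :
    ∀ᵐ ω ∂P, ∃ C, ∀ᶠ n : ℕ in atTop, 1 / (n : ℝ) * ∑ i ∈ Finset.range n, 1 / (N n i : ℝ) *
      ∑ j ∈ Finset.range (N n i), excess (truncLevel r n) (a i j ω) ≤
        C * (truncLevel r n * logRatio n) := by
  have hg : Measurable fun y : ℝ => |y| ^ r := by fun_prop
  -- Each excess in row `i` is at most Q^(1-r) |M i|^r whatever the number of observations, so the
  -- strong law for |M i|^r bounds the whole average by (m + 1) Qρ.
  have hlln := strong_law_ae_real (μ := P) (fun i ω => |M i ω| ^ r) hint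
    (fun i j hij => (hind hij).comp hg hg) (fun i => (hid i).comp hg)
  filter_upwards [hlln, haM] with ω h1 h2
  set m := ∫ ω, |M 0 ω| ^ r ∂P
  refine ⟨m + 1, ?_⟩
  filter_upwards [h1.eventually (gt_mem_nhds (lt_add_one m)), eventually_ge_atTop 2] with n h3 hn
  have hQ := truncLevel_pos r hn
  have hin : ∀ i ∈ Finset.range n, 1 / (N n i : ℝ) *
      ∑ j ∈ Finset.range (N n i), excess (truncLevel r n) (a i j ω) ≤
      truncLevel r n ^ (1 - r) * |M i ω| ^ r := by
    intro i hi
    refine one_div_mul_sum_le (by positivity) fun j hj => ?_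
    refine (excess_le_rpow hQ hr (ha i j ω)).trans ?_
    have := (h2 n i (Finset.mem_range.1 hi) j hj).trans (le_abs_self _)
    have := ha i j ω
    gcongr
  calc _ ≤ 1 / (n : ℝ) * ∑ i ∈ Finset.range n, truncLevel r n ^ (1 - r) * |M i ω| ^ r :=
        mul_le_mul_of_nonneg_left (Finset.sum_le_sum hin) (by positivity)
    _ = ((∑ i ∈ Finset.range n, |M i ω| ^ r) / n) * truncLevel r n ^ (1 - r) := by
        rw [← Finset.mul_sum]; ring
    _ ≤ (m + 1) * truncLevel r n ^ (1 - r) := by gcongr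
    _ = _ := by rw [truncLevel_rpow_one_sub (by linarith) hn]

/-- With polynomially many observations per row, no variable exceeds the truncation level by more than
the number of observations. -/
theorem ae_eventually_le_mul_truncLevel {e : ℕ → ℕ → Ω → ℝ} (he : ∀ i j ω, 0 ≤ e i j ω)
    (N : ℕ → ℕ → ℕ) {r m c s : ℝ} (hr : 2 < r)
    (hint : ∀ i j, Integrable (fun ω => e i j ω ^ r) P) (hm : ∀ i j, ∫ ω, e i j ω ^ r ∂P ≤ m)
    (hc : 0 < c) (hs : 0 < s) (hN1 : ∀ n, ∀ i < n, 1 ≤ N n i)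
    (hN : ∀ᶠ n : ℕ in atTop, ∀ i < n, c * logRatio n ^ (-s) ≤ N n i) :
    ∀ᵐ ω ∂P, ∀ᶠ n in atTop, ∀ i < n, ∀ j < N n i, e i j ω ≤ N n i * truncLevel r n := by
  have hr0 : 0 < r := by linarith
  set q := s * r / 2 with hq
  have hq0 : 0 < q := by positivity
  -- Chosen so that ρ ≤ n^(-(1-δ)) / δ gives ρ^(-(1+q)) at least of order n^(1 + q/2), an exponent
  -- still above 1.
  set δ := (q / 2) / (1 + q) with hδ
  have hδ0 : 0 < δ := by positivity
  have hδq : (1 - δ) * (1 + q) = 1 + q / 2 := by rw [hδ]; field_simp; ring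
  set κ := c ^ (r / 2) * δ ^ (1 + q) with hκ
  have hκ0 : 0 < κ := by positivity
  -- Both exponents exceed 1, so the reciprocals are summable over all pairs. By Markov and
  -- Borel–Cantelli only finitely many variables have `r`-th power reaching `Ψ`, and these
  -- eventually lie below the growing truncation level.
  let Ψ : ℕ × ℕ → ℝ := fun ij => κ * (((ij.2 : ℝ) + 1) ^ (r / 2) * ((ij.1 : ℝ) + 1) ^ (1 + q / 2))
  have hΨ0 : ∀ ij, 0 < Ψ ij := fun ij => by positivity
  have hsum : Summable fun ij : ℕ × ℕ => m * (Ψ ij)⁻¹ := by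
    have shift : ∀ t : ℝ, 1 < t → Summable fun i : ℕ => (((i : ℝ) + 1) ^ t)⁻¹ := fun t ht => by
      have := (summable_nat_add_iff 1).2 (Real.summable_nat_rpow_inv.2 ht)
      simpa using this
    have h1 := shift (1 + q / 2) (by linarith)
    have h2 := shift (r / 2) (by linarith)
    have h3 := h1.mul_of_nonneg h2 (fun _ => by positivity) (fun _ => by positivity)
    refine (h3.mul_left (m * κ⁻¹)).congr fun ij => ?_
    simp only [Ψ, mul_inv]
    ring
  have hm0 : 0 ≤ m := (integral_nonneg fun ω => Real.rpow_nonneg (he 0 0 ω) r).trans (hm 0 0)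
  have hfin : ∀ᵐ ω ∂P, {ij : ℕ × ℕ | ω ∈ {ω | Ψ ij ≤ e ij.1 ij.2 ω ^ r}}.Finite := by
    refine ae_finite_setOfPred_mem ?_
    have hle : ∀ ij : ℕ × ℕ, P {ω | Ψ ij ≤ e ij.1 ij.2 ω ^ r} ≤ ENNReal.ofReal (m * (Ψ ij)⁻¹) := by
      intro ij
      rw [← ofReal_measureReal]
      apply ENNReal.ofReal_le_ofReal
      have := mul_meas_ge_le_integral_of_nonneg (ae_of_all _ fun ω => Real.rpow_nonneg
        (he ij.1 ij.2 ω) r) (hint ij.1 ij.2) (Ψ ij)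
      rw [← div_eq_mul_inv, le_div_iff₀ (hΨ0 ij), mul_comm]
      exact this.trans (hm _ _)
    exact ne_top_of_le_ne_top hsum.tsum_ofReal_ne_top (ENNReal.tsum_le_tsum hle)
  filter_upwards [hfin] with ω hω
  obtain ⟨L, hL⟩ : ∃ L, ∀ ij ∈ {ij : ℕ × ℕ | Ψ ij ≤ e ij.1 ij.2 ω ^ r}, e ij.1 ij.2 ω ≤ L := by
    obtain ⟨L, hL⟩ := (hω.image fun ij => e ij.1 ij.2 ω).bddAbove
    exact ⟨L, fun ij h => hL ⟨ij, h, rfl⟩⟩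
  filter_upwards [hN, (tendsto_truncLevel hr0).eventually_ge_atTop L, eventually_ge_atTop 2]
    with n h1 h2 hn i hi j hj
  have hN1' : (1 : ℝ) ≤ N n i := by exact_mod_cast hN1 n i hi
  have hQ := truncLevel_pos r hn
  have hρ := logRatio_pos hn
  by_cases hij : Ψ (i, j) ≤ e i j ω ^ r
  · exact (hL (i, j) hij).trans (h2.trans (le_mul_of_one_le_left hQ.le hN1'))
  · push Not at hij
    have hn0 : (0 : ℝ) < n := by exact_mod_cast (by omega : 0 < n)
    -- Split N^r into two halves N^(r/2). One pays for the factor in `j + 1 ≤ N`. The other, at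
    -- least of order ρ^(-q), combines with Q^r = 1/ρ to pay for the factor in `i + 1 ≤ n`.
    have key : Ψ (i, j) ≤ (N n i * truncLevel r n) ^ r := by
      rw [Real.mul_rpow (by positivity) hQ.le, truncLevel_rpow hr0.ne' n]
      have e1 : (N n i : ℝ) ^ r = (N n i : ℝ) ^ (r / 2) * (N n i : ℝ) ^ (r / 2) := by
        rw [← Real.rpow_add (by positivity)]; congr 1; ring
      have e2 : ((j : ℝ) + 1) ^ (r / 2) ≤ (N n i : ℝ) ^ (r / 2) := by
        gcongr; exact_mod_cast hj
      have e3 : c ^ (r / 2) * logRatio n ^ (-q) ≤ (N n i : ℝ) ^ (r / 2) := by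
        calc _ = (c * logRatio n ^ (-s)) ^ (r / 2) := by
              rw [Real.mul_rpow hc.le (by positivity), ← Real.rpow_mul hρ.le]
              congr 2; rw [hq]; ring
          _ ≤ _ := by gcongr; exact h1 i hi
      have e4 : logRatio n ≤ (n : ℝ) ^ (-(1 - δ)) / δ := by
        have := Real.log_le_rpow_div hn0.le hδ0
        rw [logRatio, div_le_iff₀ hn0, div_mul_eq_mul_div]
        nth_rewrite 3 [← Real.rpow_one (n : ℝ)]
        rw [← Real.rpow_add hn0]
        simpa using this
      have e5 : δ ^ (1 + q) * ((i : ℝ) + 1) ^ (1 + q / 2) ≤ logRatio n ^ (-(1 + q)) := by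
        calc _ ≤ δ ^ (1 + q) * (n : ℝ) ^ (1 + q / 2) := by
              gcongr; exact_mod_cast hi
          _ = ((n : ℝ) ^ (-(1 - δ)) / δ) ^ (-(1 + q)) := by
              rw [Real.div_rpow (by positivity) hδ0.le, ← Real.rpow_mul hn0.le,
                Real.rpow_neg hδ0.le, div_inv_eq_mul, mul_comm]
              congr 2
              rw [← hδq]; ring
          _ ≤ _ := Real.rpow_le_rpow_of_nonpos hρ e4 (by linarith)
      have e6 : logRatio n ^ (-(1 + q)) = logRatio n ^ (-q) * (logRatio n)⁻¹ := by
        rw [← Real.rpow_neg_one, ← Real.rpow_add hρ]; congr 1; ring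
      calc Ψ (i, j) = c ^ (r / 2) * ((j : ℝ) + 1) ^ (r / 2) *
            (δ ^ (1 + q) * ((i : ℝ) + 1) ^ (1 + q / 2)) := by simp only [Ψ, hκ]; ring
        _ ≤ c ^ (r / 2) * (N n i : ℝ) ^ (r / 2) * (logRatio n ^ (-q) * (logRatio n)⁻¹) := by
            rw [← e6]; gcongr
        _ = (N n i : ℝ) ^ (r / 2) * (c ^ (r / 2) * logRatio n ^ (-q)) * (logRatio n)⁻¹ := by ring
        _ ≤ (N n i : ℝ) ^ (r / 2) * (N n i : ℝ) ^ (r / 2) * (logRatio n)⁻¹ := by gcongr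
        _ = _ := by rw [← e1]
    exact (Real.rpow_le_rpow_iff (he i j ω) (by positivity) hr0).1 (hij.le.trans key)

/-- Exceedances in rows of independent variables with polynomially many observations per row. -/
theorem ae_excess_le_of_dense {e : ℕ → ℕ → Ω → ℝ} (he : ∀ i j ω, 0 ≤ e i j ω)
    (hem : ∀ i j, Measurable (e i j)) (hrow : ∀ i, iIndepFun (e i) P)
    (hind : iIndepFun (fun i ω j => e i j ω) P)
    (N : ℕ → ℕ → ℕ) {r m c s : ℝ} (hr : 2 < r)
    (hint : ∀ i j, Integrable (fun ω => e i j ω ^ r) P) (hm : ∀ i j, ∫ ω, e i j ω ^ r ∂P ≤ m)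
    (hc : 0 < c) (hs : 0 < s) (hN1 : ∀ n, ∀ i < n, 1 ≤ N n i)
    (hN : ∀ᶠ n : ℕ in atTop, ∀ i < n, c * logRatio n ^ (-s) ≤ N n i) :
    ∀ᵐ ω ∂P, ∃ C, ∀ᶠ n : ℕ in atTop, 1 / (n : ℝ) * ∑ i ∈ Finset.range n, 1 / (N n i : ℝ) *
      ∑ j ∈ Finset.range (N n i), excess (truncLevel r n) (e i j ω) ≤
        C * (truncLevel r n * logRatio n) := by
  have hr0 : 0 < r := by linarith
  have hm0 : 0 ≤ m := (integral_nonneg fun ω => Real.rpow_nonneg (he 0 0 ω) r).trans (hm 0 0)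
  -- The excess in units of N Q, discarded above N Q so that it lies in [0, 1] and has exponential
  -- moments. Almost surely nothing is discarded for large `n`.
  let f : ℕ → ℕ → ℝ → ℝ := fun n i y =>
    if y ≤ N n i * truncLevel r n then excess (truncLevel r n) y / (N n i * truncLevel r n) else 0
  have hfm : ∀ n i, Measurable (f n i) := fun n i =>
    Measurable.ite measurableSet_Iic ((measurable_excess _).div_const _) measurable_const
  have hf0 : ∀ n i y, 0 ≤ y → 0 ≤ f n i y := fun n i y hy => by
    simp only [f]; split_ifs
    · exact div_nonneg (excess_nonneg hy) (mul_nonneg (Nat.cast_nonneg _) (truncLevel_nonneg _ _))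
    · exact le_rfl
  have hf1 : ∀ n i y, 0 ≤ y → f n i y ≤ 1 := fun n i y hy => by
    simp only [f]; split_ifs with h
    · exact div_le_one_of_le₀ ((excess_le hy).trans h)
        (mul_nonneg (Nat.cast_nonneg _) (truncLevel_nonneg _ _))
    · exact zero_le_one
  have hfx : ∀ n i y, 0 ≤ y → f n i y ≤ excess (truncLevel r n) y / (N n i * truncLevel r n) :=
    fun n i y hy => by
      simp only [f]; split_ifs
      · exact le_rfl
      · exact div_nonneg (excess_nonneg hy) (mul_nonneg (Nat.cast_nonneg _) (truncLevel_nonneg _ _))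
  let Rw : ℕ → ℕ → Ω → ℝ := fun n i ω => ∑ j ∈ Finset.range (N n i), f n i (e i j ω)
  have hfint : ∀ n i j, Integrable (fun ω => f n i (e i j ω)) P := fun n i j =>
    Integrable.of_bound ((hfm n i).comp (hem i j)).aestronglyMeasurable 1 (ae_of_all _ fun ω => by
      rw [Real.norm_of_nonneg (hf0 n i _ (he i j ω))]; exact hf1 n i _ (he i j ω))
  have hexpint : ∀ n i j, Integrable (fun ω => Real.exp (1 * f n i (e i j ω))) P := fun n i j =>
    Integrable.of_bound (Real.measurable_exp.comp (measurable_const.mul ((hfm n i).comp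
      (hem i j)))).aestronglyMeasurable (Real.exp 1) (ae_of_all _ fun ω => by
        rw [Real.norm_eq_abs, Real.abs_exp, one_mul]
        exact Real.exp_le_exp.2 (hf1 n i _ (he i j ω)))
  -- On [0, 1] one has exp y ≤ 1 + 2y, and the mean of `f` is at most Q^(1-r) m / (N Q) = m ρ / N; a
  -- row of N independent terms then has exponential moment at most exp (2mρ).
  have hmgf : ∀ n, 2 ≤ n → ∀ i < n, ∀ j, mgf (fun ω => f n i (e i j ω)) P 1 ≤
      Real.exp (2 * (m * logRatio n / N n i)) := by
    intro n hn i hi j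
    have hQ := truncLevel_pos r hn
    have hN0 : (0 : ℝ) < N n i := by exact_mod_cast hN1 n i hi
    have h1 : mgf (fun ω => f n i (e i j ω)) P 1 ≤ ∫ ω, (1 + 2 * f n i (e i j ω)) ∂P := by
      refine integral_mono (hexpint n i j) ((integrable_const _).add ((hfint n i j).const_mul 2))
        fun ω => ?_
      have a0 := hf0 n i _ (he i j ω)
      have a1 := hf1 n i _ (he i j ω)
      have := Real.abs_exp_sub_one_sub_id_le (x := f n i (e i j ω)) (by rwa [abs_of_nonneg a0])
      have := (le_abs_self _).trans this
      simp only [one_mul]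
      nlinarith
    have h2 : ∫ ω, (1 + 2 * f n i (e i j ω)) ∂P = 1 + 2 * ∫ ω, f n i (e i j ω) ∂P := by
      rw [integral_add (integrable_const _) ((hfint n i j).const_mul 2), integral_const_mul]
      simp
    have hexint : Integrable (fun ω => excess (truncLevel r n) (e i j ω)) P :=
      ((hint i j).const_mul (truncLevel r n ^ (1 - r))).mono'
        ((measurable_excess _).comp (hem i j)).aestronglyMeasurable (ae_of_all _ fun ω => by
          rw [Real.norm_of_nonneg (excess_nonneg (he i j ω))]
          exact excess_le_rpow hQ (by linarith) (he i j ω))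
    have h3 : ∫ ω, f n i (e i j ω) ∂P ≤ m * logRatio n / N n i := by
      calc _ ≤ ∫ ω, excess (truncLevel r n) (e i j ω) / (N n i * truncLevel r n) ∂P :=
            integral_mono (hfint n i j) (hexint.div_const _) fun ω => hfx n i _ (he i j ω)
        _ = (∫ ω, excess (truncLevel r n) (e i j ω) ∂P) / (N n i * truncLevel r n) :=
            integral_div _ _
        _ ≤ (truncLevel r n ^ (1 - r) * m) / (N n i * truncLevel r n) := by
            gcongr
            exact integral_excess_le (hem i j) (he i j) (hint i j) (hm i j) hQ (by linarith)
        _ = _ := by rw [truncLevel_rpow_one_sub hr0.ne' hn]; field_simp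
    rw [h2] at h1
    have := Real.add_one_le_exp (2 * (m * logRatio n / N n i))
    linarith
  have hRm : ∀ n i, Measurable (Rw n i) := fun n i =>
    Finset.measurable_sum _ fun j _ => (hfm n i).comp (hem i j)
  have hRind : ∀ n, iIndepFun (Rw n) P := fun n =>
    hind.comp (fun i (y : ℕ → ℝ) => ∑ j ∈ Finset.range (N n i), f n i (y j)) fun i =>
      Finset.measurable_sum _ fun j _ => (hfm n i).comp (measurable_pi_apply j)
  have hRsum : ∀ n i, (∑ j ∈ Finset.range (N n i), fun ω => f n i (e i j ω)) = Rw n i := fun n i => by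
    funext ω; simp [Rw, Finset.sum_apply]
  have hcol : ∀ n i, iIndepFun (fun j ω => f n i (e i j ω)) P := fun n i =>
    (hrow i).comp (fun _ => f n i) fun _ => hfm n i
  have hRmgf : ∀ n, 2 ≤ n → ∀ i < n, mgf (Rw n i) P 1 ≤ Real.exp (2 * (m * logRatio n)) := by
    intro n hn i hi
    have hN0 : (0 : ℝ) < N n i := by exact_mod_cast hN1 n i hi
    rw [← hRsum, (hcol n i).mgf_sum fun j => (hfm n i).comp (hem i j)]
    calc _ ≤ ∏ j ∈ Finset.range (N n i), Real.exp (2 * (m * logRatio n / N n i)) :=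
          Finset.prod_le_prod (fun _ _ => mgf_nonneg) fun j _ => hmgf n hn i hi j
      _ = _ := by
          rw [Finset.prod_const, Finset.card_range, ← Real.exp_nat_mul]; congr 1; field_simp
  have hRint : ∀ n i, Integrable (fun ω => Real.exp (1 * Rw n i ω)) P := fun n i => by
    have := (hcol n i).integrable_exp_mul_sum (t := 1) (s := Finset.range (N n i))
      (fun j => (hfm n i).comp (hem i j)) fun j _ => hexpint n i j
    rwa [hRsum] at this
  -- The `n` rows together have exponential moment at most exp (2m log n). Exceeding (2m + 2) log n
  -- therefore has probability at most n^(-2).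
  have hch : ∀ᵐ ω ∂P, ∀ᶠ n : ℕ in atTop,
      ∑ i ∈ Finset.range n, Rw n i ω < (2 * m + 2) * Real.log n := by
    refine ae_eventually_of_summable (f := fun n : ℕ => 1 / (n : ℝ) ^ 2)
      (Real.summable_one_div_nat_pow.2 (by norm_num)) ?_
    filter_upwards [eventually_ge_atTop 2] with n hn
    have hn0 : (0 : ℝ) < n := by exact_mod_cast (by omega : 0 < n)
    have h1 := measure_ge_le_exp_mul_mgf (μ := P) (X := ∑ i ∈ Finset.range n, Rw n i)
      ((2 * m + 2) * Real.log n) zero_le_one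
      ((hRind n).integrable_exp_mul_sum (hRm n) fun i _ => hRint n i)
    rw [(hRind n).mgf_sum (hRm n)] at h1
    have h2 : ∏ i ∈ Finset.range n, mgf (Rw n i) P 1 ≤ Real.exp (n * (2 * (m * logRatio n))) := by
      calc _ ≤ ∏ i ∈ Finset.range n, Real.exp (2 * (m * logRatio n)) :=
            Finset.prod_le_prod (fun _ _ => mgf_nonneg) fun i hi =>
              hRmgf n hn i (Finset.mem_range.1 hi)
        _ = _ := by rw [Finset.prod_const, Finset.card_range, ← Real.exp_nat_mul]
    simp only [Finset.sum_apply] at h1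
    simp only [not_lt]
    refine h1.trans ((mul_le_mul_of_nonneg_left h2 (Real.exp_pos _).le).trans (le_of_eq ?_))
    rw [← Real.exp_add, logRatio]
    have : -1 * ((2 * m + 2) * Real.log n) + n * (2 * (m * (Real.log n / n))) =
        Real.log n * (-(2 : ℕ)) := by
      push_cast; field_simp; ring
    rw [this, ← Real.rpow_def_of_pos hn0, Real.rpow_neg hn0.le, Real.rpow_natCast, one_div]
  filter_upwards [hch, ae_eventually_le_mul_truncLevel he N hr hint hm hc hs hN1 hN] with ω h1 h2
  refine ⟨2 * m + 2, ?_⟩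
  filter_upwards [h1, h2, eventually_ge_atTop 2] with n h3 h4 hn
  have hQ := truncLevel_pos r hn
  have hn0 : (0 : ℝ) < n := by exact_mod_cast (by omega : 0 < n)
  have hrw : ∀ i ∈ Finset.range n, 1 / (N n i : ℝ) *
      ∑ j ∈ Finset.range (N n i), excess (truncLevel r n) (e i j ω) = truncLevel r n * Rw n i ω := by
    intro i hi
    have hi' := Finset.mem_range.1 hi
    have hN0 : (0 : ℝ) < N n i := by exact_mod_cast hN1 n i hi'
    simp only [Rw, Finset.mul_sum]
    refine Finset.sum_congr rfl fun j hj => ?_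
    simp only [f, if_pos (h4 i hi' j (Finset.mem_range.1 hj))]
    field_simp
  rw [Finset.sum_congr rfl hrw, ← Finset.mul_sum]
  calc _ ≤ 1 / (n : ℝ) * (truncLevel r n * ((2 * m + 2) * Real.log n)) := by gcongr
    _ = _ := by rw [logRatio]; ring

end Residuals

/-! ### Box deviations for unbounded nonnegative weights -/

section WeightedDeviation

variable {Ω E : Type*} [MeasurableSpace Ω] [MeasurableSpace E] {P : Measure Ω}
  [IsProbabilityMeasure P] {d : ℕ}

/-- Expand the square and use w_j w_k ≤ (w_j² + w_k²) / 2. The hypothesis `hsq` bounds the second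
moment of a weight on each event that two points lie in `A`, so only the probabilities of pairs
remain; they carry the difference between sparse and dense sampling. -/
theorem integral_boxAvg_sq_le {subj : Ω → E} (hsubj : Measurable subj) (N : ℕ)
    {x : ℕ → E → Fin d → ℝ} (hx : ∀ j, Measurable (x j)) {w : ℕ → E → ℝ}
    (hw : ∀ j, Measurable (w j)) {Q C : ℝ} (hw0 : ∀ j e, 0 ≤ w j e) (hwQ : ∀ j e, w j e ≤ Q)
    (hC : 0 ≤ C) {A : Set (Fin d → ℝ)} (hA : MeasurableSet A)
    (hsq : ∀ j k, ∫⁻ ω in {ω | x j (subj ω) ∈ A ∧ x k (subj ω) ∈ A},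
      ENNReal.ofReal (w j (subj ω) ^ 2) ∂P ≤
        ENNReal.ofReal C * P {ω | x j (subj ω) ∈ A ∧ x k (subj ω) ∈ A}) :
    ∫ ω, boxAvg N w x A (subj ω) ^ 2 ∂P ≤ C * ((1 / (N : ℝ)) ^ 2 * ∑ j ∈ Finset.range N,
      ∑ k ∈ Finset.range N, P.real {ω | x j (subj ω) ∈ A ∧ x k (subj ω) ∈ A}) := by
  set S : ℕ → ℕ → Set Ω := fun j k => {ω | x j (subj ω) ∈ A ∧ x k (subj ω) ∈ A} with hS
  have hSm : ∀ j k, MeasurableSet (S j k) := fun j k =>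
    (((hx j).comp hsubj) hA).inter (((hx k).comp hsubj) hA)
  have hswap : ∀ j k, S j k = S k j := fun j k => by ext ω; simp [hS, and_comm]
  let g : ℕ → Ω → ℝ := fun j ω => w j (subj ω) ^ 2
  have hgm : ∀ j, Measurable (g j) := fun j => ((hw j).comp hsubj).pow_const 2
  have hgint : ∀ j, Integrable (g j) P := fun j =>
    Integrable.of_bound (hgm j).aestronglyMeasurable (Q ^ 2) (ae_of_all _ fun ω => by
      rw [Real.norm_of_nonneg (sq_nonneg _)]
      exact pow_le_pow_left₀ (hw0 j _) (hwQ j _) 2)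
  have hone : ∀ j k, ∫ ω, (S j k).indicator (g j) ω ∂P ≤ C * P.real (S j k) := by
    intro j k
    rw [integral_indicator (hSm j k), integral_eq_lintegral_of_nonneg_ae
      (ae_of_all _ fun ω => sq_nonneg _) (hgm j).aestronglyMeasurable]
    have := ENNReal.toReal_mono (ENNReal.mul_ne_top ENNReal.ofReal_ne_top (measure_ne_top P _))
      (hsq j k)
    rwa [ENNReal.toReal_mul, ENNReal.toReal_ofReal hC] at this
  have hpt : ∀ ω, boxAvg N w x A (subj ω) ^ 2 ≤ (1 / (N : ℝ)) ^ 2 * ∑ j ∈ Finset.range N,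
      ∑ k ∈ Finset.range N, ((S j k).indicator (g j) ω + (S j k).indicator (g k) ω) / 2 := by
    intro ω
    rw [boxAvg, mul_pow, sq (∑ j ∈ Finset.range N, _), Finset.sum_mul_sum]
    refine mul_le_mul_of_nonneg_left (Finset.sum_le_sum fun j _ => Finset.sum_le_sum fun k _ => ?_)
      (by positivity)
    by_cases hj : x j (subj ω) ∈ A <;> by_cases hk : x k (subj ω) ∈ A
    · have : ω ∈ S j k := ⟨hj, hk⟩
      rw [indicator_of_mem hj, indicator_of_mem hk, indicator_of_mem this, indicator_of_mem this]
      simp only [g]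
      nlinarith [sq_nonneg (w j (subj ω) - w k (subj ω))]
    all_goals
      have : ω ∉ S j k := fun h => by first | exact hj h.1 | exact hk h.2
      simp [hj, hk, this]
  have hind : ∀ j k l, Integrable ((S j k).indicator (g l)) P := fun j k l =>
    (hgint l).indicator (hSm j k)
  have hind2 : ∀ j k, Integrable (fun ω => ((S j k).indicator (g j) ω +
      (S j k).indicator (g k) ω) / 2) P := fun j k => ((hind j k j).add (hind j k k)).div_const 2
  have hint : Integrable (fun ω => (1 / (N : ℝ)) ^ 2 * ∑ j ∈ Finset.range N,
      ∑ k ∈ Finset.range N, ((S j k).indicator (g j) ω + (S j k).indicator (g k) ω) / 2) P :=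
    (integrable_finsetSum _ fun j _ => integrable_finsetSum _ fun k _ => hind2 j k).const_mul _
  calc _ ≤ ∫ ω, (1 / (N : ℝ)) ^ 2 * ∑ j ∈ Finset.range N,
      ∑ k ∈ Finset.range N, ((S j k).indicator (g j) ω + (S j k).indicator (g k) ω) / 2 ∂P := by
        refine integral_mono_of_nonneg (ae_of_all _ fun ω => sq_nonneg _) hint (ae_of_all _ hpt)
    _ = (1 / (N : ℝ)) ^ 2 * ∑ j ∈ Finset.range N, ∑ k ∈ Finset.range N,
        (∫ ω, (S j k).indicator (g j) ω ∂P + ∫ ω, (S j k).indicator (g k) ω ∂P) / 2 := by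
        rw [integral_const_mul, integral_finsetSum _ fun j _ =>
          integrable_finsetSum _ fun k _ => hind2 j k]
        congr 1
        refine Finset.sum_congr rfl fun j _ => ?_
        rw [integral_finsetSum _ fun k _ => hind2 j k]
        refine Finset.sum_congr rfl fun k _ => ?_
        rw [integral_div, integral_add (hind j k j) (hind j k k)]
    _ ≤ (1 / (N : ℝ)) ^ 2 * ∑ j ∈ Finset.range N, ∑ k ∈ Finset.range N, C * P.real (S j k) := by
        gcongr with j _ k _
        have h1 := hone j k
        have h2 := hone k j
        rw [hswap k j] at h2
        linarith
    _ = _ := by simp_rw [← Finset.mul_sum]; ring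

/-- Deviations of averages of weights with a moment of order `r`, uniformly over small boxes. -/
theorem ae_eventually_weighted_box_deviation_le {subj : ℕ → Ω → E}
    (hsubj : ∀ i, Measurable (subj i)) (hind : iIndepFun subj P) (N : ℕ → ℕ → ℕ)
    {x : ℕ → E → Fin d → ℝ} (hx : ∀ j, Measurable (x j)) {a : ℕ → E → ℝ}
    (ha : ∀ j, Measurable (a j)) (ha0 : ∀ j e, 0 ≤ a j e) {r m : ℝ} (hr : 2 < r)
    (hint : ∀ i j, Integrable (fun ω => a j (subj i ω) ^ r) P)
    (hm : ∀ i j, ∫ ω, a j (subj i ω) ^ r ∂P ≤ m)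
    (hres : ∀ᵐ ω ∂P, ∃ C, ∀ᶠ n : ℕ in atTop, 1 / (n : ℝ) * ∑ i ∈ Finset.range n, 1 / (N n i : ℝ) *
      ∑ j ∈ Finset.range (N n i), excess (truncLevel r n) (a j (subj i ω)) ≤
        C * (truncLevel r n * logRatio n))
    {B : ℝ} (hB : 0 ≤ B) (hsq : ∀ i j k A, MeasurableSet A →
      ∫⁻ ω in {ω | x j (subj i ω) ∈ A ∧ x k (subj i ω) ∈ A}, ENNReal.ofReal (a j (subj i ω) ^ 2) ∂P ≤
        ENNReal.ofReal B * P {ω | x j (subj i ω) ∈ A ∧ x k (subj i ω) ∈ A})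
    {side : ℕ → Fin d → ℝ} {v : ℕ → ℝ} {Cv : ℝ}
    (hcount : ∀ᶠ n : ℕ in atTop, ∀ i < n, ∀ a b : Fin d → ℤ,
      (∀ k, (b k - a k + 1 : ℝ) ≤ 4 * (n * side n k)) →
        (1 / (N n i : ℝ)) ^ 2 * ∑ j ∈ Finset.range (N n i), ∑ k ∈ Finset.range (N n i),
          P.real {ω | x j (subj i ω) ∈ gridBox n a b ∧ x k (subj i ω) ∈ gridBox n a b} ≤ Cv * v n)
    (hv : ∀ᶠ n in atTop, 0 < v n) {CQ : ℝ}
    (hQ : ∀ᶠ n : ℕ in atTop, truncLevel r n ^ 2 * logRatio n ≤ CQ * v n)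
    (hside : ∀ᶠ n : ℕ in atTop, ∀ k, 1 ≤ n * side n k)
    {C : ℝ} (hslab : ∀ᶠ n : ℕ in atTop, ∀ i < n, ∀ j k (c : ℤ),
      P.real {ω | ⌊n * x j (subj i ω) k⌋ = c} ≤ C / n) (R : ℕ) :
    ∀ᵐ ω ∂P, ∃ C', ∀ᶠ n : ℕ in atTop, ∀ I : Fin d → Set ℝ, (∀ k, (I k).OrdConnected) →
      (∀ k, I k ⊆ Icc (-(R : ℝ)) R) → (∀ k, ∀ y ∈ I k, ∀ z ∈ I k, z - y ≤ 2 * side n k) →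
      |1 / (n : ℝ) * ∑ i ∈ Finset.range n, (boxAvg (N n i) a x (univ.pi I) (subj i ω) -
        ∫ ω', boxAvg (N n i) a x (univ.pi I) (subj i ω') ∂P)| ≤ C' * √(v n * logRatio n) := by
  set Q := truncLevel r with hQdef
  have hr0 : 0 < r := by linarith
  -- The weight is split into a part `w` bounded by the truncation level and its excess `u`.
  -- Bernstein applies to `w`; the average of `u` and its mean are estimated without regard to the
  -- box.
  let w : ℕ → ℕ → E → ℝ := fun n j e => a j e - excess (Q n) (a j e)
  let u : ℕ → ℕ → E → ℝ := fun n j e => excess (Q n) (a j e)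
  have hum : ∀ n j, Measurable (u n j) := fun n j => (measurable_excess _).comp (ha j)
  have hwm : ∀ n j, Measurable (w n j) := fun n j => (ha j).sub (hum n j)
  have hu0 : ∀ n j e, 0 ≤ u n j e := fun n j e => excess_nonneg (ha0 j e)
  have hw0 : ∀ n j e, 0 ≤ w n j e := fun n j e => sub_nonneg.2 (excess_le (ha0 j e))
  have hwa : ∀ n j e, w n j e ≤ a j e := fun n j e => sub_le_self _ (hu0 n j e)
  have hwQ : ∀ n j e, w n j e ≤ Q n := fun n j e => sub_excess_le (truncLevel_nonneg r n)
  -- Large enough that `D * v n` serves both as second moment bound and in the condition on the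
  -- truncation level.
  set D : ℝ := |CQ| + B * |Cv| + 1 with hD
  have hD0 : 0 < D := by positivity
  have hQ' : ∀ᶠ n : ℕ in atTop, Q n ^ 2 * Real.log n ≤ n * (D * v n) := by
    filter_upwards [hQ, hv, eventually_ge_atTop 1] with n h1 h2 hn
    have hn0 : (0 : ℝ) < n := by exact_mod_cast hn
    have h3 : CQ * v n ≤ D * v n := by
      refine mul_le_mul_of_nonneg_right ?_ h2.le
      have := le_abs_self CQ
      have : 0 ≤ B * |Cv| := by positivity
      linarith
    have h4 : Q n ^ 2 * Real.log n = n * (Q n ^ 2 * logRatio n) := by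
      rw [logRatio]; field_simp
    rw [h4]
    exact mul_le_mul_of_nonneg_left (h1.trans h3) hn0.le
  have hmom' : ∀ᶠ n : ℕ in atTop, ∀ i < n, ∀ a b : Fin d → ℤ,
      (∀ k, (b k - a k + 1 : ℝ) ≤ 4 * (n * side n k)) →
        ∫ ω, boxAvg (N n i) (w n) x (gridBox n a b) (subj i ω) ^ 2 ∂P ≤ D * v n := by
    filter_upwards [hcount, hv] with n h1 h2 i hi b c hbc
    have hS := integral_boxAvg_sq_le (P := P) (hsubj i) (N n i) hx (hwm n) (hw0 n) (hwQ n) hB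
      (measurableSet_gridBox n b c) (fun j k => le_trans (lintegral_mono fun ω =>
        ENNReal.ofReal_le_ofReal (pow_le_pow_left₀ (hw0 n j _) (hwa n j _) 2))
        (hsq i j k _ (measurableSet_gridBox n b c)))
    refine hS.trans ((mul_le_mul_of_nonneg_left (h1 i hi b c hbc) hB).trans ?_)
    rw [← mul_assoc]
    refine mul_le_mul_of_nonneg_right ?_ h2.le
    have : B * Cv ≤ B * |Cv| := by gcongr; exact le_abs_self _
    have := abs_nonneg CQ
    linarith
  obtain ⟨C₁, hdev⟩ := ae_eventually_box_deviation_le (P := P) hsubj hind N hx hwm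
    (Q := Q) (v := fun n => D * v n) hw0 hwQ (side := side)
    (by filter_upwards [hv] with n h using mul_pos hD0 h) hside hQ' hmom' hslab R
  filter_upwards [hdev, hres] with ω h1 ⟨C₂, h2⟩
  refine ⟨(|C₁| * √D + (|C₂| + m) * √|CQ|), ?_⟩
  filter_upwards [h1, h2, hv, hQ, eventually_ge_atTop 2] with n h3 h4 h5 h6 hn I hI hIR hIs
  have hQn := truncLevel_pos r hn
  have hρ := logRatio_pos hn
  have hm0 : 0 ≤ m := (integral_nonneg fun ω => Real.rpow_nonneg (ha0 0 _) r).trans (hm 0 0)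
  set A := univ.pi I with hA
  have hAm : MeasurableSet A := MeasurableSet.univ_pi fun k => (hI k).measurableSet
  set τ := √(v n * logRatio n) with hτ
  have hτ0 : 0 ≤ τ := Real.sqrt_nonneg _
  -- The excess is of order Qρ, and (Qρ)² = (Q²ρ)ρ ≤ |CQ| vρ: the level condition makes it no larger
  -- than the fluctuation.
  have hQτ : Q n * logRatio n ≤ √|CQ| * τ := by
    rw [hτ, ← Real.sqrt_mul (abs_nonneg _)]
    refine Real.le_sqrt_of_sq_le ?_
    have : CQ * v n ≤ |CQ| * v n := by gcongr; exact le_abs_self _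
    nlinarith
  have hdevw := h3 I hI hIR hIs
  have e0 : √(D * v n * Real.log n / n) = √D * τ := by
    rw [hτ, ← Real.sqrt_mul hD0.le, logRatio]; congr 1; ring
  rw [e0] at hdevw
  have hsplit : ∀ i ω', boxAvg (N n i) a x A (subj i ω') =
      boxAvg (N n i) (w n) x A (subj i ω') + boxAvg (N n i) (u n) x A (subj i ω') := by
    intro i ω'
    rw [boxAvg, boxAvg, boxAvg, ← mul_add, ← Finset.sum_add_distrib]
    congr 1
    refine Finset.sum_congr rfl fun j _ => ?_
    by_cases hj : x j (subj i ω') ∈ A <;> simp [hj, w, u]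
  have hule : ∀ i ω', boxAvg (N n i) (u n) x A (subj i ω') ≤
      1 / (N n i : ℝ) * ∑ j ∈ Finset.range (N n i), u n j (subj i ω') := fun i ω' =>
    mul_le_mul_of_nonneg_left (Finset.sum_le_sum fun j _ =>
      indicator_le_self' (fun _ _ => hu0 n j _) _) (by positivity)
  have huint : ∀ i j, Integrable (fun ω' => u n j (subj i ω')) P := fun i j =>
    ((hint i j).const_mul (Q n ^ (1 - r))).mono'
      ((hum n j).comp (hsubj i)).aestronglyMeasurable (ae_of_all _ fun ω' => by
        rw [Real.norm_of_nonneg (hu0 n j _)]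
        exact excess_le_rpow hQn (by linarith) (ha0 j _))
  have huint' : ∀ i, Integrable (fun ω' => 1 / (N n i : ℝ) *
      ∑ j ∈ Finset.range (N n i), u n j (subj i ω')) P := fun i =>
    (integrable_finsetSum _ fun j _ => huint i j).const_mul _
  have hbuint : ∀ i, Integrable (fun ω' => boxAvg (N n i) (u n) x A (subj i ω')) P := fun i =>
    (huint' i).mono' ((measurable_boxAvg (hum n) hx hAm).comp (hsubj i)).aestronglyMeasurable
      (ae_of_all _ fun ω' => by
        rw [Real.norm_of_nonneg (boxAvg_nonneg (fun j => hu0 n j _) _)]; exact hule i ω')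
  have hbwint : ∀ i, Integrable (fun ω' => boxAvg (N n i) (w n) x A (subj i ω')) P := fun i =>
    Integrable.of_bound ((measurable_boxAvg (hwm n) hx hAm).comp (hsubj i)).aestronglyMeasurable
      (Q n) (ae_of_all _ fun ω => by
      rw [Real.norm_of_nonneg (boxAvg_nonneg (fun j => hw0 n j _) _)]
      exact boxAvg_le (fun j => hw0 n j _) (fun j => hwQ n j _) _)
  have hmean : ∀ i, 0 ≤ ∫ ω', boxAvg (N n i) (u n) x A (subj i ω') ∂P ∧
      ∫ ω', boxAvg (N n i) (u n) x A (subj i ω') ∂P ≤ m * (Q n * logRatio n) := by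
    intro i
    refine ⟨integral_nonneg fun ω' => boxAvg_nonneg (fun j => hu0 n j _) _, ?_⟩
    calc _ ≤ _ := integral_mono (hbuint i) (huint' i) (hule i)
      _ = 1 / (N n i : ℝ) * ∑ j ∈ Finset.range (N n i), ∫ ω', u n j (subj i ω') ∂P := by
          rw [integral_const_mul, integral_finsetSum _ fun j _ => huint i j]
      _ ≤ _ := by
          refine one_div_mul_sum_le (by positivity) fun j _ => ?_
          refine (integral_excess_le ((ha j).comp (hsubj i)) (fun ω' => ha0 j _) (hint i j)
            (hm i j) hQn (by linarith)).trans (le_of_eq ?_)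
          rw [truncLevel_rpow_one_sub hr0.ne' hn, mul_comm]
  have hG : 1 / (n : ℝ) * ∑ i ∈ Finset.range n, (boxAvg (N n i) a x A (subj i ω) -
        ∫ ω', boxAvg (N n i) a x A (subj i ω') ∂P) =
      1 / (n : ℝ) * ∑ i ∈ Finset.range n, (boxAvg (N n i) (w n) x A (subj i ω) -
        ∫ ω', boxAvg (N n i) (w n) x A (subj i ω') ∂P) +
      1 / (n : ℝ) * ∑ i ∈ Finset.range n, boxAvg (N n i) (u n) x A (subj i ω) -
      1 / (n : ℝ) * ∑ i ∈ Finset.range n, ∫ ω', boxAvg (N n i) (u n) x A (subj i ω') ∂P := by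
    rw [← mul_add, ← Finset.sum_add_distrib, ← mul_sub, ← Finset.sum_sub_distrib]
    congr 1
    refine Finset.sum_congr rfl fun i _ => ?_
    simp_rw [hsplit]
    rw [integral_add (hbwint i) (hbuint i)]
    ring
  have hb1 : 0 ≤ 1 / (n : ℝ) * ∑ i ∈ Finset.range n, boxAvg (N n i) (u n) x A (subj i ω) :=
    mul_nonneg (by positivity) (Finset.sum_nonneg fun i _ => boxAvg_nonneg (fun j => hu0 n j _) _)
  have hb2 : 1 / (n : ℝ) * ∑ i ∈ Finset.range n, boxAvg (N n i) (u n) x A (subj i ω) ≤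
      |C₂| * (Q n * logRatio n) := by
    refine le_trans (mul_le_mul_of_nonneg_left (Finset.sum_le_sum fun i _ => hule i ω)
      (by positivity)) (h4.trans ?_)
    gcongr
    exact le_abs_self _
  have hb3 : 0 ≤ 1 / (n : ℝ) * ∑ i ∈ Finset.range n,
      ∫ ω', boxAvg (N n i) (u n) x A (subj i ω') ∂P :=
    mul_nonneg (by positivity) (Finset.sum_nonneg fun i _ => (hmean i).1)
  have hb4 := one_div_mul_sum_le (N := n) (by positivity) fun i _ => (hmean i).2
  have hb5 : |C₂| * (Q n * logRatio n) ≤ |C₂| * (√|CQ| * τ) := by gcongr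
  have hb6 : m * (Q n * logRatio n) ≤ m * (√|CQ| * τ) := by gcongr
  have hb7 : C₁ * (√D * τ) ≤ |C₁| * (√D * τ) := by gcongr; exact le_abs_self _
  have hb8 : 0 ≤ |C₂| * (√|CQ| * τ) := by positivity
  have hb9 : 0 ≤ m * (√|CQ| * τ) := by positivity
  have hdevw' := hdevw.trans hb7
  rw [hG]
  rw [abs_le] at hdevw' ⊢
  constructor <;> nlinarith [hdevw'.1, hdevw'.2]

end WeightedDeviation

/-! ### Probabilities of boxes under the design law -/

namespace FunctionalModel

variable {p : ℕ} {Ω S : Type*}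

/-- Lower end points of the sides of the domain, time first. -/
def lower (m : FunctionalModel p Ω S) : Fin (p + 1) → ℝ := Fin.cons m.tlo m.zlo

/-- Upper end points of the sides of the domain, time first. -/
def upper (m : FunctionalModel p Ω S) : Fin (p + 1) → ℝ := Fin.cons m.thi m.zhi

/-- The `j`-th design point of a subject, as a vector. -/
def point (j : ℕ) (e : S × (Fin p → ℝ) × (ℕ → ℝ) × (ℕ → ℝ)) : Fin (p + 1) → ℝ :=
  Fin.cons (e.2.2.1 j) e.2.1

theorem cons_mem_univ_pi_iff {t : ℝ} {z : Fin p → ℝ} {I : Fin (p + 1) → Set ℝ} :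
    (Fin.cons t z : Fin (p + 1) → ℝ) ∈ univ.pi I ↔ (t, z) ∈ I 0 ×ˢ univ.pi fun k : Fin p => I k.succ := by
  simp only [mem_univ_pi, mem_prod, Fin.forall_fin_succ, Fin.cons_zero, Fin.cons_succ]

theorem mem_dom_iff (m : FunctionalModel p Ω S) {t : ℝ} {z : Fin p → ℝ} :
    (t, z) ∈ m.dom ↔
      ∀ k, (Fin.cons t z : Fin (p + 1) → ℝ) k ∈ Icc (m.lower k) (m.upper k) := by
  simp only [dom, timeSet, covSet, lower, upper, mem_prod, Fin.forall_fin_succ, Fin.cons_zero,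
    Fin.cons_succ, mem_Icc, Pi.le_def, forall_and]
  tauto

theorem measurableSet_dom (m : FunctionalModel p Ω S) : MeasurableSet m.dom :=
  measurableSet_Icc.prod measurableSet_Icc

theorem isCompact_dom (m : FunctionalModel p Ω S) : IsCompact m.dom :=
  isCompact_Icc.prod isCompact_Icc

theorem convex_dom (m : FunctionalModel p Ω S) : Convex ℝ m.dom :=
  (convex_Icc _ _).prod (convex_Icc _ _)

section Measure

variable [MeasurableSpace Ω] [MeasurableSpace S]

theorem measurable_point (j : ℕ) : Measurable (point (p := p) (S := S) j) := by
  refine measurable_pi_iff.2 fun k => ?_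
  refine Fin.cases ?_ (fun k => ?_) k
  · simp only [point, Fin.cons_zero]
    exact (measurable_pi_apply j).comp (measurable_fst.comp (measurable_snd.comp measurable_snd))
  · simp only [point, Fin.cons_succ]
    exact (measurable_pi_apply k).comp (measurable_fst.comp measurable_snd)

variable {m : FunctionalModel p Ω S} {P : Measure Ω}

theorem IsEigenAdjusted.measurable_subject (hm : m.IsEigenAdjusted P) (i : ℕ) :
    Measurable (m.subject i) :=
  (hm.meas_ξ i).prodMk ((hm.meas_Z i).prodMk ((measurable_pi_iff.2 fun j => hm.meas_T i j).prodMk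
    (measurable_pi_iff.2 fun j => hm.meas_err i j)))

theorem IsEigenAdjusted.lower_lt_upper (hm : m.IsEigenAdjusted P) (k : Fin (p + 1)) :
    m.lower k < m.upper k := by
  refine Fin.cases ?_ (fun k => ?_) k
  · simpa [lower, upper] using hm.time_nondeg
  · simpa [lower, upper] using hm.cov_nondeg k

theorem IsEigenAdjusted.ae_mem_dom (hm : m.IsEigenAdjusted P) :
    ∀ᵐ ω ∂P, ∀ i j, (m.T i j ω, m.Z i ω) ∈ m.dom := by
  refine ae_all_iff.2 fun i => ae_all_iff.2 fun j => ?_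
  have hmeas : Measurable fun ω => (m.T i j ω, m.Z i ω) := (hm.meas_T i j).prodMk (hm.meas_Z i)
  have h : ∀ᵐ x ∂(P.map fun ω => (m.T i j ω, m.Z i ω)), x ∈ m.dom := by
    rw [hm.law_design]
    exact (withDensity_absolutelyContinuous _ _).ae_le (ae_restrict_mem m.measurableSet_dom)
  exact ae_of_ae_map hmeas.aemeasurable h

theorem volume_prod_univ_pi (I : Fin (p + 1) → Set ℝ) :
    (volume : Measure (ℝ × (Fin p → ℝ))) (I 0 ×ˢ univ.pi fun k : Fin p => I k.succ) = ∏ k, volume (I k) := by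
  rw [Measure.volume_eq_prod, Measure.prod_prod, volume_pi_pi, Fin.prod_univ_succ]

theorem IsEigenAdjusted.measure_point_eq (hm : m.IsEigenAdjusted P) {I : Fin (p + 1) → Set ℝ}
    (hI : ∀ k, MeasurableSet (I k)) (i j : ℕ) :
    P {ω | point j (m.subject i ω) ∈ univ.pi I} =
      ∫⁻ x in I 0 ×ˢ univ.pi fun k : Fin p => I k.succ, ENNReal.ofReal (m.dens x) ∂volume.restrict m.dom := by
  have hmeas : Measurable fun ω => (m.T i j ω, m.Z i ω) := (hm.meas_T i j).prodMk (hm.meas_Z i)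
  have hA : MeasurableSet (I 0 ×ˢ univ.pi fun k : Fin p => I k.succ) :=
    (hI 0).prod (MeasurableSet.univ_pi fun k => hI _)
  rw [← withDensity_apply _ hA, ← hm.law_design i j, Measure.map_apply hmeas hA]
  congr 1
  ext ω
  exact cons_mem_univ_pi_iff

theorem IsEigenAdjusted.measure_point_le (hm : m.IsEigenAdjusted P) {hi : ℝ}
    (hhi : ∀ x ∈ m.dom, m.dens x ≤ hi) {I : Fin (p + 1) → Set ℝ}
    (hI : ∀ k, MeasurableSet (I k)) (i j : ℕ) :
    P {ω | point j (m.subject i ω) ∈ univ.pi I} ≤ ENNReal.ofReal hi * ∏ k, volume (I k) := by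
  rw [hm.measure_point_eq hI, ← volume_prod_univ_pi]
  have hA : MeasurableSet (I 0 ×ˢ univ.pi fun k : Fin p => I k.succ) :=
    (hI 0).prod (MeasurableSet.univ_pi fun k => hI _)
  rw [Measure.restrict_restrict hA]
  calc _ ≤ ∫⁻ _ in (I 0 ×ˢ univ.pi fun k : Fin p => I k.succ) ∩ m.dom, ENNReal.ofReal hi :=
        setLIntegral_mono' (hA.inter m.measurableSet_dom) fun x hx =>
          ENNReal.ofReal_le_ofReal (hhi x hx.2)
    _ ≤ _ := by
        rw [setLIntegral_const]
        gcongr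
        exact inter_subset_left

theorem IsEigenAdjusted.le_measure_point (hm : m.IsEigenAdjusted P) {lo : ℝ}
    (hlo : ∀ x ∈ m.dom, lo ≤ m.dens x) {I : Fin (p + 1) → Set ℝ}
    (hI : ∀ k, MeasurableSet (I k)) (hId : ∀ k, I k ⊆ Icc (m.lower k) (m.upper k)) (i j : ℕ) :
    ENNReal.ofReal lo * ∏ k, volume (I k) ≤ P {ω | point j (m.subject i ω) ∈ univ.pi I} := by
  rw [hm.measure_point_eq hI, ← volume_prod_univ_pi]
  have hA : MeasurableSet (I 0 ×ˢ univ.pi fun k : Fin p => I k.succ) :=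
    (hI 0).prod (MeasurableSet.univ_pi fun k => hI _)
  rw [Measure.restrict_restrict hA]
  have hsub : (I 0 ×ˢ univ.pi fun k : Fin p => I k.succ) ⊆ m.dom := by
    rintro ⟨t, z⟩ htz
    exact m.mem_dom_iff.2 fun k => hId k (cons_mem_univ_pi_iff.2 htz k (mem_univ k))
  rw [inter_eq_left.2 hsub, ← setLIntegral_const]
  exact setLIntegral_mono' hA fun x hx => ENNReal.ofReal_le_ofReal (hlo x (hsub hx))

theorem IsEigenAdjusted.ae_point_mem (hm : m.IsEigenAdjusted P) :
    ∀ᵐ ω ∂P, ∀ i j k, point j (m.subject i ω) k ∈ Icc (m.lower k) (m.upper k) := by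
  filter_upwards [hm.ae_mem_dom] with ω h i j
  exact m.mem_dom_iff.1 (h i j)

theorem gridBox_eq_pi {d : ℕ} (n : ℕ) (a b : Fin d → ℤ) :
    gridBox n a b = univ.pi fun k => {y : ℝ | a k ≤ ⌊n * y⌋ ∧ ⌊n * y⌋ ≤ b k} := by
  ext y; simp [gridBox]

theorem measurableSet_floor_mem (n : ℕ) (a b : ℤ) :
    MeasurableSet {y : ℝ | a ≤ ⌊n * y⌋ ∧ ⌊n * y⌋ ≤ b} := by
  have : Measurable fun y : ℝ => ⌊(n : ℝ) * y⌋ := Int.measurable_floor.comp (by fun_prop)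
  exact this (measurableSet_Icc (a := a) (b := b))

theorem volume_floor_mem_le {n : ℕ} (hn : 0 < n) (a b : ℤ) :
    volume {y : ℝ | a ≤ ⌊n * y⌋ ∧ ⌊n * y⌋ ≤ b} ≤ ENNReal.ofReal ((b - a + 1) / n) := by
  have hn' : (0 : ℝ) < n := by exact_mod_cast hn
  have hsub : {y : ℝ | a ≤ ⌊n * y⌋ ∧ ⌊n * y⌋ ≤ b} ⊆ Icc ((a : ℝ) / n) ((b + 1) / n) := by
    rintro y ⟨h1, h2⟩
    rw [mem_Icc, div_le_iff₀ hn', le_div_iff₀ hn']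
    have e1 := Int.le_floor.1 h1
    have e2 := Int.lt_floor_add_one ((n : ℝ) * y)
    have e3 : (⌊(n : ℝ) * y⌋ : ℝ) ≤ b := by exact_mod_cast h2
    constructor <;> linarith
  refine (measure_mono hsub).trans (le_of_eq ?_)
  rw [Real.volume_Icc]
  congr 1; ring

theorem IsEigenAdjusted.measureReal_point_gridBox_le (hm : m.IsEigenAdjusted P) {hi : ℝ}
    (hhi0 : 0 ≤ hi) (hhi : ∀ x ∈ m.dom, m.dens x ≤ hi) {n : ℕ} (hn : 0 < n) {a b : Fin (p + 1) → ℤ}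
    {side : Fin (p + 1) → ℝ} (hs : ∀ k, 0 ≤ side k)
    (hab : ∀ k, (b k - a k + 1 : ℝ) ≤ 4 * (n * side k)) (i j : ℕ) :
    P.real {ω | point j (m.subject i ω) ∈ gridBox n a b} ≤ hi * (4 ^ (p + 1) * ∏ k, side k) := by
  have hn' : (0 : ℝ) < n := by exact_mod_cast hn
  rw [gridBox_eq_pi]
  have h1 := hm.measure_point_le hhi (fun k => measurableSet_floor_mem n (a k) (b k)) i j
  have h2 : ∏ k, volume {y : ℝ | a k ≤ ⌊n * y⌋ ∧ ⌊n * y⌋ ≤ b k} ≤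
      ENNReal.ofReal (4 ^ (p + 1) * ∏ k, side k) := by
    have : (4 : ℝ) ^ (p + 1) * ∏ k, side k = ∏ k, 4 * side k := by
      rw [Finset.prod_mul_distrib]; simp
    rw [this, ENNReal.ofReal_prod_of_nonneg fun k _ => by have := hs k; positivity]
    gcongr with k
    refine (volume_floor_mem_le hn _ _).trans (ENNReal.ofReal_le_ofReal ?_)
    rw [div_le_iff₀ hn']
    linarith [hab k]
  have h0 : 0 ≤ ∏ k, side k := Finset.prod_nonneg fun k _ => hs k
  have h3 : P {ω | point j (m.subject i ω) ∈ univ.pi fun k =>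
      {y : ℝ | a k ≤ ⌊n * y⌋ ∧ ⌊n * y⌋ ≤ b k}} ≤ ENNReal.ofReal (hi * (4 ^ (p + 1) * ∏ k, side k)) := by
    rw [ENNReal.ofReal_mul hhi0]
    exact h1.trans (by gcongr)
  exact ENNReal.toReal_le_of_le_ofReal (by positivity) h3

/-- Up to a null set the slab is a box with one side of length at most `1 / n` and the full sides of
the domain otherwise. Lengths are raised to at least 1 so that the constant does not depend on `k`.
-/
theorem IsEigenAdjusted.measureReal_slab_le (hm : m.IsEigenAdjusted P) {hi : ℝ}
    (hhi0 : 0 ≤ hi) (hhi : ∀ x ∈ m.dom, m.dens x ≤ hi) {n : ℕ} (hn : 0 < n) (i j : ℕ)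
    (k : Fin (p + 1)) (c : ℤ) :
    P.real {ω | ⌊n * point j (m.subject i ω) k⌋ = c} ≤
      hi * (∏ k, max 1 (m.upper k - m.lower k)) / n := by
  classical
  have hn' : (0 : ℝ) < n := by exact_mod_cast hn
  let I : Fin (p + 1) → Set ℝ := fun l => if l = k then {y : ℝ | c ≤ ⌊n * y⌋ ∧ ⌊n * y⌋ ≤ c} else
    Icc (m.lower l) (m.upper l)
  have hIm : ∀ l, MeasurableSet (I l) := fun l => by
    simp only [I]; split_ifs
    · exact measurableSet_floor_mem n c c
    · exact measurableSet_Icc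
  have hle : P {ω | ⌊n * point j (m.subject i ω) k⌋ = c} ≤
      P {ω | point j (m.subject i ω) ∈ univ.pi I} := by
    refine measure_mono_ae ?_
    filter_upwards [hm.ae_point_mem] with ω hω h l _
    by_cases hl : l = k
    · subst hl
      have h' : ⌊n * point j (m.subject i ω) l⌋ = c := h
      simp only [I, if_true, mem_ofPred_eq, h']
      exact ⟨le_rfl, le_rfl⟩
    · simp only [I, if_neg hl]; exact hω i j l
  have hvol : ∏ l, volume (I l) ≤ ENNReal.ofReal ((∏ k, max 1 (m.upper k - m.lower k)) / n) := by
    have e : ∀ l, volume (I l) ≤ ENNReal.ofReal (max 1 (m.upper l - m.lower l) *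
        (if l = k then 1 / (n : ℝ) else 1)) := by
      intro l
      by_cases hl : l = k
      · simp only [I, if_pos hl]
        refine (volume_floor_mem_le hn _ _).trans (ENNReal.ofReal_le_ofReal ?_)
        rw [sub_self, zero_add]
        exact le_mul_of_one_le_left (by positivity) (le_max_left _ _)
      · simp only [I, if_neg hl, Real.volume_Icc, mul_one]
        exact ENNReal.ofReal_le_ofReal (le_max_right _ _)
    have e2 : (∏ k, max 1 (m.upper k - m.lower k)) / n =
        ∏ l, (max 1 (m.upper l - m.lower l) * (if l = k then 1 / (n : ℝ) else 1)) := by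
      rw [Finset.prod_mul_distrib, Finset.prod_ite_eq' Finset.univ k, if_pos (Finset.mem_univ k)]
      ring
    rw [e2, ENNReal.ofReal_prod_of_nonneg]
    · exact Finset.prod_le_prod' fun l _ => e l
    · intro l _
      have : 0 ≤ max 1 (m.upper l - m.lower l) := zero_le_one.trans (le_max_left _ _)
      split_ifs <;> positivity
  have h0 : 0 ≤ ∏ k, max 1 (m.upper k - m.lower k) :=
    Finset.prod_nonneg fun k _ => zero_le_one.trans (le_max_left _ _)
  refine ENNReal.toReal_le_of_le_ofReal (by positivity) ?_
  rw [mul_div_assoc, ENNReal.ofReal_mul hhi0]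
  exact hle.trans ((hm.measure_point_le hhi hIm i j).trans (by gcongr))

/-- The two points share their covariate, so the event constrains two times and one covariate:
compared with a single point only one further factor, the time side, is gained. -/
theorem IsEigenAdjusted.measureReal_pair_gridBox_le (hm : m.IsEigenAdjusted P) {B : ℝ≥0}
    {i j k : ℕ} (hB : P.map (fun ω => (m.T i j ω, m.T i k ω, m.Z i ω)) ≤ (B : ℝ≥0∞) • volume)
    {n : ℕ} (hn : 0 < n) {a b : Fin (p + 1) → ℤ}
    {side : Fin (p + 1) → ℝ} (hs : ∀ k, 0 ≤ side k)
    (hab : ∀ k, (b k - a k + 1 : ℝ) ≤ 4 * (n * side k)) :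
    P.real {ω | point j (m.subject i ω) ∈ gridBox n a b ∧
      point k (m.subject i ω) ∈ gridBox n a b} ≤ B * (4 ^ (p + 2) * (side 0 * ∏ k, side k)) := by
  have hn' : (0 : ℝ) < n := by exact_mod_cast hn
  set I : Fin (p + 1) → Set ℝ := fun k => {y : ℝ | a k ≤ ⌊n * y⌋ ∧ ⌊n * y⌋ ≤ b k} with hI
  have hIm : ∀ k, MeasurableSet (I k) := fun k => measurableSet_floor_mem n (a k) (b k)
  have hIv : ∀ k, volume (I k) ≤ ENNReal.ofReal (4 * side k) := fun k => by
    refine (volume_floor_mem_le hn _ _).trans (ENNReal.ofReal_le_ofReal ?_)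
    rw [div_le_iff₀ hn']
    linarith [hab k]
  have hA' : MeasurableSet (I 0 ×ˢ univ.pi fun k : Fin p => I k.succ) :=
    (hIm 0).prod (MeasurableSet.univ_pi fun k => hIm _)
  have hA : MeasurableSet (I 0 ×ˢ (I 0 ×ˢ univ.pi fun k : Fin p => I k.succ)) := (hIm 0).prod hA'
  have hmeas : Measurable fun ω => (m.T i j ω, m.T i k ω, m.Z i ω) :=
    (hm.meas_T i j).prodMk ((hm.meas_T i k).prodMk (hm.meas_Z i))
  have h0 : 0 ≤ ∏ k, side k := Finset.prod_nonneg fun k _ => hs k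
  have hs0 := hs 0
  refine ENNReal.toReal_le_of_le_ofReal (by positivity) ?_
  have hsub : {ω | point j (m.subject i ω) ∈ gridBox n a b ∧ point k (m.subject i ω) ∈ gridBox n a b}
      ⊆ (fun ω => (m.T i j ω, m.T i k ω, m.Z i ω)) ⁻¹' (I 0 ×ˢ (I 0 ×ˢ univ.pi fun k : Fin p => I k.succ)) := by
    rintro ω ⟨h1, h2⟩
    rw [gridBox_eq_pi] at h1 h2
    exact ⟨(cons_mem_univ_pi_iff.1 h1).1, cons_mem_univ_pi_iff.1 h2⟩
  have h1 : P {ω | point j (m.subject i ω) ∈ gridBox n a b ∧ point k (m.subject i ω) ∈ gridBox n a b}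
      ≤ B * (volume (I 0) * ∏ k, volume (I k)) := by
    refine (measure_mono hsub).trans ?_
    rw [← Measure.map_apply hmeas hA]
    refine (hB _).trans (le_of_eq ?_)
    rw [Measure.smul_apply, Measure.volume_eq_prod, Measure.prod_prod, volume_prod_univ_pi, smul_eq_mul]
  refine h1.trans ?_
  have e : (B : ℝ) * (4 ^ (p + 2) * (side 0 * ∏ k, side k)) = B * ((4 * side 0) * ∏ k, 4 * side k) := by
    rw [Finset.prod_mul_distrib, Finset.prod_const, Finset.card_univ, Fintype.card_fin]; ring
  have h4 : 0 ≤ 4 * side 0 := by positivity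
  rw [e, ENNReal.ofReal_mul B.coe_nonneg, ENNReal.ofReal_mul h4, ENNReal.ofReal_coe_nnreal,
    ENNReal.ofReal_prod_of_nonneg fun k _ => by have := hs k; positivity]
  gcongr with k
  · exact hIv 0
  · exact hIv k

end Measure

end FunctionalModel

/-! ### Noise as latent deviation plus measurement error -/

namespace FunctionalModel

variable {p : ℕ} {Ω S : Type*}

/-- Deviation of the latent trajectory from the mean function at the `j`-th design point. -/
noncomputable def latentDev (m : FunctionalModel p Ω S) (j : ℕ)
    (e : S × (Fin p → ℝ) × (ℕ → ℝ) × (ℕ → ℝ)) : ℝ :=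
  m.X e.1 (e.2.2.1 j) e.2.1 - m.dom.indicator m.mean (e.2.2.1 j, e.2.1)

/-- Measurement error at the `j`-th design point. -/
def errAt (j : ℕ) (e : S × (Fin p → ℝ) × (ℕ → ℝ) × (ℕ → ℝ)) : ℝ := e.2.2.2 j

/-- Covariate and observation times of a subject. -/
def design (m : FunctionalModel p Ω S) (i : ℕ) (ω : Ω) : (Fin p → ℝ) × (ℕ → ℝ) :=
  (m.Z i ω, fun j => m.T i j ω)

theorem MeanRegular.continuousOn {m : FunctionalModel p Ω S} (h : m.MeanRegular) :
    ContinuousOn m.mean m.dom :=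
  h.1.continuousOn

variable [MeasurableSpace Ω] [MeasurableSpace S] {m : FunctionalModel p Ω S} {P : Measure Ω}

/-- Regularity of the mean is assumed on the domain only, so it is cut off outside to become
measurable; almost surely the design never leaves the domain. -/
theorem measurable_indicator_mean (hc : ContinuousOn m.mean m.dom) :
    Measurable (m.dom.indicator m.mean) := by
  classical
  rw [← piecewise_eq_indicator]
  exact hc.measurable_piecewise continuousOn_const m.measurableSet_dom

theorem IsEigenAdjusted.measurable_latentDev (hm : m.IsEigenAdjusted P)
    (hc : ContinuousOn m.mean m.dom) (j : ℕ) : Measurable (m.latentDev j) := by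
  have h1 : Measurable fun e : S × (Fin p → ℝ) × (ℕ → ℝ) × (ℕ → ℝ) => e.2.2.1 j :=
    (measurable_pi_apply j).comp (measurable_fst.comp (measurable_snd.comp measurable_snd))
  have h2 : Measurable fun e : S × (Fin p → ℝ) × (ℕ → ℝ) × (ℕ → ℝ) => e.2.1 :=
    measurable_fst.comp measurable_snd
  exact (hm.meas_X.comp (measurable_fst.prodMk (h1.prodMk h2))).sub
    ((measurable_indicator_mean hc).comp (h1.prodMk h2))

theorem measurable_errAt (j : ℕ) : Measurable (errAt (p := p) (S := S) j) :=
  (measurable_pi_apply j).comp (measurable_snd.comp (measurable_snd.comp measurable_snd))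

theorem IsEigenAdjusted.measurable_design (hm : m.IsEigenAdjusted P) (i : ℕ) :
    Measurable (m.design i) :=
  (hm.meas_Z i).prodMk (measurable_pi_iff.2 fun j => hm.meas_T i j)

theorem measurable_cons_design (j : ℕ) : Measurable fun δ : (Fin p → ℝ) × (ℕ → ℝ) =>
    (Fin.cons (δ.2 j) δ.1 : Fin (p + 1) → ℝ) := by
  refine measurable_pi_iff.2 fun k => ?_
  refine Fin.cases ?_ (fun k => ?_) k
  · simp only [Fin.cons_zero]
    exact (measurable_pi_apply j).comp measurable_snd
  · simp only [Fin.cons_succ]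
    exact (measurable_pi_apply k).comp measurable_fst

theorem measurableSet_pair_mem (j k : ℕ) {A : Set (Fin (p + 1) → ℝ)} (hA : MeasurableSet A) :
    MeasurableSet {δ : (Fin p → ℝ) × (ℕ → ℝ) | (Fin.cons (δ.2 j) δ.1 : Fin (p + 1) → ℝ) ∈ A ∧
        (Fin.cons (δ.2 k) δ.1 : Fin (p + 1) → ℝ) ∈ A} :=
  (measurable_cons_design j hA).inter (measurable_cons_design k hA)

/-- The deviation of the latent trajectory as a function of design and outcome. -/
noncomputable def devOf (m : FunctionalModel p Ω S) (j : ℕ)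
    (q : ((Fin p → ℝ) × (ℕ → ℝ)) × S) : ℝ :=
  m.X q.2 (q.1.2 j) q.1.1 - m.dom.indicator m.mean (q.1.2 j, q.1.1)

theorem IsEigenAdjusted.measurable_devOf (hm : m.IsEigenAdjusted P)
    (hc : ContinuousOn m.mean m.dom) (j : ℕ) : Measurable (m.devOf j) := by
  have h1 : Measurable fun q : ((Fin p → ℝ) × (ℕ → ℝ)) × S => q.1.2 j :=
    (measurable_pi_apply j).comp (measurable_snd.comp measurable_fst)
  have h2 : Measurable fun q : ((Fin p → ℝ) × (ℕ → ℝ)) × S => q.1.1 :=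
    measurable_fst.comp measurable_fst
  exact (hm.meas_X.comp (measurable_snd.prodMk (h1.prodMk h2))).sub
    ((measurable_indicator_mean hc).comp (h1.prodMk h2))

variable [IsProbabilityMeasure P]

/-- Lets one condition on the design by Fubini: for a frozen design the outcome keeps its law. -/
theorem IsEigenAdjusted.map_design_prod (hm : m.IsEigenAdjusted P) (i : ℕ) :
    P.map (fun ω => (m.design i ω, m.ξ i ω)) = (P.map (m.design i)).prod (P.map (m.ξ i)) :=
  (indepFun_iff_map_prod_eq_prod_map_map (hm.measurable_design i).aemeasurable
    (hm.meas_ξ i).aemeasurable).1 (hm.indep_design i).symm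

theorem IsEigenAdjusted.ae_design_mem_dom (hm : m.IsEigenAdjusted P) (i j : ℕ) :
    ∀ᵐ δ ∂P.map (m.design i), (δ.2 j, δ.1) ∈ m.dom := by
  have hmeas : Measurable fun δ : (Fin p → ℝ) × (ℕ → ℝ) => (δ.2 j, δ.1) :=
    ((measurable_pi_apply j).comp measurable_snd).prodMk measurable_fst
  rw [ae_map_iff (hm.measurable_design i).aemeasurable (hmeas m.measurableSet_dom)]
  filter_upwards [hm.ae_mem_dom] with ω h using h i j

/-- By Fubini over the independent design and outcome, the inner integral at a frozen design is the
variance of `X` at a fixed point of the domain, which is bounded uniformly. -/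
theorem IsEigenAdjusted.exists_lintegral_latentDev_sq_le (hm : m.IsEigenAdjusted P)
    (hc : ContinuousOn m.mean m.dom) : ∃ C : ℝ, 0 ≤ C ∧ ∀ i j B, MeasurableSet B →
      ∫⁻ ω in m.design i ⁻¹' B, ENNReal.ofReal (m.latentDev j (m.subject i ω) ^ 2) ∂P ≤
        ENNReal.ofReal C * P (m.design i ⁻¹' B) := by
  obtain ⟨C, hC⟩ := hm.X_var_bdd
  refine ⟨max C 0, le_max_right _ _, fun i j B hB => ?_⟩
  have hD := hm.measurable_design i
  let F : ((Fin p → ℝ) × (ℕ → ℝ)) × S → ℝ≥0∞ := fun q =>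
    B.indicator 1 q.1 * ENNReal.ofReal (m.devOf j q ^ 2)
  have hFm : Measurable F :=
    ((measurable_one.indicator hB).comp measurable_fst).mul
      ((hm.measurable_devOf hc j).pow_const 2).ennreal_ofReal
  have hpt : ∀ t z, (t, z) ∈ m.dom →
      ∫⁻ s, ENNReal.ofReal ((m.X s t z - m.mean (t, z)) ^ 2) ∂P.map (m.ξ i) ≤
        ENNReal.ofReal (max C 0) := by
    intro t z htz
    have hXm : Measurable fun s => m.X s t z :=
      hm.meas_X.comp (measurable_id.prodMk (measurable_const (a := (t, z))))
    rw [lintegral_map (((hXm.sub_const _).pow_const 2).ennreal_ofReal) (hm.meas_ξ i)]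
    have hL := hm.X_memLp i t htz.1 z htz.2
    have hI : Integrable (fun ω => (m.X (m.ξ i ω) t z - m.mean (t, z)) ^ 2) P :=
      (hL.sub (memLp_const (m.mean (t, z)))).integrable_sq
    rw [← ofReal_integral_eq_lintegral_ofReal hI
      (ae_of_all _ fun ω => sq_nonneg _)]
    refine ENNReal.ofReal_le_ofReal ((le_of_eq ?_).trans ((hC i t htz.1 z htz.2).trans (le_max_left _ _)))
    rw [variance_eq_integral hL.aestronglyMeasurable.aemeasurable, hm.X_mean i t htz.1 z htz.2]
  calc _ = ∫⁻ ω, F (m.design i ω, m.ξ i ω) ∂P := by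
        rw [← lintegral_indicator (hD hB)]
        refine lintegral_congr fun ω => ?_
        by_cases h : m.design i ω ∈ B
        · rw [indicator_of_mem (show ω ∈ m.design i ⁻¹' B from h)]
          simp only [F, indicator_of_mem h, Pi.one_apply, one_mul]
          rfl
        · rw [indicator_of_notMem (show ω ∉ m.design i ⁻¹' B from h)]
          simp only [F, indicator_of_notMem h, zero_mul]
    _ = ∫⁻ q, F q ∂(P.map (m.design i)).prod (P.map (m.ξ i)) := by
        rw [← hm.map_design_prod i, lintegral_map hFm (hD.prodMk (hm.meas_ξ i))]
    _ = ∫⁻ δ, ∫⁻ s, F (δ, s) ∂P.map (m.ξ i) ∂P.map (m.design i) :=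
        lintegral_prod _ hFm.aemeasurable
    _ ≤ ∫⁻ δ, B.indicator 1 δ * ENNReal.ofReal (max C 0) ∂P.map (m.design i) := by
        refine lintegral_mono_ae ?_
        filter_upwards [hm.ae_design_mem_dom i j] with δ hδ
        simp only [F, devOf, indicator_of_mem hδ]
        rw [lintegral_const_mul']
        · gcongr; exact hpt _ _ hδ
        · by_cases h : δ ∈ B <;> simp [h]
    _ = _ := by
        rw [lintegral_mul_const' _ _ ENNReal.ofReal_ne_top, lintegral_indicator_one hB,
          Measure.map_apply hD hB, mul_comm]

theorem IsEigenAdjusted.memLp_latentDev (hm : m.IsEigenAdjusted P)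
    (hc : ContinuousOn m.mean m.dom) (i j : ℕ) :
    MemLp (fun ω => m.latentDev j (m.subject i ω)) 2 P := by
  have hmeas : Measurable fun ω => m.latentDev j (m.subject i ω) :=
    (hm.measurable_latentDev hc j).comp (hm.measurable_subject i)
  rw [memLp_two_iff_integrable_sq hmeas.aestronglyMeasurable]
  obtain ⟨C, hC0, hC⟩ := hm.exists_lintegral_latentDev_sq_le hc
  have := hC i j univ MeasurableSet.univ
  simp only [preimage_univ, Measure.restrict_univ, measure_univ, mul_one] at this
  refine ⟨(hmeas.pow_const 2).aestronglyMeasurable, ?_⟩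
  rw [hasFiniteIntegral_iff_ofReal (ae_of_all _ fun ω => sq_nonneg _)]
  exact this.trans_lt ENNReal.ofReal_lt_top

/-- Conditionally on the design the deviation has mean zero, because `m.mean` is the mean of `X` at
every fixed point of the domain. -/
theorem IsEigenAdjusted.integral_latentDev_eq_zero (hm : m.IsEigenAdjusted P)
    (hc : ContinuousOn m.mean m.dom) (i j : ℕ) {B : Set ((Fin p → ℝ) × (ℕ → ℝ))}
    (hB : MeasurableSet B) :
    ∫ ω, (m.design i ⁻¹' B).indicator (fun ω => m.latentDev j (m.subject i ω)) ω ∂P = 0 := by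
  have hD := hm.measurable_design i
  let F : ((Fin p → ℝ) × (ℕ → ℝ)) × S → ℝ := fun q => B.indicator 1 q.1 * m.devOf j q
  have hFm : Measurable F :=
    ((measurable_one.indicator hB).comp measurable_fst).mul (hm.measurable_devOf hc j)
  have heq : (m.design i ⁻¹' B).indicator (fun ω => m.latentDev j (m.subject i ω)) =
      fun ω => F (m.design i ω, m.ξ i ω) := by
    funext ω
    by_cases h : m.design i ω ∈ B
    · rw [indicator_of_mem (show ω ∈ m.design i ⁻¹' B from h)]
      simp only [F, indicator_of_mem h, Pi.one_apply, one_mul]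
      rfl
    · rw [indicator_of_notMem (show ω ∉ m.design i ⁻¹' B from h)]
      simp only [F, indicator_of_notMem h, zero_mul]
  have hint : Integrable ((m.design i ⁻¹' B).indicator
      fun ω => m.latentDev j (m.subject i ω)) P :=
    ((hm.memLp_latentDev hc i j).integrable one_le_two).indicator (hD hB)
  rw [heq] at hint ⊢
  have hpair : Measurable fun ω => (m.design i ω, m.ξ i ω) := hD.prodMk (hm.meas_ξ i)
  rw [← integral_map hpair.aemeasurable hFm.aestronglyMeasurable]
  have hint' := (integrable_map_measure hFm.aestronglyMeasurable hpair.aemeasurable).2 hint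
  rw [hm.map_design_prod i] at hint' ⊢
  rw [integral_prod _ hint']
  refine integral_eq_zero_of_ae ?_
  filter_upwards [hm.ae_design_mem_dom i j] with δ hδ
  simp only [F, devOf, indicator_of_mem hδ, Pi.zero_apply]
  have hXm : Measurable fun s => m.X s (δ.2 j) δ.1 :=
    hm.meas_X.comp (measurable_id.prodMk (measurable_const (a := (δ.2 j, δ.1))))
  rw [integral_const_mul, integral_map (hm.meas_ξ i).aemeasurable
    (hXm.sub_const _).aestronglyMeasurable, integral_sub
    ((hm.X_memLp i _ hδ.1 _ hδ.2).integrable one_le_two) (integrable_const _),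
    hm.X_mean i _ hδ.1 _ hδ.2]
  simp

theorem IsEigenAdjusted.indep_design_err (hm : m.IsEigenAdjusted P) (i j : ℕ) :
    IndepFun (m.design i) (m.err i j) P :=
  (hm.indep_err i).comp (φ := fun x : S × (Fin p → ℝ) × (ℕ → ℝ) => x.2)
    (ψ := fun y : ℕ → ℝ => y j) measurable_snd (measurable_pi_apply j)

theorem IsEigenAdjusted.lintegral_err_sq_le (hm : m.IsEigenAdjusted P) (i j : ℕ)
    {B : Set ((Fin p → ℝ) × (ℕ → ℝ))} (hB : MeasurableSet B) :
    ∫⁻ ω in m.design i ⁻¹' B, ENNReal.ofReal (errAt j (m.subject i ω) ^ 2) ∂P ≤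
        ENNReal.ofReal (m.σ ^ 2) * P (m.design i ⁻¹' B) := by
  have hD := hm.measurable_design i
  have hE := hm.meas_err i j
  have h1 : ∫⁻ ω, ENNReal.ofReal (m.err i j ω ^ 2) ∂P = ENNReal.ofReal (m.σ ^ 2) := by
    rw [← ofReal_integral_eq_lintegral_ofReal (hm.err_memLp i j).integrable_sq
      (ae_of_all _ fun ω => sq_nonneg _), ← hm.err_var i j,
      variance_of_integral_eq_zero hE.aemeasurable (hm.err_mean i j)]
  have hind : IndepFun (fun ω => B.indicator (1 : (Fin p → ℝ) × (ℕ → ℝ) → ℝ≥0∞) (m.design i ω))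
      (fun ω => ENNReal.ofReal (m.err i j ω ^ 2)) P :=
    (hm.indep_design_err i j).comp (φ := B.indicator (1 : (Fin p → ℝ) × (ℕ → ℝ) → ℝ≥0∞))
      (ψ := fun y : ℝ => ENNReal.ofReal (y ^ 2)) (measurable_one.indicator hB) (by fun_prop)
  rw [← lintegral_indicator (hD hB)]
  calc _ = ∫⁻ ω, (fun ω => B.indicator (1 : (Fin p → ℝ) × (ℕ → ℝ) → ℝ≥0∞) (m.design i ω)) ω *
        (fun ω => ENNReal.ofReal (m.err i j ω ^ 2)) ω ∂P := by
        refine lintegral_congr fun ω => ?_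
        by_cases h : m.design i ω ∈ B
        · rw [indicator_of_mem (show ω ∈ m.design i ⁻¹' B from h)]
          simp only [indicator_of_mem h, Pi.one_apply, one_mul]
          rfl
        · rw [indicator_of_notMem (show ω ∉ m.design i ⁻¹' B from h)]
          simp only [indicator_of_notMem h, zero_mul]
    _ = (∫⁻ ω, B.indicator (1 : (Fin p → ℝ) × (ℕ → ℝ) → ℝ≥0∞) (m.design i ω) ∂P) *
        ∫⁻ ω, ENNReal.ofReal (m.err i j ω ^ 2) ∂P :=
        lintegral_mul_eq_lintegral_mul_lintegral_of_indepFun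
          ((measurable_one.indicator hB).comp hD) ((hE.pow_const 2).ennreal_ofReal) hind
    _ = P (m.design i ⁻¹' B) * ENNReal.ofReal (m.σ ^ 2) := by
        rw [h1]
        congr 1
        have : (fun ω => B.indicator (1 : (Fin p → ℝ) × (ℕ → ℝ) → ℝ≥0∞) (m.design i ω)) =
          (m.design i ⁻¹' B).indicator 1 := rfl
        rw [this, lintegral_indicator_one (hD hB)]
    _ ≤ _ := le_of_eq (mul_comm _ _)

theorem IsEigenAdjusted.integral_err_eq_zero (hm : m.IsEigenAdjusted P) (i j : ℕ)
    {B : Set ((Fin p → ℝ) × (ℕ → ℝ))} (hB : MeasurableSet B) :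
    ∫ ω, (m.design i ⁻¹' B).indicator (fun ω => errAt j (m.subject i ω)) ω ∂P = 0 := by
  have hD := hm.measurable_design i
  have hE := hm.meas_err i j
  have hind : IndepFun (fun ω => B.indicator (1 : (Fin p → ℝ) × (ℕ → ℝ) → ℝ) (m.design i ω)) (m.err i j) P :=
    (hm.indep_design_err i j).comp (φ := B.indicator (1 : (Fin p → ℝ) × (ℕ → ℝ) → ℝ)) (ψ := id)
      (measurable_one.indicator hB) measurable_id
  have heq : (m.design i ⁻¹' B).indicator (fun ω => errAt j (m.subject i ω)) =
      fun ω => B.indicator (1 : (Fin p → ℝ) × (ℕ → ℝ) → ℝ) (m.design i ω) * m.err i j ω := by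
    funext ω
    by_cases h : m.design i ω ∈ B
    · rw [indicator_of_mem (show ω ∈ m.design i ⁻¹' B from h)]
      simp only [indicator_of_mem h, Pi.one_apply, one_mul]
      rfl
    · rw [indicator_of_notMem (show ω ∉ m.design i ⁻¹' B from h)]
      simp only [indicator_of_notMem h, zero_mul]
  rw [heq, hind.integral_fun_mul_eq_mul_integral
    ((measurable_one.indicator hB).comp hD).aestronglyMeasurable hE.aestronglyMeasurable,
    hm.err_mean, mul_zero]

/-- The latent deviations of a subject have an envelope with a moment of order `r`. -/
theorem IsEigenAdjusted.exists_envelope (hm : m.IsEigenAdjusted P)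
    (hc : ContinuousOn m.mean m.dom) {r : ℝ} (hr : 1 ≤ r)
    (hX : ∀ i, AEMeasurable m.supX (P.map fun ω => (m.ξ i ω, m.Z i ω)) ∧
      ∫⁻ ω, m.supX (m.ξ i ω, m.Z i ω) ^ r ∂P < ∞) :
    ∃ G : S × (Fin p → ℝ) × (ℕ → ℝ) × (ℕ → ℝ) → ℝ, Measurable G ∧
      (∀ᵐ ω ∂P, ∀ i j, |m.latentDev j (m.subject i ω)| ≤ G (m.subject i ω)) ∧
      ∀ i, MemLp (fun ω => G (m.subject i ω)) (ENNReal.ofReal r) P := by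
  have hr0 : 0 < r := by linarith
  obtain ⟨C, hC⟩ := m.isCompact_dom.exists_bound_of_continuousOn hc
  -- The supremum over time is only almost everywhere measurable. A measurable version chosen for
  -- subject 0 serves all subjects, their pairs (outcome, covariate) having the same law.
  set g := (hX 0).1.mk m.supX with hg
  have hgm : Measurable g := (hX 0).1.measurable_mk
  have hpairm : ∀ i, Measurable fun ω => (m.ξ i ω, m.Z i ω) := fun i =>
    (hm.meas_ξ i).prodMk (hm.meas_Z i)
  have hprm : Measurable fun e : S × (Fin p → ℝ) × (ℕ → ℝ) × (ℕ → ℝ) => (e.1, e.2.1) :=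
    measurable_fst.prodMk (measurable_fst.comp measurable_snd)
  have hlaw : ∀ i, P.map (fun ω => (m.ξ i ω, m.Z i ω)) = P.map fun ω => (m.ξ 0 ω, m.Z 0 ω) :=
    fun i => ((hm.subjects_ident i).comp hprm).map_eq
  have hgeq : ∀ i, ∀ᵐ ω ∂P, m.supX (m.ξ i ω, m.Z i ω) = g (m.ξ i ω, m.Z i ω) := by
    intro i
    have : ∀ᵐ q ∂(P.map fun ω => (m.ξ i ω, m.Z i ω)), m.supX q = g q := by
      rw [hlaw i]; exact (hX 0).1.ae_eq_mk
    exact ae_of_ae_map (hpairm i).aemeasurable this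
  have hgint : ∀ i, ∫⁻ ω, g (m.ξ i ω, m.Z i ω) ^ r ∂P < ∞ := by
    intro i
    refine lt_of_eq_of_lt (lintegral_congr_ae ?_) (hX i).2
    filter_upwards [hgeq i] with ω h
    rw [h]
  have hgfin : ∀ i, ∀ᵐ ω ∂P, g (m.ξ i ω, m.Z i ω) < ∞ := by
    intro i
    filter_upwards [ae_lt_top ((hgm.comp (hpairm i)).pow_const r) (hgint i).ne] with ω h
    exact (ENNReal.rpow_lt_top_iff_of_pos hr0).1 h
  refine ⟨fun e => (g (e.1, e.2.1)).toReal + C, ((hgm.comp hprm).ennreal_toReal).add_const C, ?_, ?_⟩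
  · filter_upwards [ae_all_iff.2 hgeq, ae_all_iff.2 hgfin, hm.ae_mem_dom] with ω h1 h2 h3 i j
    have hd := h3 i j
    have hmean : |m.mean (m.T i j ω, m.Z i ω)| ≤ C := hC _ hd
    have hXle : |m.X (m.ξ i ω) (m.T i j ω) (m.Z i ω)| ≤ (g (m.ξ i ω, m.Z i ω)).toReal := by
      rw [← ENNReal.ofReal_le_iff_le_toReal (h2 i).ne, ← h1 i]
      exact le_iSup₂ (f := fun t (_ : t ∈ m.timeSet) =>
        ENNReal.ofReal |m.X (m.ξ i ω) t (m.Z i ω)|) (m.T i j ω) hd.1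
    have e1 : m.latentDev j (m.subject i ω) =
        m.X (m.ξ i ω) (m.T i j ω) (m.Z i ω) - m.mean (m.T i j ω, m.Z i ω) := by
      simp only [latentDev, subject, indicator_of_mem hd]
    rw [e1]
    exact (abs_sub _ _).trans (add_le_add hXle hmean)
  · intro i
    refine MemLp.add (f := fun ω => (g (m.ξ i ω, m.Z i ω)).toReal) ?_ (memLp_const C)
    have hmeas : Measurable fun ω => (g (m.ξ i ω, m.Z i ω)).toReal :=
      (hgm.comp (hpairm i)).ennreal_toReal
    rw [← integrable_norm_rpow_iff hmeas.aestronglyMeasurable (by simp [hr0]) ENNReal.ofReal_ne_top,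
      ENNReal.toReal_ofReal hr0.le]
    refine ⟨(hmeas.norm.pow_const r).aestronglyMeasurable, ?_⟩
    rw [hasFiniteIntegral_iff_ofReal (ae_of_all _ fun ω => by positivity)]
    refine lt_of_le_of_lt (lintegral_mono fun ω => ?_) (hgint i)
    rw [Real.norm_of_nonneg ENNReal.toReal_nonneg, ← ENNReal.ofReal_rpow_of_nonneg
      ENNReal.toReal_nonneg hr0.le]
    gcongr
    exact ENNReal.ofReal_toReal_le

theorem IsEigenAdjusted.ae_U_eq (hm : m.IsEigenAdjusted P) : ∀ᵐ ω ∂P, ∀ i j,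
    m.U i j ω = m.latentDev j (m.subject i ω) + errAt j (m.subject i ω) := by
  filter_upwards [hm.ae_mem_dom] with ω h i j
  simp only [U, Y, latentDev, errAt, subject, indicator_of_mem (h i j)]
  ring

/-- The moments are assumed for `U` and for the supremum of the trajectory; the error is the
difference of `U` and the latent deviation, hence inherits them. -/
theorem IsEigenAdjusted.memLp_err (hm : m.IsEigenAdjusted P)
    (hc : ContinuousOn m.mean m.dom) {r : ℝ} (hr : 1 ≤ r)
    (hU : ∀ i j, Integrable (fun ω => |m.U i j ω| ^ r) P)
    (hX : ∀ i, AEMeasurable m.supX (P.map fun ω => (m.ξ i ω, m.Z i ω)) ∧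
      ∫⁻ ω, m.supX (m.ξ i ω, m.Z i ω) ^ r ∂P < ∞) (i j : ℕ) :
    MemLp (fun ω => errAt j (m.subject i ω)) (ENNReal.ofReal r) P := by
  have hr0 : 0 < r := by linarith
  obtain ⟨G, hG, hle, hGL⟩ := hm.exists_envelope hc hr hX
  have h1 : MemLp (fun ω => m.latentDev j (m.subject i ω)) (ENNReal.ofReal r) P := by
    refine (hGL i).mono ((hm.measurable_latentDev hc j).comp
      (hm.measurable_subject i)).aestronglyMeasurable ?_
    filter_upwards [hle] with ω h
    exact (h i j).trans (le_abs_self _)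
  have hVm : Measurable fun ω => m.latentDev j (m.subject i ω) + errAt j (m.subject i ω) :=
    ((hm.measurable_latentDev hc j).comp (hm.measurable_subject i)).add
      ((measurable_errAt j).comp (hm.measurable_subject i))
  have h2 : MemLp (fun ω => m.latentDev j (m.subject i ω) + errAt j (m.subject i ω))
      (ENNReal.ofReal r) P := by
    rw [← integrable_norm_rpow_iff hVm.aestronglyMeasurable (by simp [hr0]) ENNReal.ofReal_ne_top,
      ENNReal.toReal_ofReal hr0.le]
    refine (hU i j).congr ?_
    filter_upwards [hm.ae_U_eq] with ω h
    rw [h i j, Real.norm_eq_abs]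
  refine (h2.sub h1).ae_eq (ae_of_all _ fun ω => ?_)
  simp

theorem IsEigenAdjusted.identDistrib_err (hm : m.IsEigenAdjusted P) (i j : ℕ) :
    IdentDistrib (fun ω => errAt j (m.subject i ω)) (fun ω => errAt 0 (m.subject 0 ω)) P P :=
  (hm.err_ident i j).trans ((hm.subjects_ident i).comp (measurable_errAt 0))

end FunctionalModel

/-! ### Signed weights -/

section Signed

variable {Ω E : Type*} [MeasurableSpace Ω] [MeasurableSpace E] {P : Measure Ω}
  [IsProbabilityMeasure P] {d : ℕ}

/-- Independent subjects whose observation points put little mass, of order `v n` in mean square per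
subject, on boxes with sides of order `side n`, with `v n` matching the truncation level of order `r`. -/
structure IsBoxDesign (P : Measure Ω) (subj : ℕ → Ω → E) (N : ℕ → ℕ → ℕ) (x : ℕ → E → Fin d → ℝ)
    (r : ℝ) (side : ℕ → Fin d → ℝ) (v : ℕ → ℝ) : Prop where
  measurable_subj : ∀ i, Measurable (subj i)
  indep : iIndepFun subj P
  measurable_point : ∀ j, Measurable (x j)
  two_lt : 2 < r
  pos : ∀ᶠ n in atTop, 0 < v n
  one_le_side : ∀ᶠ n : ℕ in atTop, ∀ k, 1 ≤ n * side n k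
  level : ∃ C, ∀ᶠ n : ℕ in atTop, truncLevel r n ^ 2 * logRatio n ≤ C * v n
  slab : ∃ C, ∀ᶠ n : ℕ in atTop, ∀ i < n, ∀ j k (c : ℤ),
    P.real {ω | ⌊n * x j (subj i ω) k⌋ = c} ≤ C / n
  count : ∃ C, ∀ᶠ n : ℕ in atTop, ∀ i < n, ∀ a b : Fin d → ℤ,
    (∀ k, (b k - a k + 1 : ℝ) ≤ 4 * (n * side n k)) →
      (1 / (N n i : ℝ)) ^ 2 * ∑ j ∈ Finset.range (N n i), ∑ k ∈ Finset.range (N n i),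
        P.real {ω | x j (subj i ω) ∈ gridBox n a b ∧ x k (subj i ω) ∈ gridBox n a b} ≤ C * v n

/-- Boxes with sides at most `2 * side`, inside the cube with half side `R`. -/
def IsSmallBox {d : ℕ} (R : ℕ) (side : Fin d → ℝ) (I : Fin d → Set ℝ) : Prop :=
  (∀ k, (I k).OrdConnected) ∧ (∀ k, I k ⊆ Icc (-(R : ℝ)) R) ∧
    ∀ k, ∀ y ∈ I k, ∀ z ∈ I k, z - y ≤ 2 * side k

variable {subj : ℕ → Ω → E} {N : ℕ → ℕ → ℕ} {x : ℕ → E → Fin d → ℝ} {r : ℝ}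
  {side : ℕ → Fin d → ℝ} {v : ℕ → ℝ}

theorem IsBoxDesign.deviation_le (h : IsBoxDesign P subj N x r side v) {a : ℕ → E → ℝ}
    (ha : ∀ j, Measurable (a j)) (ha0 : ∀ j e, 0 ≤ a j e) {m : ℝ}
    (hint : ∀ i j, Integrable (fun ω => a j (subj i ω) ^ r) P)
    (hm : ∀ i j, ∫ ω, a j (subj i ω) ^ r ∂P ≤ m)
    (hres : ∀ᵐ ω ∂P, ∃ C, ∀ᶠ n : ℕ in atTop, 1 / (n : ℝ) * ∑ i ∈ Finset.range n, 1 / (N n i : ℝ) *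
      ∑ j ∈ Finset.range (N n i), excess (truncLevel r n) (a j (subj i ω)) ≤
        C * (truncLevel r n * logRatio n))
    {B : ℝ} (hB : 0 ≤ B) (hsq : ∀ i j k A, MeasurableSet A →
      ∫⁻ ω in {ω | x j (subj i ω) ∈ A ∧ x k (subj i ω) ∈ A}, ENNReal.ofReal (a j (subj i ω) ^ 2) ∂P ≤
        ENNReal.ofReal B * P {ω | x j (subj i ω) ∈ A ∧ x k (subj i ω) ∈ A}) (R : ℕ) :
    ∀ᵐ ω ∂P, ∃ C, ∀ᶠ n : ℕ in atTop, ∀ I : Fin d → Set ℝ, IsSmallBox R (side n) I →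
      |1 / (n : ℝ) * ∑ i ∈ Finset.range n, (boxAvg (N n i) a x (univ.pi I) (subj i ω) -
        ∫ ω', boxAvg (N n i) a x (univ.pi I) (subj i ω') ∂P)| ≤ C * √(v n * logRatio n) := by
  obtain ⟨CQ, hQ⟩ := h.level
  obtain ⟨Cs, hs⟩ := h.slab
  obtain ⟨Cv, hcv⟩ := h.count
  filter_upwards [ae_eventually_weighted_box_deviation_le h.measurable_subj h.indep N
    h.measurable_point ha ha0 h.two_lt hint hm hres hB hsq hcv h.pos hQ h.one_le_side hs R]
    with ω ⟨C, hC⟩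
  exact ⟨C, hC.mono fun n hn I hI => hn I hI.1 hI.2.1 hI.2.2⟩

theorem integrable_boxAvg {M : ℕ} {b : ℕ → E → ℝ} (hx : ∀ j, Measurable (x j))
    {s : Ω → E} (hs : Measurable s) (hb : ∀ j, Integrable (fun ω => b j (s ω)) P)
    {A : Set (Fin d → ℝ)} (hA : MeasurableSet A) :
    Integrable (fun ω => boxAvg M b x A (s ω)) P := by
  refine (integrable_finsetSum _ fun j _ => ?_).const_mul _
  have : (fun ω => A.indicator (fun _ => b j (s ω)) (x j (s ω))) =
      {ω | x j (s ω) ∈ A}.indicator (fun ω => b j (s ω)) := by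
    funext ω; by_cases h : x j (s ω) ∈ A <;> simp [h]
  rw [this]
  exact (hb j).indicator (((hx j).comp hs) hA)

/-- The squeezing between grid boxes needs nonnegative weights, so positive and negative parts are
treated separately. Their means over a box agree by `hzero` and cancel in the difference. -/
theorem IsBoxDesign.centered_sum_le (h : IsBoxDesign P subj N x r side v) {b : ℕ → E → ℝ}
    (hb : ∀ j, Measurable (b j)) {m : ℝ}
    (hL : ∀ i j, MemLp (fun ω => b j (subj i ω)) (ENNReal.ofReal r) P)
    (hm : ∀ i j, ∫ ω, |b j (subj i ω)| ^ r ∂P ≤ m)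
    (hres : ∀ s : ℝ, |s| = 1 → ∀ᵐ ω ∂P, ∃ C, ∀ᶠ n : ℕ in atTop, 1 / (n : ℝ) *
      ∑ i ∈ Finset.range n, 1 / (N n i : ℝ) * ∑ j ∈ Finset.range (N n i),
        excess (truncLevel r n) (max (s * b j (subj i ω)) 0) ≤ C * (truncLevel r n * logRatio n))
    {B : ℝ} (hB : 0 ≤ B) (hsq : ∀ i j k A, MeasurableSet A →
      ∫⁻ ω in {ω | x j (subj i ω) ∈ A ∧ x k (subj i ω) ∈ A}, ENNReal.ofReal (b j (subj i ω) ^ 2) ∂P ≤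
        ENNReal.ofReal B * P {ω | x j (subj i ω) ∈ A ∧ x k (subj i ω) ∈ A})
    (hzero : ∀ i j A, MeasurableSet A →
      ∫ ω, {ω | x j (subj i ω) ∈ A ∧ x j (subj i ω) ∈ A}.indicator (fun ω => b j (subj i ω)) ω ∂P = 0)
    (R : ℕ) :
    ∀ᵐ ω ∂P, ∃ C, ∀ᶠ n : ℕ in atTop, ∀ I : Fin d → Set ℝ, IsSmallBox R (side n) I →
      |1 / (n : ℝ) * ∑ i ∈ Finset.range n, boxAvg (N n i) b x (univ.pi I) (subj i ω)| ≤
        C * √(v n * logRatio n) := by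
  have hr0 : 0 < r := by linarith [h.two_lt]
  have hr1 : 1 ≤ ENNReal.ofReal r := by
    rw [← ENNReal.ofReal_one]; exact ENNReal.ofReal_le_ofReal (by linarith [h.two_lt])
  have hpart : ∀ s : ℝ, |s| = 1 → ∀ y : ℝ, max (s * y) 0 ≤ |y| := fun s hs y => by
    refine max_le ((le_abs_self _).trans ?_) (abs_nonneg _)
    rw [abs_mul, hs, one_mul]
  have hbint : ∀ i j, Integrable (fun ω => b j (subj i ω)) P := fun i j => (hL i j).integrable hr1
  have hbr : ∀ i j, Integrable (fun ω => |b j (subj i ω)| ^ r) P := fun i j => by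
    have := (hL i j).integrable_norm_rpow (by simp [hr0]) ENNReal.ofReal_ne_top
    rwa [ENNReal.toReal_ofReal hr0.le] at this
  have hpm : ∀ s j, Measurable fun e => max (s * b j e) 0 := fun s j => by
    have := hb j; fun_prop
  have hdev : ∀ s : ℝ, |s| = 1 → ∀ᵐ ω ∂P, ∃ C, ∀ᶠ n : ℕ in atTop, ∀ I : Fin d → Set ℝ,
      IsSmallBox R (side n) I → |1 / (n : ℝ) * ∑ i ∈ Finset.range n,
        (boxAvg (N n i) (fun j e => max (s * b j e) 0) x (univ.pi I) (subj i ω) -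
        ∫ ω', boxAvg (N n i) (fun j e => max (s * b j e) 0) x (univ.pi I) (subj i ω') ∂P)| ≤
          C * √(v n * logRatio n) := by
    intro s hs
    have hle : ∀ i j ω, max (s * b j (subj i ω)) 0 ^ r ≤ |b j (subj i ω)| ^ r := fun i j ω =>
      Real.rpow_le_rpow (le_max_right _ _) (hpart s hs _) hr0.le
    have hint : ∀ i j, Integrable (fun ω => max (s * b j (subj i ω)) 0 ^ r) P := fun i j =>
      (hbr i j).mono' ((((hpm s j).comp (h.measurable_subj i)).pow_const r).aestronglyMeasurable)
        (ae_of_all _ fun ω => by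
          rw [Real.norm_of_nonneg (Real.rpow_nonneg (le_max_right _ _) r)]; exact hle i j ω)
    refine h.deviation_le (a := fun j e => max (s * b j e) 0) (hpm s) (fun _ _ => le_max_right _ _)
      (m := m) hint
      (fun i j => (integral_mono (hint i j) (hbr i j) (hle i j)).trans (hm i j)) (hres s hs) hB ?_ R
    intro i j k A hA
    refine le_trans (lintegral_mono fun ω => ENNReal.ofReal_le_ofReal ?_) (hsq i j k A hA)
    rw [← sq_abs (b j (subj i ω))]
    exact pow_le_pow_left₀ (le_max_right _ _) (hpart s hs _) 2
  filter_upwards [hdev 1 (by simp), hdev (-1) (by simp)] with ω ⟨C₁, h1⟩ ⟨C₂, h2⟩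
  refine ⟨C₁ + C₂, ?_⟩
  filter_upwards [h1, h2] with n h3 h4 I hI
  have g1 := h3 I hI
  have g2 := h4 I hI
  set A := univ.pi I
  have hA : MeasurableSet A := MeasurableSet.univ_pi fun k => (hI.1 k).measurableSet
  have hdec : ∀ M e, boxAvg M b x A e = boxAvg M (fun j e => max (1 * b j e) 0) x A e -
      boxAvg M (fun j e => max (-1 * b j e) 0) x A e := by
    intro M e
    rw [boxAvg, boxAvg, boxAvg, ← mul_sub, ← Finset.sum_sub_distrib]
    congr 1
    refine Finset.sum_congr rfl fun j _ => ?_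
    by_cases hj : x j e ∈ A
    · simp only [indicator_of_mem hj, one_mul, neg_mul]
      rcases le_total 0 (b j e) with h | h
      · rw [max_eq_left h, max_eq_right (by linarith)]; ring
      · rw [max_eq_right h, max_eq_left (by linarith)]; ring
    · simp only [indicator_of_notMem hj, sub_self]
  have hpint : ∀ s : ℝ, |s| = 1 → ∀ i, Integrable (fun ω =>
      boxAvg (N n i) (fun j e => max (s * b j e) 0) x A (subj i ω)) P := fun s hs i =>
    integrable_boxAvg h.measurable_point (h.measurable_subj i) (fun j =>
      (hbint i j).abs.mono' ((hpm s j).comp (h.measurable_subj i)).aestronglyMeasurable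
        (ae_of_all _ fun ω => by
          rw [Real.norm_of_nonneg (le_max_right _ _)]; exact hpart s hs _)) hA
  have hmean : ∀ i, ∫ ω, boxAvg (N n i) (fun j e => max (1 * b j e) 0) x A (subj i ω) ∂P =
      ∫ ω, boxAvg (N n i) (fun j e => max (-1 * b j e) 0) x A (subj i ω) ∂P := by
    intro i
    rw [← sub_eq_zero, ← integral_sub (hpint 1 (by simp) i) (hpint (-1) (by simp) i)]
    simp_rw [← hdec]
    have e : ∀ j, (fun ω => A.indicator (fun _ => b j (subj i ω)) (x j (subj i ω))) =
        {ω | x j (subj i ω) ∈ A ∧ x j (subj i ω) ∈ A}.indicator (fun ω => b j (subj i ω)) := by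
      intro j
      funext ω; by_cases h : x j (subj i ω) ∈ A <;> simp [h]
    have hm' : ∀ j, MeasurableSet {ω | x j (subj i ω) ∈ A ∧ x j (subj i ω) ∈ A} := fun j =>
      (((h.measurable_point j).comp (h.measurable_subj i)) hA).inter
        (((h.measurable_point j).comp (h.measurable_subj i)) hA)
    simp only [boxAvg]
    rw [integral_const_mul, integral_finsetSum]
    · simp_rw [e, hzero i _ A hA]
      simp
    · intro j _
      rw [e]
      exact (hbint i j).indicator (hm' j)
  have hsum : 1 / (n : ℝ) * ∑ i ∈ Finset.range n, boxAvg (N n i) b x A (subj i ω) =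
      1 / (n : ℝ) * ∑ i ∈ Finset.range n,
        (boxAvg (N n i) (fun j e => max (1 * b j e) 0) x A (subj i ω) -
        ∫ ω', boxAvg (N n i) (fun j e => max (1 * b j e) 0) x A (subj i ω') ∂P) -
      1 / (n : ℝ) * ∑ i ∈ Finset.range n,
        (boxAvg (N n i) (fun j e => max (-1 * b j e) 0) x A (subj i ω) -
        ∫ ω', boxAvg (N n i) (fun j e => max (-1 * b j e) 0) x A (subj i ω') ∂P) := by
    rw [← mul_sub, ← Finset.sum_sub_distrib]
    congr 1
    refine Finset.sum_congr rfl fun i _ => ?_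
    rw [hdec, hmean i]
    ring
  rw [hsum, add_mul]
  exact (abs_sub _ _).trans (add_le_add g1 g2)

/-- The case of unit weights; they have no excess once the truncation level is at least 1. -/
theorem IsBoxDesign.count_deviation_le (h : IsBoxDesign P subj N x r side v) (R : ℕ) :
    ∀ᵐ ω ∂P, ∃ C, ∀ᶠ n : ℕ in atTop, ∀ I : Fin d → Set ℝ, IsSmallBox R (side n) I →
      |1 / (n : ℝ) * ∑ i ∈ Finset.range n, boxAvg (N n i) (fun _ _ => 1) x (univ.pi I) (subj i ω) -
        1 / (n : ℝ) * ∑ i ∈ Finset.range n, 1 / (N n i : ℝ) * ∑ j ∈ Finset.range (N n i),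
          P.real {ω | x j (subj i ω) ∈ univ.pi I}| ≤ C * √(v n * logRatio n) := by
  have hr0 : 0 < r := by linarith [h.two_lt]
  have := h.deviation_le (a := fun _ _ => (1 : ℝ)) (fun _ => measurable_const)
    (fun _ _ => zero_le_one) (m := 1) (fun i j => by simp) (fun i j => by simp) (ae_of_all _ fun ω => ⟨0, by
      filter_upwards [(tendsto_truncLevel hr0).eventually_ge_atTop 1] with n hn
      simp [excess, hn]⟩) zero_le_one (fun i j k A hA => by simp) R
  filter_upwards [this] with ω ⟨C, hC⟩
  refine ⟨C, hC.mono fun n hn I hI => ?_⟩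
  have hA : MeasurableSet (univ.pi I) := MeasurableSet.univ_pi fun k => (hI.1 k).measurableSet
  convert hn I hI using 2
  rw [← mul_sub, ← Finset.sum_sub_distrib]
  congr 1
  refine Finset.sum_congr rfl fun i _ => ?_
  congr 1
  have hS : ∀ j, MeasurableSet {ω | x j (subj i ω) ∈ univ.pi I} := fun j =>
    ((h.measurable_point j).comp (h.measurable_subj i)) hA
  have e : ∀ j, (fun ω => (univ.pi I).indicator (fun _ => (1 : ℝ)) (x j (subj i ω))) =
      {ω | x j (subj i ω) ∈ univ.pi I}.indicator 1 := by
    intro j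
    funext ω
    by_cases h : x j (subj i ω) ∈ univ.pi I
    · rw [indicator_of_mem h, indicator_of_mem (by exact h)]; rfl
    · rw [indicator_of_notMem h, indicator_of_notMem (by exact h)]
  simp only [boxAvg]
  rw [integral_const_mul, integral_finsetSum]
  · simp_rw [e, integral_indicator_one (hS _)]
  · intro j _
    rw [e]
    exact (integrable_const (1 : ℝ)).indicator (hS j)

end Signed

/-! ### Noise averages and variance factors in the model -/

namespace FunctionalModel

variable {p : ℕ} {Ω S : Type*} [MeasurableSpace Ω] [MeasurableSpace S]
  {m : FunctionalModel p Ω S} {P : Measure Ω} [IsProbabilityMeasure P]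

theorem max_mul_zero_le_abs {s : ℝ} (hs : |s| = 1) (y : ℝ) : max (s * y) 0 ≤ |y| := by
  refine max_le ((le_abs_self _).trans ?_) (abs_nonneg _)
  rw [abs_mul, hs, one_mul]

/-- The supremum over time dominates all observations of a subject, however many, so the envelope
argument applies in both regimes. -/
theorem IsEigenAdjusted.ae_latentDev_excess_le (hm : m.IsEigenAdjusted P)
    (hc : ContinuousOn m.mean m.dom) (N : ℕ → ℕ → ℕ) {r : ℝ} (hr : 1 ≤ r)
    (hX : ∀ i, AEMeasurable m.supX (P.map fun ω => (m.ξ i ω, m.Z i ω)) ∧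
      ∫⁻ ω, m.supX (m.ξ i ω, m.Z i ω) ^ r ∂P < ∞) {s : ℝ} (hs : |s| = 1) :
    ∀ᵐ ω ∂P, ∃ C, ∀ᶠ n : ℕ in atTop, 1 / (n : ℝ) * ∑ i ∈ Finset.range n, 1 / (N n i : ℝ) *
      ∑ j ∈ Finset.range (N n i),
        excess (truncLevel r n) (max (s * m.latentDev j (m.subject i ω)) 0) ≤
          C * (truncLevel r n * logRatio n) := by
  have hr0 : 0 < r := by linarith
  obtain ⟨G, hG, hle, hL⟩ := hm.exists_envelope hc hr hX
  refine ae_excess_le_of_envelope (a := fun i j ω => max (s * m.latentDev j (m.subject i ω)) 0)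
    (M := fun i ω => G (m.subject i ω)) N hr (fun _ _ _ => le_max_right _ _) ?_
    (fun i j hij => (hm.subjects_indep.indepFun hij).comp hG hG)
    (fun i => (hm.subjects_ident i).comp hG) ?_
  · filter_upwards [hle] with ω h n i _ j _
    exact (max_mul_zero_le_abs hs _).trans (h i j)
  · have := (hL 0).integrable_norm_rpow (by simp [hr0]) ENNReal.ofReal_ne_top
    rwa [ENNReal.toReal_ofReal hr0.le] at this

/-- At most `M` errors of a subject occur, and the sum of their absolute values is an i.i.d.
envelope with a moment of order `r`. -/
theorem IsEigenAdjusted.ae_err_excess_le_of_bounded (hm : m.IsEigenAdjusted P)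
    {N : ℕ → ℕ → ℕ} {M : ℕ} (hN : ∀ n, ∀ i < n, N n i ≤ M) {r : ℝ} (hr : 1 ≤ r)
    (hL : ∀ i j, MemLp (fun ω => errAt j (m.subject i ω)) (ENNReal.ofReal r) P)
    {s : ℝ} (hs : |s| = 1) :
    ∀ᵐ ω ∂P, ∃ C, ∀ᶠ n : ℕ in atTop, 1 / (n : ℝ) * ∑ i ∈ Finset.range n, 1 / (N n i : ℝ) *
      ∑ j ∈ Finset.range (N n i), excess (truncLevel r n) (max (s * errAt j (m.subject i ω)) 0) ≤
          C * (truncLevel r n * logRatio n) := by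
  have hr0 : 0 < r := by linarith
  have hG : Measurable fun e : S × (Fin p → ℝ) × (ℕ → ℝ) × (ℕ → ℝ) =>
      ∑ j ∈ Finset.range M, |errAt j e| :=
    Finset.measurable_sum _ fun j _ => (measurable_errAt j).abs
  refine ae_excess_le_of_envelope (a := fun i j ω => max (s * errAt j (m.subject i ω)) 0)
    (M := fun i ω => ∑ j ∈ Finset.range M, |errAt j (m.subject i ω)|) N hr
    (fun _ _ _ => le_max_right _ _) (ae_of_all _ fun ω n i hi j hj => ?_)
    (fun i j hij => (hm.subjects_indep.indepFun hij).comp hG hG)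
    (fun i => (hm.subjects_ident i).comp hG) ?_
  · exact (max_mul_zero_le_abs hs _).trans
      (Finset.single_le_sum (f := fun j => |errAt j (m.subject i ω)|) (fun _ _ => abs_nonneg _)
        (Finset.mem_range.2 (hj.trans_le (hN n i hi))))
  · have : MemLp (fun ω => ∑ j ∈ Finset.range M, |errAt j (m.subject 0 ω)|) (ENNReal.ofReal r) P :=
      memLp_finsetSum _ fun j _ => (hL 0 j).abs
    have := this.integrable_norm_rpow (by simp [hr0]) ENNReal.ofReal_ne_top
    rwa [ENNReal.toReal_ofReal hr0.le] at this

theorem IsEigenAdjusted.integral_abs_err_rpow (hm : m.IsEigenAdjusted P) (r : ℝ) (i j : ℕ) :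
    ∫ ω, |errAt j (m.subject i ω)| ^ r ∂P = ∫ ω, |errAt 0 (m.subject 0 ω)| ^ r ∂P :=
  ((hm.identDistrib_err i j).comp (u := fun y : ℝ => |y| ^ r) (by fun_prop)).integral_eq

theorem IsEigenAdjusted.ae_err_excess_le_of_dense (hm : m.IsEigenAdjusted P)
    {N : ℕ → ℕ → ℕ} (hN1 : ∀ n, ∀ i < n, 1 ≤ N n i) {c a : ℝ} (hc : 0 < c) (ha : 0 < a)
    (hN : ∀ᶠ n : ℕ in atTop, ∀ i < n, c * logRatio n ^ (-a) ≤ N n i) {r : ℝ} (hr : 2 < r)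
    (hL : ∀ i j, MemLp (fun ω => errAt j (m.subject i ω)) (ENNReal.ofReal r) P)
    {s : ℝ} (hs : |s| = 1) :
    ∀ᵐ ω ∂P, ∃ C, ∀ᶠ n : ℕ in atTop, 1 / (n : ℝ) * ∑ i ∈ Finset.range n, 1 / (N n i : ℝ) *
      ∑ j ∈ Finset.range (N n i), excess (truncLevel r n) (max (s * errAt j (m.subject i ω)) 0) ≤
          C * (truncLevel r n * logRatio n) := by
  have hr0 : 0 < r := by linarith
  have hfm : Measurable fun y : ℝ => max (s * y) 0 := by fun_prop
  have hbr : ∀ i j, Integrable (fun ω => |errAt j (m.subject i ω)| ^ r) P := fun i j => by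
    have := (hL i j).integrable_norm_rpow (by simp [hr0]) ENNReal.ofReal_ne_top
    rwa [ENNReal.toReal_ofReal hr0.le] at this
  have hle : ∀ i j ω, max (s * errAt j (m.subject i ω)) 0 ^ r ≤ |errAt j (m.subject i ω)| ^ r :=
    fun i j ω => Real.rpow_le_rpow (le_max_right _ _) (max_mul_zero_le_abs hs _) hr0.le
  have hem : ∀ i j, Measurable fun ω => max (s * errAt j (m.subject i ω)) 0 := fun i j =>
    hfm.comp ((measurable_errAt j).comp (hm.measurable_subject i))
  have hint : ∀ i j, Integrable (fun ω => max (s * errAt j (m.subject i ω)) 0 ^ r) P := fun i j =>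
    (hbr i j).mono' (((hem i j).pow_const r).aestronglyMeasurable)
      (ae_of_all _ fun ω => by
        rw [Real.norm_of_nonneg (Real.rpow_nonneg (le_max_right _ _) r)]; exact hle i j ω)
  refine _root_.ae_excess_le_of_dense (e := fun i j ω => max (s * errAt j (m.subject i ω)) 0)
    (fun _ _ _ => le_max_right _ _) hem (fun i => (hm.err_indep i).comp (fun _ y => max (s * y) 0)
      fun _ => hfm) ?_ N hr hint
    (fun i j => (integral_mono (hint i j) (hbr i j) (hle i j)).trans
      (hm.integral_abs_err_rpow r i j).le) hc ha hN1 hN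
  exact hm.subjects_indep.comp (fun _ e j => max (s * errAt j e) 0) fun _ =>
    measurable_pi_iff.2 fun j => hfm.comp (measurable_errAt j)

/-- The empirical mass of a set of design points. -/
noncomputable def empMass (m : FunctionalModel p Ω S) (N : ℕ → ℕ → ℕ) (n : ℕ) (ω : Ω)
    (A : Set (Fin (p + 1) → ℝ)) : ℝ :=
  1 / (n : ℝ) * ∑ i ∈ Finset.range n, 1 / (N n i : ℝ) * ∑ j ∈ Finset.range (N n i),
    A.indicator (fun _ => (1 : ℝ)) (point j (m.subject i ω))

/-- The empirical average of the centred observations over a set of design points. -/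
noncomputable def empNoise (m : FunctionalModel p Ω S) (N : ℕ → ℕ → ℕ) (n : ℕ) (ω : Ω)
    (A : Set (Fin (p + 1) → ℝ)) : ℝ :=
  1 / (n : ℝ) * ∑ i ∈ Finset.range n, 1 / (N n i : ℝ) * ∑ j ∈ Finset.range (N n i),
    A.indicator (fun _ => m.U i j ω) (point j (m.subject i ω))

/-- Latent deviation and error are each centred with bounded second moment given the design, and
their excesses are controlled by different arguments; hence they are bounded separately and added.
-/
theorem IsEigenAdjusted.ae_empNoise_le (hm : m.IsEigenAdjusted P)
    (hc : ContinuousOn m.mean m.dom) {N : ℕ → ℕ → ℕ} {r : ℝ}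
    (hU : ∀ i j, Integrable (fun ω => |m.U i j ω| ^ r) P)
    (hX : ∀ i, AEMeasurable m.supX (P.map fun ω => (m.ξ i ω, m.Z i ω)) ∧
      ∫⁻ ω, m.supX (m.ξ i ω, m.Z i ω) ^ r ∂P < ∞)
    {side : ℕ → Fin (p + 1) → ℝ} {v : ℕ → ℝ}
    (hd : IsBoxDesign P m.subject N (fun j => point j) r side v)
    (hres : ∀ s : ℝ, |s| = 1 → ∀ᵐ ω ∂P, ∃ C, ∀ᶠ n : ℕ in atTop, 1 / (n : ℝ) *
      ∑ i ∈ Finset.range n, 1 / (N n i : ℝ) * ∑ j ∈ Finset.range (N n i),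
        excess (truncLevel r n) (max (s * errAt j (m.subject i ω)) 0) ≤
          C * (truncLevel r n * logRatio n)) (R : ℕ) :
    ∀ᵐ ω ∂P, ∃ C, ∀ᶠ n : ℕ in atTop, ∀ I : Fin (p + 1) → Set ℝ, IsSmallBox R (side n) I →
      |m.empNoise N n ω (univ.pi I)| ≤ C * √(v n * logRatio n) := by
  have hr : 1 ≤ r := by linarith [hd.two_lt]
  have hr0 : 0 < r := by linarith
  obtain ⟨G, hG, hle, hGL⟩ := hm.exists_envelope hc hr hX
  obtain ⟨C₀, hC0, hC⟩ := hm.exists_lintegral_latentDev_sq_le hc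
  have hGr : ∀ i, Integrable (fun ω => |G (m.subject i ω)| ^ r) P := fun i => by
    have := (hGL i).integrable_norm_rpow (by simp [hr0]) ENNReal.ofReal_ne_top
    rwa [ENNReal.toReal_ofReal hr0.le] at this
  have hWm : ∀ i j, Measurable fun ω => m.latentDev j (m.subject i ω) := fun i j =>
    (hm.measurable_latentDev hc j).comp (hm.measurable_subject i)
  have hWL : ∀ i j, MemLp (fun ω => m.latentDev j (m.subject i ω)) (ENNReal.ofReal r) P := by
    intro i j
    refine (hGL i).mono (hWm i j).aestronglyMeasurable ?_
    filter_upwards [hle] with ω h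
    exact (h i j).trans (le_abs_self _)
  have hEL := hm.memLp_err hc hr hU hX
  have h1 := hd.centered_sum_le (b := m.latentDev) (hm.measurable_latentDev hc) hWL
    (m := ∫ ω, |G (m.subject 0 ω)| ^ r ∂P) (fun i j => by
      have e : ∫ ω, |G (m.subject i ω)| ^ r ∂P = ∫ ω, |G (m.subject 0 ω)| ^ r ∂P :=
        ((hm.subjects_ident i).comp (u := fun e => |G e| ^ r) (by fun_prop)).integral_eq
      rw [← e]
      refine integral_mono_of_nonneg (ae_of_all _ fun ω => by positivity) (hGr i) ?_
      filter_upwards [hle] with ω h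
      exact Real.rpow_le_rpow (abs_nonneg _) ((h i j).trans (le_abs_self _)) hr0.le)
    (fun s hs => hm.ae_latentDev_excess_le hc N hr hX hs) hC0
    (fun i j k A hA => hC i j _ (measurableSet_pair_mem j k hA))
    (fun i j A hA => hm.integral_latentDev_eq_zero hc i j (measurableSet_pair_mem j j hA)) R
  have h2 := hd.centered_sum_le (b := fun j => errAt j) (fun j => measurable_errAt j) hEL
    (m := ∫ ω, |errAt 0 (m.subject 0 ω)| ^ r ∂P) (fun i j => (hm.integral_abs_err_rpow r i j).le)
    hres (sq_nonneg m.σ)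
    (fun i j k A hA => hm.lintegral_err_sq_le i j (measurableSet_pair_mem j k hA))
    (fun i j A hA => hm.integral_err_eq_zero i j (measurableSet_pair_mem j j hA)) R
  filter_upwards [h1, h2, hm.ae_U_eq] with ω ⟨C₁, h3⟩ ⟨C₂, h4⟩ hUeq
  refine ⟨C₁ + C₂, ?_⟩
  filter_upwards [h3, h4] with n h5 h6 I hI
  have key : m.empNoise N n ω (univ.pi I) =
      1 / (n : ℝ) * ∑ i ∈ Finset.range n,
        boxAvg (N n i) m.latentDev (fun j => point j) (univ.pi I) (m.subject i ω) +
      1 / (n : ℝ) * ∑ i ∈ Finset.range n,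
        boxAvg (N n i) (fun j => errAt j) (fun j => point j) (univ.pi I) (m.subject i ω) := by
    rw [empNoise, ← mul_add, ← Finset.sum_add_distrib]
    congr 1
    refine Finset.sum_congr rfl fun i _ => ?_
    rw [boxAvg, boxAvg, ← mul_add, ← Finset.sum_add_distrib]
    congr 1
    refine Finset.sum_congr rfl fun j _ => ?_
    rw [hUeq]
    by_cases h : point j (m.subject i ω) ∈ univ.pi I
    · simp only [indicator_of_mem h]
    · simp only [indicator_of_notMem h, add_zero]
  rw [key, add_mul]
  exact (abs_add_le _ _).trans (add_le_add (h5 I hI) (h6 I hI))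

/-- With Q the truncation level, Q² log n = n Q²ρ ≤ C n v ≤ C n ∏ side ≤ C n side_k once all sides
are at most 1, while the left side tends to infinity. -/
theorem one_le_mul_side {r : ℝ} (hr : 2 < r) {d : ℕ} {side : ℕ → Fin d → ℝ}
    (h0 : ∀ n k, 0 < side n k) (hlim : ∀ k, Tendsto (fun n => side n k) atTop (𝓝 0)) {v : ℕ → ℝ}
    (hv0 : ∀ n, 0 < v n) (hv : ∀ᶠ n in atTop, v n ≤ ∏ k, side n k)
    (hlevel : ∃ C, ∀ᶠ n : ℕ in atTop, truncLevel r n ^ 2 * logRatio n ≤ C * v n) :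
    ∀ᶠ n : ℕ in atTop, ∀ k, 1 ≤ n * side n k := by
  obtain ⟨C, hC⟩ := hlevel
  have hr0 : 0 < r := by linarith
  have hone : ∀ᶠ n in atTop, ∀ k, side n k ≤ 1 :=
    eventually_all.2 fun k => (hlim k).eventually_le_const zero_lt_one
  have hlog : ∀ᶠ n : ℕ in atTop, 1 ≤ Real.log n :=
    (Real.tendsto_log_atTop.comp (tendsto_natCast_atTop_atTop (R := ℝ))).eventually_ge_atTop 1
  filter_upwards [hC, hv, hone, hlog, eventually_gt_atTop 0,
    (tendsto_truncLevel hr0).eventually_ge_atTop (max C 1)] with n h1 h2 h3 h4 hn h5 k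
  have hn' : (0 : ℝ) < n := by exact_mod_cast hn
  have hlr : n * logRatio n = Real.log n := by rw [logRatio]; field_simp
  have h6 : ∏ k, side n k ≤ side n k := by
    rw [← Finset.mul_prod_erase Finset.univ _ (Finset.mem_univ k)]
    exact mul_le_of_le_one_right (h0 n k).le
      (Finset.prod_le_one (fun l _ => (h0 n l).le) fun l _ => h3 l)
  set C' := max C 1
  have hC' : 1 ≤ C' := le_max_right _ _
  have h7 : C' ≤ C' * (n * side n k) := by
    have hπ : 0 < ∏ k, side n k := Finset.prod_pos fun k _ => h0 n k
    have hT : C' ≤ truncLevel r n ^ 2 := by nlinarith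
    have hlo : truncLevel r n ^ 2 * logRatio n ≤ C' * ∏ k, side n k := by
      refine h1.trans ?_
      exact mul_le_mul (le_max_left _ _) h2 (hv0 n).le (by linarith)
    calc C' ≤ truncLevel r n ^ 2 * Real.log n := by nlinarith
      _ = n * (truncLevel r n ^ 2 * logRatio n) := by rw [← hlr]; ring
      _ ≤ n * (C' * ∏ k, side n k) := by gcongr
      _ ≤ n * (C' * side n k) := by gcongr
      _ = _ := by ring
  nlinarith

/-- From Q²ρ ≤ C v and v ≤ π, the product of the sides, follows vρ ≤ C (π / Q)². The fluctuation
relative to π is O(1 / Q), so empirical masses of boxes are eventually comparable to the true ones.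
-/
theorem tendsto_sqrt_div_prod {r : ℝ} (hr : 2 < r) {d : ℕ} {side : ℕ → Fin d → ℝ}
    (h0 : ∀ n k, 0 < side n k) {v : ℕ → ℝ} (hv0 : ∀ n, 0 < v n)
    (hv : ∀ᶠ n in atTop, v n ≤ ∏ k, side n k)
    (hlevel : ∃ C, ∀ᶠ n : ℕ in atTop, truncLevel r n ^ 2 * logRatio n ≤ C * v n) :
    Tendsto (fun n => √(v n * logRatio n) / ∏ k, side n k) atTop (𝓝 0) := by
  obtain ⟨C, hC⟩ := hlevel
  have hr0 : 0 < r := by linarith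
  have hlim : Tendsto (fun n => √C * (truncLevel r n)⁻¹) atTop (𝓝 0) := by
    simpa using ((tendsto_truncLevel hr0).inv_tendsto_atTop).const_mul (√C)
  refine squeeze_zero' (Eventually.of_forall fun n =>
    div_nonneg (Real.sqrt_nonneg _) (Finset.prod_nonneg fun k _ => (h0 n k).le)) ?_ hlim
  filter_upwards [hC, hv, eventually_ge_atTop 2] with n h1 h2 hn
  have hπ : 0 < ∏ k, side n k := Finset.prod_pos fun k _ => h0 n k
  have hT := truncLevel_pos r hn
  have hρ := logRatio_pos hn
  have hv := hv0 n
  rw [div_le_iff₀ hπ]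
  have h3 : v n * logRatio n ≤ C * ((truncLevel r n)⁻¹ * ∏ k, side n k) ^ 2 := by
    rw [mul_pow, inv_pow]
    have hC0 : 0 ≤ C := by
      by_contra h
      push Not at h
      have : C * v n < 0 := mul_neg_of_neg_of_pos h hv
      have : 0 < truncLevel r n ^ 2 * logRatio n := by positivity
      linarith
    have h4 : v n * v n ≤ (∏ k, side n k) ^ 2 := by rw [sq]; gcongr
    calc v n * logRatio n = (truncLevel r n ^ 2)⁻¹ * ((truncLevel r n ^ 2 * logRatio n) * v n) := by
          field_simp
      _ ≤ (truncLevel r n ^ 2)⁻¹ * ((C * v n) * v n) := by gcongr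
      _ = C * ((truncLevel r n ^ 2)⁻¹ * (v n * v n)) := by ring
      _ ≤ _ := by gcongr
  refine (Real.sqrt_le_sqrt h3).trans (le_of_eq ?_)
  rw [Real.sqrt_mul' _ (by positivity), Real.sqrt_sq (by positivity)]
  ring

/-- Time and covariate bandwidths as one vector, time first. -/
def sides (ht : ℕ → ℝ) (hz : ℕ → Fin p → ℝ) (n : ℕ) : Fin (p + 1) → ℝ := Fin.cons (ht n) (hz n)

theorem prod_sides (ht : ℕ → ℝ) (hz : ℕ → Fin p → ℝ) (n : ℕ) :
    ∏ k, sides ht hz n k = ht n * ∏ k, hz n k := by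
  simp [sides, Fin.prod_univ_succ]

theorem sides_pos {ht : ℕ → ℝ} {hz : ℕ → Fin p → ℝ} (ht_pos : ∀ n, 0 < ht n)
    (hz_pos : ∀ n k, 0 < hz n k) (n : ℕ) (k : Fin (p + 1)) : 0 < sides ht hz n k := by
  refine Fin.cases ?_ (fun k => ?_) k
  · simpa [sides] using ht_pos n
  · simpa [sides] using hz_pos n k

theorem tendsto_sides {ht : ℕ → ℝ} {hz : ℕ → Fin p → ℝ} (h1 : Tendsto ht atTop (𝓝 0))
    (h2 : ∀ k, Tendsto (fun n => hz n k) atTop (𝓝 0)) (k : Fin (p + 1)) :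
    Tendsto (fun n => sides ht hz n k) atTop (𝓝 0) := by
  refine Fin.cases ?_ (fun k => ?_) k
  · simpa [sides] using h1
  · simpa [sides] using h2 k

/-- The bandwidth condition bounds the truncation level by any sequence dominating its variance
factor. -/
theorem truncLevel_sq_mul_le {ht : ℕ → ℝ} {hz : ℕ → Fin p → ℝ} {N : ℕ → ℕ → ℕ}
    (ht_pos : ∀ n, 0 < ht n) (hz_pos : ∀ n k, 0 < hz n k) {r : ℝ}
    (h : Tendsto (fun n => ((ht n) ^ 2 * ∏ k, hz n k + ht n * (∏ k, hz n k) / harmonicCount N n)⁻¹ *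
      logRatio n ^ (1 - 2 / r)) atTop (𝓝 0)) {v : ℕ → ℝ} {C : ℝ}
    (hv : ∀ᶠ n : ℕ in atTop, (ht n) ^ 2 * ∏ k, hz n k +
      ht n * (∏ k, hz n k) * (1 / (n : ℝ) * ∑ i ∈ Finset.range n, 1 / (N n i : ℝ)) ≤ C * v n) :
    ∃ C, ∀ᶠ n : ℕ in atTop, truncLevel r n ^ 2 * logRatio n ≤ C * v n := by
  refine ⟨C, ?_⟩
  filter_upwards [hv, h.eventually_le_const zero_lt_one, eventually_ge_atTop 2] with n h1 h2 hn
  have hρ := logRatio_pos hn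
  have hπ : 0 < ∏ k, hz n k := Finset.prod_pos fun k _ => hz_pos n k
  have ht0 := ht_pos n
  have hS : 0 ≤ 1 / (n : ℝ) * ∑ i ∈ Finset.range n, 1 / (N n i : ℝ) := by positivity
  have e : ht n * (∏ k, hz n k) / harmonicCount N n =
      ht n * (∏ k, hz n k) * (1 / (n : ℝ) * ∑ i ∈ Finset.range n, 1 / (N n i : ℝ)) := by
    rw [harmonicCount, div_inv_eq_mul]
    simp only [one_div]
  rw [e] at h2
  -- The truncation level is tuned to the bandwidth condition, whose numerator is exactly this
  -- quantity.
  have e' : truncLevel r n ^ 2 * logRatio n = logRatio n ^ (1 - 2 / r) := by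
    rw [truncLevel, ← Real.rpow_mul_natCast hρ.le]
    nth_rewrite 2 [← Real.rpow_one (logRatio n)]
    rw [← Real.rpow_add hρ]
    congr 1
    push_cast
    ring
  rw [inv_mul_le_iff₀ (by positivity), mul_one] at h2
  rw [e']
  exact h2.trans h1

theorem IsEigenAdjusted.isBoxDesign (hm : m.IsEigenAdjusted P) (A1 : m.DensityRegular)
    {N : ℕ → ℕ → ℕ} {r : ℝ} (hr : 2 < r) {side : ℕ → Fin (p + 1) → ℝ}
    (h0 : ∀ n k, 0 < side n k) (hlim : ∀ k, Tendsto (fun n => side n k) atTop (𝓝 0)) {v : ℕ → ℝ}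
    (hv0 : ∀ n, 0 < v n) (hv : ∀ᶠ n in atTop, v n ≤ ∏ k, side n k)
    (hlevel : ∃ C, ∀ᶠ n : ℕ in atTop, truncLevel r n ^ 2 * logRatio n ≤ C * v n)
    (hcount : ∃ C, ∀ᶠ n : ℕ in atTop, ∀ i < n, ∀ a b : Fin (p + 1) → ℤ,
      (∀ k, (b k - a k + 1 : ℝ) ≤ 4 * (n * side n k)) →
      (1 / (N n i : ℝ)) ^ 2 * ∑ j ∈ Finset.range (N n i), ∑ k ∈ Finset.range (N n i),
        P.real {ω | point j (m.subject i ω) ∈ gridBox n a b ∧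
          point k (m.subject i ω) ∈ gridBox n a b} ≤ C * v n) :
    IsBoxDesign P m.subject N (fun j => point j) r side v where
  measurable_subj := hm.measurable_subject
  indep := hm.subjects_indep
  measurable_point := fun j => measurable_point j
  two_lt := hr
  pos := Eventually.of_forall hv0
  one_le_side := one_le_mul_side hr h0 hlim hv0 hv hlevel
  level := hlevel
  slab := by
    obtain ⟨lo, hi, hlo, hd⟩ := A1.1
    refine ⟨max hi 0 * (∏ k, max 1 (m.upper k - m.lower k)), ?_⟩
    filter_upwards [eventually_gt_atTop 0] with n hn i _ j k c
    exact hm.measureReal_slab_le (le_max_right _ _)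
      (fun x hx => (hd x hx).2.trans (le_max_left _ _)) hn i j k c
  count := hcount

/-- A pair is in the box only if its first point is. This crude bound needs no information on the
joint law and suffices for sparse data. -/
theorem IsEigenAdjusted.count_le (hm : m.IsEigenAdjusted P) (A1 : m.DensityRegular)
    (N : ℕ → ℕ → ℕ) {side : ℕ → Fin (p + 1) → ℝ} (h0 : ∀ n k, 0 < side n k) :
    ∃ C, ∀ᶠ n : ℕ in atTop, ∀ i < n, ∀ a b : Fin (p + 1) → ℤ,
      (∀ k, (b k - a k + 1 : ℝ) ≤ 4 * (n * side n k)) →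
      (1 / (N n i : ℝ)) ^ 2 * ∑ j ∈ Finset.range (N n i), ∑ k ∈ Finset.range (N n i),
        P.real {ω | point j (m.subject i ω) ∈ gridBox n a b ∧
          point k (m.subject i ω) ∈ gridBox n a b} ≤ C * ∏ k, side n k := by
  obtain ⟨lo, hi, hlo, hd⟩ := A1.1
  refine ⟨max hi 0 * 4 ^ (p + 1), ?_⟩
  filter_upwards [eventually_gt_atTop 0] with n hn i _ a b hab
  have hπ : 0 < ∏ k, side n k := Finset.prod_pos fun k _ => h0 n k
  have hc : 0 ≤ max hi 0 * 4 ^ (p + 1) * ∏ k, side n k := by positivity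
  rw [sq, mul_assoc, Finset.mul_sum]
  refine one_div_mul_sum_le hc fun j _ => one_div_mul_sum_le hc fun k _ => ?_
  rw [mul_assoc]
  exact (measureReal_mono (fun ω hω => hω.1)).trans
    (hm.measureReal_point_gridBox_le (le_max_right _ _)
      (fun x hx => (hd x hx).2.trans (le_max_left _ _)) hn (fun k => (h0 n k).le) hab i j)

/-- Diagonal pairs are a fraction 1 / N = O(h_t) of all pairs and have probability O(π), π being the
product of the sides; off-diagonal pairs have probability O(h_t π) by the pair density. Both
contribute h_t π. -/
theorem IsEigenAdjusted.count_le_of_pairDensity (hm : m.IsEigenAdjusted P) (A1 : m.DensityRegular)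
    (hpair : PairDensityBounded m P)
    {N : ℕ → ℕ → ℕ} {side : ℕ → Fin (p + 1) → ℝ} (h0 : ∀ n k, 0 < side n k) {D : ℝ}
    (hN : ∀ᶠ n : ℕ in atTop, ∀ i < n, 1 / (N n i : ℝ) ≤ D * side n 0) :
    ∃ C, ∀ᶠ n : ℕ in atTop, ∀ i < n, ∀ a b : Fin (p + 1) → ℤ,
      (∀ k, (b k - a k + 1 : ℝ) ≤ 4 * (n * side n k)) →
      (1 / (N n i : ℝ)) ^ 2 * ∑ j ∈ Finset.range (N n i), ∑ k ∈ Finset.range (N n i),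
        P.real {ω | point j (m.subject i ω) ∈ gridBox n a b ∧
          point k (m.subject i ω) ∈ gridBox n a b} ≤ C * (side n 0 * ∏ k, side n k) := by
  obtain ⟨lo, hi, hlo, hd⟩ := A1.1
  obtain ⟨B, hB⟩ := hpair
  refine ⟨max hi 0 * 4 ^ (p + 1) * max D 0 + B * 4 ^ (p + 2), ?_⟩
  filter_upwards [hN, eventually_gt_atTop 0] with n hNn hn i hi' a b hab
  have hπ : 0 < ∏ k, side n k := Finset.prod_pos fun k _ => h0 n k
  have hs0 := h0 n 0
  have hND : 1 / (N n i : ℝ) ≤ max D 0 * side n 0 :=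
    (hNn i hi').trans (by gcongr; exact le_max_left _ _)
  set c₁ := max hi 0 * (4 ^ (p + 1) * ∏ k, side n k) with hc1
  set c₂ := B * (4 ^ (p + 2) * (side n 0 * ∏ k, side n k)) with hc2
  have h1 : 0 ≤ c₁ := by positivity
  have h2 : 0 ≤ c₂ := by positivity
  have hD0 : 0 ≤ max D 0 * side n 0 := by positivity
  have hrow : ∀ j < N n i, 1 / (N n i : ℝ) * ∑ k ∈ Finset.range (N n i),
      P.real {ω | point j (m.subject i ω) ∈ gridBox n a b ∧
          point k (m.subject i ω) ∈ gridBox n a b} ≤ max D 0 * side n 0 * c₁ + c₂ := by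
    intro j hj
    rw [← Finset.add_sum_erase _ _ (Finset.mem_range.2 hj), mul_add]
    refine add_le_add ?_ ?_
    · refine mul_le_mul hND ?_ measureReal_nonneg hD0
      exact (measureReal_mono (fun ω hω => hω.1)).trans
        (hm.measureReal_point_gridBox_le (le_max_right _ _)
          (fun x hx => (hd x hx).2.trans (le_max_left _ _)) hn (fun k => (h0 n k).le) hab i j)
    · have h3 : ∑ k ∈ (Finset.range (N n i)).erase j,
          P.real {ω | point j (m.subject i ω) ∈ gridBox n a b ∧
            point k (m.subject i ω) ∈ gridBox n a b} ≤ N n i * c₂ := by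
        refine (Finset.sum_le_card_nsmul _ _ c₂ fun k hk => ?_).trans ?_
        · exact hm.measureReal_pair_gridBox_le (hB i j k (Finset.ne_of_mem_erase hk).symm) hn
            (fun k => (h0 n k).le) hab
        · rw [nsmul_eq_mul]
          gcongr
          exact (Finset.card_erase_le).trans (by simp)
      have hNi : (0 : ℝ) < N n i := by exact_mod_cast (Nat.zero_le j).trans_lt hj
      rw [one_div, inv_mul_le_iff₀ hNi]
      exact h3
  rw [sq, mul_assoc, Finset.mul_sum]
  refine (one_div_mul_sum_le (by positivity) hrow).trans (le_of_eq ?_)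
  rw [hc1, hc2]; ring

end FunctionalModel

/-! ### Local linear fits on good samples -/

section Fit

variable {d : ℕ} {K : ℝ → ℝ}

theorem prod_indicator_one {I : Fin d → Set ℝ} (y : Fin d → ℝ) :
    ∏ k, (I k).indicator (1 : ℝ → ℝ) (y k) = (univ.pi I).indicator (fun _ => (1 : ℝ)) y := by
  by_cases h : y ∈ univ.pi I
  · rw [indicator_of_mem h]
    exact Finset.prod_eq_one fun k _ => indicator_of_mem (h k (mem_univ k)) _
  · rw [indicator_of_notMem h]
    simp only [mem_univ_pi, not_forall] at h
    obtain ⟨k, hk⟩ := h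
    exact Finset.prod_eq_zero (Finset.mem_univ k) (indicator_of_notMem hk _)

theorem ordConnected_rescaled {I : Set ℝ} (hI : I.OrdConnected) {x s : ℝ} (hs : 0 < s) :
    {y : ℝ | (y - x) / s ∈ I}.OrdConnected := by
  refine ⟨fun u hu v hv w hw => ?_⟩
  refine hI.out hu hv ⟨?_, ?_⟩
  · exact div_le_div_of_nonneg_right (by linarith [hw.1]) hs.le
  · exact div_le_div_of_nonneg_right (by linarith [hw.2]) hs.le

/-- Kernel weighted sums are controlled by sums over small boxes. -/
theorem abs_sum_mul_prod_rescaled_le {B : ℝ} {f : Fin d → ℝ → ℝ}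
    (hf : ∀ k, LayeredOn (Icc (-1) 1) B (f k)) {ι : Type} (F : Finset ι) (c : ι → ℝ)
    (pt : ι → Fin d → ℝ) (x side : Fin d → ℝ) (hs : ∀ k, 0 < side k) {R : ℕ}
    (hR : ∀ q ∈ F, ∀ k, pt q k ∈ Icc (-(R : ℝ)) R) {ε : ℝ}
    (h : ∀ I : Fin d → Set ℝ, IsSmallBox R side I →
      |∑ q ∈ F, c q * (univ.pi I).indicator (fun _ => (1 : ℝ)) (pt q)| ≤ ε) :
    |∑ q ∈ F, c q * ∏ k, f k ((pt q k - x k) / side k)| ≤ B ^ d * ε := by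
  have := abs_sum_mul_prod_le_of_layeredOn hf F c (fun q k => (pt q k - x k) / side k) ε ?_
  · simpa using this
  intro I hI hI1
  -- The test box in rescaled coordinates is pulled back and cut to the cube that contains all the
  -- points, which alters no indicator in the sum.
  let J : Fin d → Set ℝ := fun k => {y : ℝ | (y - x k) / side k ∈ I k} ∩ Icc (-(R : ℝ)) R
  have hJ : IsSmallBox R side J := by
    refine ⟨fun k => (ordConnected_rescaled (hI k) (hs k)).inter ordConnected_Icc,
      fun k => inter_subset_right, fun k y hy z hz => ?_⟩
    have h1 := (hI1 k hy.1).1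
    have h2 := (hI1 k hz.1).2
    rw [le_div_iff₀ (hs k)] at h1
    rw [div_le_iff₀ (hs k)] at h2
    linarith
  refine le_of_eq_of_le (congrArg _ (Finset.sum_congr rfl fun q hq => ?_)) (h J hJ)
  rw [← prod_indicator_one]
  congr 1
  refine Finset.prod_congr rfl fun k _ => ?_
  by_cases hk : (pt q k - x k) / side k ∈ I k
  · rw [indicator_of_mem hk, indicator_of_mem (show pt q k ∈ J k from ⟨hk, hR q hq k⟩)]; rfl
  · rw [indicator_of_notMem hk, indicator_of_notMem fun hmem => hk hmem.1]

theorem IsKernel.prod_eq_zero_or (hK : IsKernel K) (u : Fin d → ℝ) :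
    ∏ k, K (u k) = 0 ∨ ∀ k, |u k| ≤ 1 := by
  by_cases h : ∀ k, |u k| ≤ 1
  · exact Or.inr h
  · push Not at h
    obtain ⟨k, hk⟩ := h
    refine Or.inl (Finset.prod_eq_zero (Finset.mem_univ k) (hK.support _ fun hmem => ?_))
    exact absurd (abs_le.2 ⟨hmem.1, hmem.2⟩) (not_le.2 hk)

/-- The corner boxes of the kernel window carry a positive share of the kernel mass. -/
theorem le_sum_kernel_mul_corner {ι : Type} {α κ c₀ : ℝ} (hα : 0 ≤ α)
    (hκ : 0 < κ) (hκ1 : α + 3 * κ ≤ 1) (hc0 : 0 < c₀)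
    (hKc : ∀ u, α ≤ |u| → |u| ≤ α + 3 * κ → c₀ ≤ K u) (F : Finset ι) (c : ι → ℝ)
    (hc : ∀ q ∈ F, 0 ≤ c q) (pt : ι → Fin d → ℝ) (x side lower upper : Fin d → ℝ)
    (hs : ∀ k, 0 < side k) (hx : ∀ k, x k ∈ Icc (lower k) (upper k))
    (hside : ∀ k, 2 * side k ≤ upper k - lower k) {lo ε : ℝ}
    (hlow : ∀ a b : Fin d → ℝ, (∀ k, lower k ≤ a k) → (∀ k, b k ≤ upper k) → (∀ k, a k ≤ b k) →
      (∀ k, b k - a k ≤ 2 * side k) → lo * ∏ k, (b k - a k) - ε ≤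
        ∑ q ∈ F, c q * (univ.pi fun k => Icc (a k) (b k)).indicator (fun _ => (1 : ℝ)) (pt q))
    {s : Fin d → ℝ} (hsdef : s = fun k => if x k ≤ (lower k + upper k) / 2 then 1 else -1)
    (e : Fin d → Bool) :
    c₀ ^ d * (lo * (κ ^ d * ∏ k, side k) - ε) ≤
      ∑ q ∈ F, (c q * ∏ k, K ((pt q k - x k) / side k)) * ∏ k,
        (if e k then Icc (α + 2 * κ) (α + 3 * κ) else Icc α (α + κ)).indicator (1 : ℝ → ℝ)
          (s k * ((pt q k - x k) / side k)) := by
  let a₀ : Fin d → ℝ := fun k => if e k then α + 2 * κ else α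
  have ha0 : ∀ k, α ≤ a₀ k ∧ a₀ k + κ ≤ α + 3 * κ := fun k => by
    simp only [a₀]; split_ifs <;> constructor <;> linarith
  have hIcc : ∀ k, (if e k then Icc (α + 2 * κ) (α + 3 * κ) else Icc α (α + κ)) =
      Icc (a₀ k) (a₀ k + κ) := fun k => by
    simp only [a₀]; split_ifs <;> [(congr 1; ring); rfl]
  simp only [hIcc]
  -- The corner box is placed above `x k` when `x k` is in the lower half of its side and below it
  -- otherwise. As `2 * side k` is at most the length of the side, it stays inside the domain, where
  -- the density is bounded below.
  let a : Fin d → ℝ := fun k => if x k ≤ (lower k + upper k) / 2 then x k + a₀ k * side k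
    else x k - (a₀ k + κ) * side k
  let b : Fin d → ℝ := fun k => a k + κ * side k
  have hbound : ∀ k, 0 ≤ a₀ k * side k ∧ (a₀ k + κ) * side k ≤ side k ∧ 0 < κ * side k := fun k => by
    have h1 := ha0 k
    have h2 := hs k
    refine ⟨mul_nonneg (hα.trans h1.1) h2.le, ?_, by positivity⟩
    exact mul_le_of_le_one_left h2.le (h1.2.trans hκ1)
  have hmem : ∀ k y, y ∈ Icc (a k) (b k) ↔ s k * ((y - x k) / side k) ∈ Icc (a₀ k) (a₀ k + κ) := by
    intro k y
    have h2 := hs k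
    simp only [a, b, hsdef, mem_Icc]
    split_ifs
    · rw [one_mul, le_div_iff₀ h2, div_le_iff₀ h2]
      constructor <;> rintro ⟨h3, h4⟩ <;> constructor <;> linarith
    · rw [neg_one_mul, ← neg_div, le_div_iff₀ h2, div_le_iff₀ h2]
      constructor <;> rintro ⟨h3, h4⟩ <;> constructor <;> linarith
  have hl := hlow a b (fun k => ?_) (fun k => ?_) (fun k => ?_) (fun k => ?_)
  rotate_left
  · have h1 := hbound k; have h3 := hx k; have h4 := hside k
    simp only [a]; split_ifs with h
    · linarith [h3.1]
    · push Not at h; linarith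
  · have h1 := hbound k; have h3 := hx k; have h4 := hside k
    simp only [b, a]; split_ifs with h
    · linarith
    · linarith [h3.2]
  · linarith [(hbound k).2.2, show b k = a k + κ * side k from rfl]
  · have h1 := hbound k; have h2 := hs k
    have : b k - a k = κ * side k := by simp [b]
    rw [this]; linarith
  have hprod : ∏ k, (b k - a k) = κ ^ d * ∏ k, side k := by
    simp [b, Finset.prod_mul_distrib]
  rw [hprod] at hl
  refine (mul_le_mul_of_nonneg_left hl (by positivity)).trans ?_
  rw [Finset.mul_sum]
  refine Finset.sum_le_sum fun q hq => ?_
  rw [← prod_indicator_one]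
  have hi : ∀ k, (Icc (a k) (b k)).indicator (1 : ℝ → ℝ) (pt q k) =
      (Icc (a₀ k) (a₀ k + κ)).indicator (1 : ℝ → ℝ) (s k * ((pt q k - x k) / side k)) := fun k => by
    by_cases h : pt q k ∈ Icc (a k) (b k)
    · rw [indicator_of_mem h, indicator_of_mem ((hmem k _).1 h)]; rfl
    · rw [indicator_of_notMem h, indicator_of_notMem fun h' => h ((hmem k _).2 h')]
  simp only [hi]
  by_cases h : ∀ k, s k * ((pt q k - x k) / side k) ∈ Icc (a₀ k) (a₀ k + κ)
  · have h1 : c₀ ^ d ≤ ∏ k, K ((pt q k - x k) / side k) := by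
      have hcd : ∏ _k : Fin d, c₀ = c₀ ^ d := by simp
      rw [← hcd]
      refine Finset.prod_le_prod (fun _ _ => hc0.le) fun k _ => ?_
      have hab : |(pt q k - x k) / side k| = s k * ((pt q k - x k) / side k) := by
        have h3 : 0 ≤ s k * ((pt q k - x k) / side k) := (hα.trans (ha0 k).1).trans (h k).1
        have h4 : |s k| = 1 := by simp only [hsdef]; split_ifs <;> simp
        rw [← abs_of_nonneg h3, abs_mul, h4, one_mul]
      apply hKc <;> rw [hab]
      · exact (ha0 k).1.trans (h k).1
      · exact (h k).2.trans (ha0 k).2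
    have h2 : ∏ k, (Icc (a₀ k) (a₀ k + κ)).indicator (1 : ℝ → ℝ)
        (s k * ((pt q k - x k) / side k)) = 1 :=
      Finset.prod_eq_one fun k _ => indicator_of_mem (h k) _
    rw [h2, mul_one, mul_one, mul_comm]
    exact mul_le_mul_of_nonneg_left h1 (hc q hq)
  · push Not at h
    obtain ⟨k, hk⟩ := h
    have h2 : ∏ k, (Icc (a₀ k) (a₀ k + κ)).indicator (1 : ℝ → ℝ)
        (s k * ((pt q k - x k) / side k)) = 0 :=
      Finset.prod_eq_zero (Finset.mem_univ k) (indicator_of_notMem hk _)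
    rw [h2]; simp

/-- A kernel weighted linear fit to noise plus a second order bias has a small intercept. -/
theorem exists_abs_intercept_le (d : ℕ) (hK : IsKernel K) {lo A C : ℝ} (hlo : 0 < lo) (hA : 0 ≤ A)
    (hC : 0 ≤ C) : ∃ D ε₀ : ℝ, 0 ≤ D ∧ 0 < ε₀ ∧ ∀ (ι : Type) (F : Finset ι) (c : ι → ℝ)
    (pt : ι → Fin d → ℝ) (x side lower upper : Fin d → ℝ) (R : ℕ) (V τ : ι → ℝ) (δ ε θ₀ : ℝ)
    (θ : Fin d → ℝ), (∀ q ∈ F, 0 ≤ c q) → (∀ k, 0 < side k) →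
    (∀ k, x k ∈ Icc (lower k) (upper k)) → (∀ k, 2 * side k ≤ upper k - lower k) →
    (∀ q ∈ F, ∀ k, pt q k ∈ Icc (-(R : ℝ)) R) →
    (∀ q ∈ F, |τ q| ≤ C * ∑ k, (pt q k - x k) ^ 2) →
    (∀ I : Fin d → Set ℝ, IsSmallBox R side I →
      |∑ q ∈ F, c q * V q * (univ.pi I).indicator (fun _ => (1 : ℝ)) (pt q)| ≤ δ * ∏ k, side k) →
    (∀ I : Fin d → Set ℝ, IsSmallBox R side I →
      |∑ q ∈ F, c q * (univ.pi I).indicator (fun _ => (1 : ℝ)) (pt q)| ≤ A * ∏ k, side k) →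
    (∀ a b : Fin d → ℝ, (∀ k, lower k ≤ a k) → (∀ k, b k ≤ upper k) → (∀ k, a k ≤ b k) →
      (∀ k, b k - a k ≤ 2 * side k) → lo * ∏ k, (b k - a k) - ε * ∏ k, side k ≤
        ∑ q ∈ F, c q * (univ.pi fun k => Icc (a k) (b k)).indicator (fun _ => (1 : ℝ)) (pt q)) →
    ε ≤ ε₀ →
    ∑ q ∈ F, (c q * ∏ k, K ((pt q k - x k) / side k)) *
        ((V q + τ q) - (θ₀ + ∑ k, θ k * ((pt q k - x k) / side k))) ^ 2 ≤
      ∑ q ∈ F, (c q * ∏ k, K ((pt q k - x k) / side k)) * (V q + τ q) ^ 2 →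
    |θ₀| ≤ D * (δ + ∑ k, side k ^ 2) := by
  obtain ⟨α, β, c₀, hα, hαβ, hβ, hc0, hKc⟩ := hK.exists_pos_lower_bound
  obtain ⟨B, hB, hB1, hB2⟩ := hK.exists_layeredOn
  -- The annulus on which the kernel is bounded below is cut into three; the corner boxes use the
  -- first and the last third, separated by a gap of length `κ`.
  set κ := (β - α) / 3 with hκdef
  have hκ : 0 < κ := by simp only [hκdef]; linarith
  have hκβ : α + 3 * κ = β := by simp only [hκdef]; ring
  -- Half of the expected mass of a corner box; the threshold for `ε` lets the fluctuation consume
  -- at most the other half.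
  set η := c₀ ^ d * (lo * κ ^ d / 2) with hηdef
  have hη : 0 < η := by positivity
  refine ⟨2 * (B ^ d * (1 + C * A)) / (η * (κ / 6) ^ 2), lo * κ ^ d / 2, by positivity,
    by positivity, ?_⟩
  intro ι F c pt x side lower upper R V τ δ ε θ₀ θ hc hs hx hside hR hτ hV hup hlow hε hloss
  set π := ∏ k, side k with hπdef
  have hπ : 0 < π := Finset.prod_pos fun k _ => hs k
  set H := ∑ k, side k ^ 2 with hH
  have hH0 : 0 ≤ H := Finset.sum_nonneg fun k _ => sq_nonneg _
  set w : ι → ℝ := fun q => c q * ∏ k, K ((pt q k - x k) / side k) with hwdef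
  have hKn : ∀ q, 0 ≤ ∏ k, K ((pt q k - x k) / side k) := fun q =>
    Finset.prod_nonneg fun k _ => hK.nonneg _
  have hw : ∀ q ∈ F, 0 ≤ w q := fun q hq => mul_nonneg (hc q hq) (hKn q)
  have hempty : IsSmallBox R side fun _ => (∅ : Set ℝ) :=
    ⟨fun _ => ordConnected_empty, fun _ => empty_subset _, fun _ _ h => absurd h (notMem_empty _)⟩
  have hδ : 0 ≤ δ := by
    have := (abs_nonneg _).trans (hV _ hempty)
    exact nonneg_of_mul_nonneg_left this hπ
  have hwsum : ∑ q ∈ F, w q ≤ B ^ d * (A * π) :=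
    (le_abs_self _).trans (abs_sum_mul_prod_rescaled_le (fun _ => hB1) F c pt x side hs hR hup)
  have hwτ : ∀ q ∈ F, w q * |τ q| ≤ w q * (C * H) := by
    intro q hq
    rcases hK.prod_eq_zero_or fun k => (pt q k - x k) / side k with h | h
    · simp only [hwdef, h, mul_zero, zero_mul]; exact le_rfl
    · refine mul_le_mul_of_nonneg_left ((hτ q hq).trans ?_) (hw q hq)
      refine mul_le_mul_of_nonneg_left (Finset.sum_le_sum fun k _ => ?_) hC
      have h1 := h k
      rw [abs_div, abs_of_pos (hs k), div_le_one (hs k)] at h1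
      exact sq_le_sq' (abs_le.1 h1).1 (abs_le.1 h1).2
  -- No cancellation is used for the remainder: inside the kernel window it is at most `C * H`, and
  -- the total weight is of order `π`.
  have hbias : ∀ g : ι → ℝ, (∀ q ∈ F, (∀ k, |(pt q k - x k) / side k| ≤ 1) → |g q| ≤ 1) →
      |∑ q ∈ F, w q * τ q * g q| ≤ C * H * (B ^ d * (A * π)) := by
    intro g hg
    calc _ ≤ ∑ q ∈ F, |w q * τ q * g q| := Finset.abs_sum_le_sum_abs _ _
      _ ≤ ∑ q ∈ F, w q * (C * H) := by
          refine Finset.sum_le_sum fun q hq => ?_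
          refine le_trans ?_ (hwτ q hq)
          rw [abs_mul, abs_mul, abs_of_nonneg (hw q hq)]
          rcases hK.prod_eq_zero_or fun k => (pt q k - x k) / side k with h | h
          · simp only [hwdef, h, mul_zero, zero_mul]; exact le_rfl
          · exact mul_le_of_le_one_right (mul_nonneg (hw q hq) (abs_nonneg _)) (hg q hq h)
      _ = C * H * ∑ q ∈ F, w q := by rw [← Finset.sum_mul]; ring
      _ ≤ _ := mul_le_mul_of_nonneg_left hwsum (by positivity)
  set Rb := B ^ d * (δ * π) + C * H * (B ^ d * (A * π)) with hRb
  have hsc0 : |∑ q ∈ F, w q * (V q + τ q)| ≤ Rb := by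
    have e : ∑ q ∈ F, w q * (V q + τ q) = ∑ q ∈ F, c q * V q * ∏ k, K ((pt q k - x k) / side k) +
        ∑ q ∈ F, w q * τ q * 1 := by
      rw [← Finset.sum_add_distrib]
      exact Finset.sum_congr rfl fun q _ => by simp only [hwdef]; ring
    rw [e]
    exact (abs_add_le _ _).trans (add_le_add
      (abs_sum_mul_prod_rescaled_le (fun _ => hB1) F _ pt x side hs hR hV)
      (hbias (fun _ => 1) fun _ _ _ => by simp))
  have hsc1 : ∀ k, |∑ q ∈ F, w q * (V q + τ q) * ((pt q k - x k) / side k)| ≤ Rb := by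
    intro k
    -- The score of the `k`-th slope is again a tensor product, with `K u * u` in place of `K` in
    -- coordinate `k`.
    let f : Fin d → ℝ → ℝ := fun l => if l = k then fun u => K u * u else K
    have hf : ∀ l, LayeredOn (Icc (-1) 1) B (f l) := fun l => by
      simp only [f]; split_ifs <;> assumption
    have hfp : ∀ q, ∏ l, f l ((pt q l - x l) / side l) =
        (∏ l, K ((pt q l - x l) / side l)) * ((pt q k - x k) / side k) := by
      intro q
      have : ∀ l, f l ((pt q l - x l) / side l) = K ((pt q l - x l) / side l) *
          (if l = k then (pt q l - x l) / side l else 1) := fun l => by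
        simp only [f]; split_ifs <;> simp
      simp only [this, Finset.prod_mul_distrib]
      rw [Finset.prod_ite_eq' Finset.univ k, if_pos (Finset.mem_univ k)]
    have e : ∑ q ∈ F, w q * (V q + τ q) * ((pt q k - x k) / side k) =
        ∑ q ∈ F, c q * V q * ∏ l, f l ((pt q l - x l) / side l) +
        ∑ q ∈ F, w q * τ q * ((pt q k - x k) / side k) := by
      rw [← Finset.sum_add_distrib]
      exact Finset.sum_congr rfl fun q _ => by rw [hfp]; simp only [hwdef]; ring
    rw [e]
    exact (abs_add_le _ _).trans (add_le_add
      (abs_sum_mul_prod_rescaled_le hf F _ pt x side hs hR hV)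
      (hbias _ fun q _ h => h k))
  have hmass := le_sum_kernel_mul_corner hα hκ (hκβ.trans_le hβ) hc0
    (fun u h1 h2 => hKc u h1 (h2.trans hκβ.le)) F c hc pt x side lower upper hs hx hside hlow rfl
  have hηle : η * π ≤ c₀ ^ d * (lo * (κ ^ d * π) - ε * π) := by
    have : ε * π ≤ lo * κ ^ d / 2 * π := mul_le_mul_of_nonneg_right hε hπ.le
    calc η * π = c₀ ^ d * (lo * κ ^ d / 2 * π) := by rw [hηdef]; ring
      _ ≤ _ := by
        refine mul_le_mul_of_nonneg_left ?_ (by positivity)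
        linarith
  have hfin := abs_intercept_le_of_loss_le F w (fun q => V q + τ q)
    (fun q k => (pt q k - x k) / side k) hw _ (fun k => by split_ifs <;> norm_num) hα hκ
    (hκβ.trans_le hβ) (mul_pos hη hπ) (fun e => hηle.trans (hmass e)) θ₀ θ hsc0 hsc1 hloss
  refine hfin.trans ?_
  have e1 : 2 * Rb / (η * π * (κ / 6) ^ 2) =
      2 * (B ^ d * (δ + C * H * A)) / (η * (κ / 6) ^ 2) := by
    rw [hRb]; field_simp
  rw [e1, div_mul_eq_mul_div]
  refine div_le_div_of_nonneg_right ?_ (by positivity)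
  have hBd : 0 ≤ B ^ d := by positivity
  have : δ + C * H * A ≤ (1 + C * A) * (δ + H) := by
    have := mul_nonneg (mul_nonneg hC hA) hδ
    nlinarith
  calc _ ≤ 2 * (B ^ d * ((1 + C * A) * (δ + H))) := by gcongr
    _ = _ := by ring

end Fit

/-! ### The local linear criterion as a weighted linear fit -/

namespace FunctionalModel

variable {p : ℕ} {Ω S : Type*} {m : FunctionalModel p Ω S}

/-- Index set of the observations of the first `n` subjects. -/
def obsIndex (N : ℕ → ℕ → ℕ) (n : ℕ) : Finset (Σ _ : ℕ, ℕ) :=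
  (Finset.range n).sigma fun i => Finset.range (N n i)

theorem sum_obsIndex (N : ℕ → ℕ → ℕ) (n : ℕ) (g : ℕ → ℕ → ℝ) :
    ∑ q ∈ obsIndex N n, 1 / (n : ℝ) * (1 / (N n q.1 : ℝ)) * g q.1 q.2 =
      1 / (n : ℝ) * ∑ i ∈ Finset.range n, 1 / (N n i : ℝ) * ∑ j ∈ Finset.range (N n i), g i j := by
  rw [obsIndex, Finset.sum_sigma, Finset.mul_sum]
  refine Finset.sum_congr rfl fun i _ => ?_
  rw [← mul_assoc, Finset.mul_sum]

/-- Time and covariate are merged into one vector, and the normalization of the kernels becomes a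
positive factor common to all coefficients, hence irrelevant to the minimization. -/
theorem localLinearLoss_eq (K : ℝ → ℝ) (N : ℕ → ℕ → ℕ) (ht : ℕ → ℝ) (hz : ℕ → Fin p → ℝ)
    (n : ℕ) (ω : Ω) (t : ℝ) (z : Fin p → ℝ) (b : ℝ × ℝ × (Fin p → ℝ)) :
    localLinearLoss m K N ht hz n ω t z b = (∏ k, sides ht hz n k)⁻¹ *
      ∑ q ∈ obsIndex N n, (1 / (n : ℝ) * (1 / (N n q.1 : ℝ)) *
        ∏ k, K ((point q.2 (m.subject q.1 ω) k - (Fin.cons t z : Fin (p + 1) → ℝ) k) /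
          sides ht hz n k)) *
        (m.Y q.1 q.2 ω - b.1 - ∑ k, (Fin.cons b.2.1 b.2.2 : Fin (p + 1) → ℝ) k *
          (point q.2 (m.subject q.1 ω) k - (Fin.cons t z : Fin (p + 1) → ℝ) k)) ^ 2 := by
  have h := sum_obsIndex N n fun i j => (m.Y i j ω - b.1 - b.2.1 * (m.T i j ω - t) -
      ∑ k, b.2.2 k * (m.Z i ω k - z k)) ^ 2 *
      scaledKernel K (ht n) (m.T i j ω - t) * ∏ k, scaledKernel K (hz n k) (m.Z i ω k - z k)
  rw [localLinearLoss, ← h, Finset.mul_sum]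
  refine Finset.sum_congr rfl fun q _ => ?_
  simp only [Fin.prod_univ_succ, Fin.sum_univ_succ, sides, point, subject, Fin.cons_zero,
    Fin.cons_succ, scaledKernel, Finset.prod_div_distrib]
  rw [mul_inv]
  ring

theorem norm_sq_le_sum (x y : Fin (p + 1) → ℝ) :
    ‖((x 0 - y 0, fun k : Fin p => x k.succ - y k.succ) : ℝ × (Fin p → ℝ))‖ ^ 2 ≤
      ∑ k, (x k - y k) ^ 2 := by
  have hk : ∀ k, |x k - y k| ≤ √(∑ k, (x k - y k) ^ 2) := fun k => by
    refine Real.abs_le_sqrt ?_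
    exact Finset.single_le_sum (f := fun k => (x k - y k) ^ 2) (fun _ _ => sq_nonneg _)
      (Finset.mem_univ k)
  have : ‖((x 0 - y 0, fun k : Fin p => x k.succ - y k.succ) : ℝ × (Fin p → ℝ))‖ ≤
      √(∑ k, (x k - y k) ^ 2) := by
    refine max_le (hk 0) ?_
    exact (pi_norm_le_iff_of_nonneg (Real.sqrt_nonneg _)).2 fun k => hk k.succ
  calc _ ≤ (√(∑ k, (x k - y k) ^ 2)) ^ 2 := by gcongr
    _ = _ := Real.sq_sqrt (Finset.sum_nonneg fun _ _ => sq_nonneg _)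

theorem map_eq_sum_cons (D : ℝ × (Fin p → ℝ) →L[ℝ] ℝ) (x : Fin (p + 1) → ℝ) :
    D (x 0, fun k : Fin p => x k.succ) =
      ∑ k, (Fin.cons (D (1, 0)) fun k => D (0, Pi.single k 1) : Fin (p + 1) → ℝ) k * x k := by
  have e : ((x 0, fun k : Fin p => x k.succ) : ℝ × (Fin p → ℝ)) =
      x 0 • ((1, 0) : ℝ × (Fin p → ℝ)) +
        ∑ k : Fin p, x k.succ • ((0, Pi.single k 1) : ℝ × (Fin p → ℝ)) := by
    refine Prod.ext ?_ ?_
    · simp [Prod.fst_sum]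
    · simp only [Prod.snd_add, Prod.smul_snd, smul_zero, zero_add, Prod.snd_sum]
      funext k
      simp [Finset.sum_apply, Pi.single_apply]
  rw [e, map_add, map_sum, map_smul, Fin.sum_univ_succ]
  simp only [map_smul, smul_eq_mul, Fin.cons_zero, Fin.cons_succ]
  rw [mul_comm]
  congr 1
  exact Finset.sum_congr rfl fun k _ => mul_comm _ _

variable [MeasurableSpace Ω] [MeasurableSpace S]

/-- On a good sample the local linear estimator is uniformly close to the mean function. -/
theorem MeanRegular.exists_abs_sub_le (B1 : m.MeanRegular) {K : ℝ → ℝ} (hK : IsKernel K)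
    {lo A : ℝ} (hlo : 0 < lo) (hA : 0 ≤ A) :
    ∃ D ε₀ : ℝ, 0 ≤ D ∧ 0 < ε₀ ∧ ∀ (N : ℕ → ℕ → ℕ) (ht : ℕ → ℝ) (hz : ℕ → Fin p → ℝ)
      (n : ℕ) (ω : Ω) (R : ℕ) (δ ε : ℝ), (∀ k, 0 < sides ht hz n k) →
      (∀ k, 2 * sides ht hz n k ≤ m.upper k - m.lower k) →
      (∀ k, Icc (m.lower k) (m.upper k) ⊆ Icc (-(R : ℝ)) R) →
      (∀ i j, (m.T i j ω, m.Z i ω) ∈ m.dom) →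
      (∀ I, IsSmallBox R (sides ht hz n) I →
        |m.empNoise N n ω (univ.pi I)| ≤ δ * ∏ k, sides ht hz n k) →
      (∀ I, IsSmallBox R (sides ht hz n) I →
        m.empMass N n ω (univ.pi I) ≤ A * ∏ k, sides ht hz n k) →
      (∀ a b : Fin (p + 1) → ℝ, (∀ k, m.lower k ≤ a k) → (∀ k, b k ≤ m.upper k) →
        (∀ k, a k ≤ b k) → (∀ k, b k - a k ≤ 2 * sides ht hz n k) →
        lo * ∏ k, (b k - a k) - ε * ∏ k, sides ht hz n k ≤
          m.empMass N n ω (univ.pi fun k => Icc (a k) (b k))) → ε ≤ ε₀ →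
      ∀ t ∈ m.timeSet, ∀ z ∈ m.covSet, ∀ (b₀ b₁ : ℝ) (b₂ : Fin p → ℝ),
        (∀ b, localLinearLoss m K N ht hz n ω t z (b₀, b₁, b₂) ≤
          localLinearLoss m K N ht hz n ω t z b) →
        |b₀ - m.mean (t, z)| ≤ D * (δ + ∑ k, sides ht hz n k ^ 2) := by
  obtain ⟨hd1, hd2, C, hC⟩ := B1
  obtain ⟨D, ε₀, hD, hε₀, hfit⟩ := exists_abs_intercept_le (p + 1) hK (C := max C 0) hlo hA
    (le_max_right _ _)
  refine ⟨D, ε₀, hD, hε₀, ?_⟩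
  intro N ht hz n ω R δ ε hs hside hR hdom hU hup hlow hε t htt z hzz b₀ b₁ b₂ hmin
  set x : Fin (p + 1) → ℝ := Fin.cons t z with hx
  have hxdom : (t, z) ∈ m.dom := ⟨htt, hzz⟩
  have hxk : ∀ k, x k ∈ Icc (m.lower k) (m.upper k) := m.mem_dom_iff.1 hxdom
  set pt : (Σ _ : ℕ, ℕ) → Fin (p + 1) → ℝ := fun q => point q.2 (m.subject q.1 ω) with hpt
  have hptk : ∀ q k, pt q k ∈ Icc (m.lower k) (m.upper k) := fun q =>
    m.mem_dom_iff.1 (hdom q.1 q.2)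
  set L := fderivWithin ℝ m.mean m.dom (t, z) with hL
  -- Coordinates of the derivative of the mean at (t, z). The tangent plane serves as the competitor
  -- of the minimizer, so that only noise `V` and remainder `τ` are left.
  set β : Fin (p + 1) → ℝ := Fin.cons (L (1, 0)) fun k => L (0, Pi.single k 1) with hβ
  set V : (Σ _ : ℕ, ℕ) → ℝ := fun q => m.U q.1 q.2 ω with hV
  set τ : (Σ _ : ℕ, ℕ) → ℝ := fun q => m.mean (m.T q.1 q.2 ω, m.Z q.1 ω) - m.mean (t, z) -
    ∑ k, β k * (pt q k - x k) with hτ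
  have hτle : ∀ q, |τ q| ≤ max C 0 * ∑ k, (pt q k - x k) ^ 2 := by
    intro q
    have hq : ((m.T q.1 q.2 ω, m.Z q.1 ω) : ℝ × (Fin p → ℝ)) - (t, z) =
        (pt q 0 - x 0, fun k : Fin p => pt q k.succ - x k.succ) := by
      simp only [hpt, hx, point, subject, Fin.cons_zero, Fin.cons_succ]
      rfl
    have h1 := norm_sub_fderivWithin_le m.convex_dom hd1 hd2 hC hxdom (hdom q.1 q.2)
    rw [hq, map_eq_sum_cons _ fun k => pt q k - x k] at h1
    exact h1.trans (mul_le_mul (le_max_left _ _) (norm_sq_le_sum _ _) (by positivity)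
      (le_max_right _ _))
  set b : Fin (p + 1) → ℝ := Fin.cons b₁ b₂ with hb
  set c : (Σ _ : ℕ, ℕ) → ℝ := fun q => 1 / (n : ℝ) * (1 / (N n q.1 : ℝ)) with hc
  have hnoise : ∀ A : Set (Fin (p + 1) → ℝ), ∑ q ∈ obsIndex N n, c q * V q *
      A.indicator (fun _ => (1 : ℝ)) (pt q) = m.empNoise N n ω A := by
    intro A
    rw [empNoise, ← sum_obsIndex N n fun i j =>
      A.indicator (fun _ => m.U i j ω) (point j (m.subject i ω))]
    refine Finset.sum_congr rfl fun q _ => ?_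
    simp only [hc, hV, hpt]
    by_cases h : point q.2 (m.subject q.1 ω) ∈ A
    · rw [indicator_of_mem h, indicator_of_mem h, mul_one]
    · rw [indicator_of_notMem h, indicator_of_notMem h, mul_zero, mul_zero]
  have hmass : ∀ A : Set (Fin (p + 1) → ℝ), ∑ q ∈ obsIndex N n, c q *
      A.indicator (fun _ => (1 : ℝ)) (pt q) = m.empMass N n ω A := fun A =>
    sum_obsIndex N n fun i j => A.indicator (fun _ => (1 : ℝ)) (point j (m.subject i ω))
  have hmass0 : ∀ A : Set (Fin (p + 1) → ℝ), 0 ≤ m.empMass N n ω A := fun A => by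
    rw [← hmass]
    exact Finset.sum_nonneg fun q _ => mul_nonneg (by simp only [hc]; positivity)
      (indicator_nonneg (fun _ _ => zero_le_one) _)
  -- The fit to noise and remainder has intercept `b₀ - m.mean (t, z)`; slope differences are
  -- multiplied by the bandwidths because the regressors are divided by them.
  refine hfit (Σ _ : ℕ, ℕ) (obsIndex N n) c pt x (sides ht hz n) m.lower m.upper R V τ δ ε
    (b₀ - m.mean (t, z)) (fun k => sides ht hz n k * (b k - β k))
    (fun q _ => by simp only [hc]; positivity) hs hxk hside (fun q _ k => hR k (hptk q k))
    (fun q _ => hτle q) (fun I hI => by rw [hnoise]; exact hU I hI)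
    (fun I hI => by rw [hmass, abs_of_nonneg (hmass0 _)]; exact hup I hI)
    (fun a b h1 h2 h3 h4 => by rw [hmass]; exact hlow a b h1 h2 h3 h4) hε ?_
  have hπ : 0 < ∏ k, sides ht hz n k := Finset.prod_pos fun k _ => hs k
  have h := hmin (m.mean (t, z), L (1, 0), fun k => L (0, Pi.single k 1))
  rw [localLinearLoss_eq, localLinearLoss_eq, mul_le_mul_iff_right₀ (inv_pos.2 hπ)] at h
  have e1 : ∀ q : Σ _ : ℕ, ℕ, m.Y q.1 q.2 ω - m.mean (t, z) - ∑ k, β k * (pt q k - x k) =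
      V q + τ q := fun q => by simp only [hV, hτ, U]; ring
  have e2 : ∀ q : Σ _ : ℕ, ℕ, m.Y q.1 q.2 ω - b₀ - ∑ k, b k * (pt q k - x k) =
      V q + τ q - (b₀ - m.mean (t, z) +
        ∑ k, sides ht hz n k * (b k - β k) * ((pt q k - x k) / sides ht hz n k)) := fun q => by
    rw [← e1]
    have : ∑ k, sides ht hz n k * (b k - β k) * ((pt q k - x k) / sides ht hz n k) =
        ∑ k, b k * (pt q k - x k) - ∑ k, β k * (pt q k - x k) := by
      rw [← Finset.sum_sub_distrib]
      refine Finset.sum_congr rfl fun k _ => ?_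
      have := (hs k).ne'
      field_simp
    rw [this]
    ring
  simp only [← hb, ← hβ, ← hx] at h
  refine le_trans (le_of_eq ?_) (h.trans (le_of_eq ?_))
  · exact Finset.sum_congr rfl fun q _ => by rw [← e2]
  · exact Finset.sum_congr rfl fun q _ => by rw [← e1]

end FunctionalModel

/-! ### From box deviations to the uniform rate -/

namespace FunctionalModel

variable {p : ℕ} {Ω S : Type*} [MeasurableSpace Ω] [MeasurableSpace S]
  {m : FunctionalModel p Ω S} {P : Measure Ω} [IsProbabilityMeasure P]

theorem le_one_div_mul_sum {N : ℕ} (hN : 0 < N) {f : ℕ → ℝ} {c : ℝ} (h : ∀ j < N, c ≤ f j) :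
    c ≤ 1 / (N : ℝ) * ∑ j ∈ Finset.range N, f j := by
  have hN' : (0 : ℝ) < N := by exact_mod_cast hN
  rw [one_div, le_inv_mul_iff₀ hN', ← nsmul_eq_mul]
  simpa using Finset.card_nsmul_le_sum (Finset.range N) f c fun j hj => h j (Finset.mem_range.1 hj)

theorem IsEigenAdjusted.measureReal_smallBox_le (hm : m.IsEigenAdjusted P) {hi : ℝ}
    (hhi0 : 0 ≤ hi) (hhi : ∀ x ∈ m.dom, m.dens x ≤ hi) {R : ℕ} {side : Fin (p + 1) → ℝ}
    (hs : ∀ k, 0 ≤ side k) {I : Fin (p + 1) → Set ℝ} (hI : IsSmallBox R side I) (i j : ℕ) :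
    P.real {ω | point j (m.subject i ω) ∈ univ.pi I} ≤ hi * 2 ^ (p + 1) * ∏ k, side k := by
  have h1 := hm.measure_point_le hhi (fun k => (hI.1 k).measurableSet) i j
  have hvol : ∀ k, volume (I k) ≤ ENNReal.ofReal (2 * side k) := fun k => by
    refine (Real.volume_le_diam _).trans (Metric.ediam_le fun y hy z hz => ?_)
    rw [edist_dist, Real.dist_eq]
    exact ENNReal.ofReal_le_ofReal (abs_le.2 ⟨by linarith [hI.2.2 k y hy z hz],
      by linarith [hI.2.2 k z hz y hy]⟩)
  have e : hi * 2 ^ (p + 1) * ∏ k, side k = hi * ∏ k, 2 * side k := by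
    rw [Finset.prod_mul_distrib, Finset.prod_const, Finset.card_univ, Fintype.card_fin]; ring
  have h0 : 0 ≤ ∏ k, 2 * side k := Finset.prod_nonneg fun k _ => by have := hs k; positivity
  refine ENNReal.toReal_le_of_le_ofReal (by rw [e]; positivity) (h1.trans ?_)
  rw [e, ENNReal.ofReal_mul hhi0,
    ENNReal.ofReal_prod_of_nonneg fun k _ => by have := hs k; positivity]
  gcongr with k
  exact hvol k

theorem IsEigenAdjusted.le_measureReal_Icc (hm : m.IsEigenAdjusted P) {lo : ℝ} (hlo0 : 0 ≤ lo)
    (hlo : ∀ x ∈ m.dom, lo ≤ m.dens x) {a b : Fin (p + 1) → ℝ} (ha : ∀ k, m.lower k ≤ a k)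
    (hb : ∀ k, b k ≤ m.upper k) (hab : ∀ k, a k ≤ b k) (i j : ℕ) :
    lo * ∏ k, (b k - a k) ≤
      P.real {ω | point j (m.subject i ω) ∈ univ.pi fun k => Icc (a k) (b k)} := by
  have h1 := hm.le_measure_point hlo (I := fun k => Icc (a k) (b k)) (fun k => measurableSet_Icc)
    (fun k => Icc_subset_Icc (ha k) (hb k)) i j
  simp only [Real.volume_Icc] at h1
  rw [← ENNReal.ofReal_prod_of_nonneg fun k _ => sub_nonneg.2 (hab k),
    ← ENNReal.ofReal_mul hlo0] at h1
  exact (ENNReal.ofReal_le_iff_le_toReal (measure_ne_top _ _)).1 h1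

/-- The uniform error is of the order of squared bandwidths plus the stochastic fluctuation. -/
theorem IsEigenAdjusted.hasUniformRate (hm : m.IsEigenAdjusted P) (A1 : m.DensityRegular)
    (B1 : m.MeanRegular) {K : ℝ → ℝ} (A2 : IsKernel K) {N : ℕ → ℕ → ℕ}
    (hN : ∀ n, ∀ i < n, 1 ≤ N n i) {ht : ℕ → ℝ} {hz : ℕ → Fin p → ℝ}
    (ht_pos : ∀ n, 0 < ht n) (hz_pos : ∀ n k, 0 < hz n k)
    (hlim : ∀ k, Tendsto (fun n => sides ht hz n k) atTop (𝓝 0)) {r : ℝ}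
    (hU : ∀ i j, Integrable (fun ω => |m.U i j ω| ^ r) P)
    (hX : ∀ i, AEMeasurable m.supX (P.map fun ω => (m.ξ i ω, m.Z i ω)) ∧
      ∫⁻ ω, m.supX (m.ξ i ω, m.Z i ω) ^ r ∂P < ∞) {v : ℕ → ℝ}
    (hd : IsBoxDesign P m.subject N (fun j => point j) r (sides ht hz) v)
    (hres : ∀ s : ℝ, |s| = 1 → ∀ᵐ ω ∂P, ∃ C, ∀ᶠ n : ℕ in atTop, 1 / (n : ℝ) *
      ∑ i ∈ Finset.range n, 1 / (N n i : ℝ) * ∑ j ∈ Finset.range (N n i),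
        excess (truncLevel r n) (max (s * errAt j (m.subject i ω)) 0) ≤
          C * (truncLevel r n * logRatio n))
    (hδ : Tendsto (fun n => √(v n * logRatio n) / ∏ k, sides ht hz n k) atTop (𝓝 0))
    {muhat : ℕ → Ω → ℝ → (Fin p → ℝ) → ℝ} (hmu : IsLocalLinearEstimator m K N ht hz muhat)
    {rate : ℕ → ℝ} (hrate0 : ∀ n, 0 ≤ rate n)
    (hrate : (fun n => √(v n * logRatio n) / (∏ k, sides ht hz n k) + ∑ k, sides ht hz n k ^ 2)
      =O[atTop] rate) : HasUniformRate m P muhat rate := by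
  obtain ⟨lo, hi, hlo, hdens⟩ := A1.1
  have hhi : ∀ x ∈ m.dom, m.dens x ≤ max hi 0 := fun x hx => (hdens x hx).2.trans (le_max_left _ _)
  -- The first summand bounds the expected mass of a small box in units of `π`; the 1 is for the
  -- fluctuation, eventually at most `π`.
  set A := max hi 0 * 2 ^ (p + 1) + 1 with hAdef
  have hA : 0 ≤ A := by positivity
  obtain ⟨D, ε₀, hD, hε₀, hfit⟩ := B1.exists_abs_sub_le A2 hlo hA
  obtain ⟨R, hR⟩ : ∃ R : ℕ, ∀ k, Icc (m.lower k) (m.upper k) ⊆ Icc (-(R : ℝ)) R := by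
    obtain ⟨R, hR⟩ := exists_nat_ge (∑ k, (|m.lower k| + |m.upper k|))
    refine ⟨R, fun k => ?_⟩
    have h1 : |m.lower k| + |m.upper k| ≤ R :=
      (Finset.single_le_sum (f := fun k => |m.lower k| + |m.upper k|)
        (fun _ _ => by positivity) (Finset.mem_univ k)).trans hR
    have h2 := neg_abs_le (m.lower k)
    have h3 := le_abs_self (m.upper k)
    have h4 := abs_nonneg (m.lower k)
    have h5 := abs_nonneg (m.upper k)
    exact Icc_subset_Icc (by linarith) (by linarith)
  obtain ⟨E, hE, hrate'⟩ := hrate.exists_pos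
  have hspos : ∀ n k, 0 < sides ht hz n k := sides_pos ht_pos hz_pos
  have hsmall : ∀ᶠ n in atTop, ∀ k, 2 * sides ht hz n k ≤ m.upper k - m.lower k := by
    refine eventually_all.2 fun k => ?_
    have h1 : 0 < (m.upper k - m.lower k) / 2 := by linarith [hm.lower_lt_upper k]
    filter_upwards [(hlim k).eventually_le_const h1] with n hn
    linarith
  filter_upwards [hm.ae_empNoise_le B1.continuousOn hU hX hd hres R, hd.count_deviation_le R,
    hm.ae_mem_dom] with ω ⟨C₁, hC1⟩ ⟨C₂, hC2⟩ hdom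
  -- The bound 1 is for the upper estimate of the empirical mass, `ε₀` for the lower one.
  have hev : ∀ᶠ n in atTop, max C₂ 0 * (√(v n * logRatio n) / ∏ k, sides ht hz n k) ≤ min 1 ε₀ := by
    have := hδ.const_mul (max C₂ 0)
    rw [mul_zero] at this
    exact this.eventually_le_const (lt_min one_pos hε₀)
  refine ⟨D * (max C₁ 1 * E), ?_⟩
  filter_upwards [hC1, hC2, hev, hrate'.bound, hsmall, eventually_gt_atTop 0]
    with n h1 h2 h3 h4 h5 hn
  set π := ∏ k, sides ht hz n k with hπdef
  have hπ : 0 < π := Finset.prod_pos fun k _ => hspos n k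
  set δ := √(v n * logRatio n) / π with hδdef
  have hδ0 : 0 ≤ δ := by positivity
  have hsq : √(v n * logRatio n) = δ * π := by rw [hδdef]; field_simp
  rw [hsq] at h1 h2
  set H := ∑ k, sides ht hz n k ^ 2 with hHdef
  have hH0 : 0 ≤ H := Finset.sum_nonneg fun k _ => sq_nonneg _
  rw [Real.norm_of_nonneg (by positivity), Real.norm_of_nonneg (hrate0 n)] at h4
  have hdevle : C₂ * (δ * π) ≤ max C₂ 0 * δ * π := by
    rw [mul_assoc]; gcongr; exact le_max_left _ _
  have hmassdev : ∀ I, IsSmallBox R (sides ht hz n) I →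
      |m.empMass N n ω (univ.pi I) - 1 / (n : ℝ) * ∑ i ∈ Finset.range n, 1 / (N n i : ℝ) *
        ∑ j ∈ Finset.range (N n i), P.real {ω | point j (m.subject i ω) ∈ univ.pi I}| ≤
          max C₂ 0 * δ * π := fun I hI => (h2 I hI).trans hdevle
  have hmain := hfit N ht hz n ω R (max C₁ 1 * δ) (max C₂ 0 * δ) (hspos n) h5 hR hdom
    (fun I hI => (h1 I hI).trans (by
      rw [mul_assoc]; gcongr; exact le_max_left _ _)) (fun I hI => ?_)
    (fun a b ha hb hab hbox => ?_) (h3.trans (min_le_right _ _))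
  · refine iSup₂_le fun t htt => iSup₂_le fun z hzz => ENNReal.ofReal_le_ofReal ?_
    obtain ⟨b₁, b₂, hb⟩ := hmu n ω t htt z hzz
    refine (hmain t htt z hzz _ b₁ b₂ hb).trans ?_
    have hC1' : 1 ≤ max C₁ 1 := le_max_right _ _
    calc D * (max C₁ 1 * δ + H) ≤ D * (max C₁ 1 * (δ + H)) := by
          refine mul_le_mul_of_nonneg_left ?_ hD
          nlinarith
      _ ≤ D * (max C₁ 1 * (E * rate n)) := by gcongr
      _ = _ := by ring
  · have h6 := (abs_le.1 (hmassdev I hI)).2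
    have h7 : 1 / (n : ℝ) * ∑ i ∈ Finset.range n, 1 / (N n i : ℝ) *
        ∑ j ∈ Finset.range (N n i), P.real {ω | point j (m.subject i ω) ∈ univ.pi I} ≤
          max hi 0 * 2 ^ (p + 1) * π := by
      have h0 : 0 ≤ max hi 0 * 2 ^ (p + 1) * π := by positivity
      exact one_div_mul_sum_le h0 fun i _ => one_div_mul_sum_le h0 fun j _ =>
        hm.measureReal_smallBox_le (le_max_right _ _) hhi (fun k => (hspos n k).le) hI i j
    have h8 : max C₂ 0 * δ * π ≤ 1 * π :=
      mul_le_mul_of_nonneg_right (h3.trans (min_le_left _ _)) hπ.le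
    rw [hAdef, add_mul]
    linarith
  · have hI : IsSmallBox R (sides ht hz n) fun k => Icc (a k) (b k) :=
      ⟨fun k => ordConnected_Icc, fun k => (Icc_subset_Icc (ha k) (hb k)).trans (hR k),
        fun k y hy z hz => by linarith [hy.1, hz.2, hbox k]⟩
    have h6 := (abs_le.1 (hmassdev _ hI)).1
    have h7 : lo * ∏ k, (b k - a k) ≤ 1 / (n : ℝ) * ∑ i ∈ Finset.range n, 1 / (N n i : ℝ) *
        ∑ j ∈ Finset.range (N n i),
          P.real {ω | point j (m.subject i ω) ∈ univ.pi fun k => Icc (a k) (b k)} :=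
      le_one_div_mul_sum hn fun i hi => le_one_div_mul_sum (hN n i hi) fun j _ =>
        hm.le_measureReal_Icc hlo.le (fun x hx => (hdens x hx).1) ha hb hab i j
    linarith

end FunctionalModel

/-! ### Comparison of rates -/

theorem isBigO_sqrt_div {a b ρ : ℕ → ℝ} (ha : ∀ n, 0 < a n) (hb : ∀ n, 0 < b n)
    (hρ : ∀ n, 0 ≤ ρ n) (hab : a =O[atTop] b) :
    (fun n => √(ρ n / b n)) =O[atTop] fun n => √(ρ n / a n) := by
  obtain ⟨C, hC, h⟩ := hab.exists_pos
  refine IsBigO.of_bound (√C) ?_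
  filter_upwards [h.bound] with n hn
  have h1 := ha n
  have h2 := hb n
  have h3 := hρ n
  rw [Real.norm_of_nonneg h1.le, Real.norm_of_nonneg h2.le] at hn
  rw [Real.norm_of_nonneg (Real.sqrt_nonneg _), Real.norm_of_nonneg (Real.sqrt_nonneg _),
    ← Real.sqrt_mul hC.le]
  refine Real.sqrt_le_sqrt ?_
  rw [mul_div_assoc', div_le_div_iff₀ h2 h1]
  nlinarith

theorem pow_isBigO_prod {d : ℕ} {h : ℕ → ℝ} {side : ℕ → Fin d → ℝ}
    (H : ∀ k, h =O[atTop] fun n => side n k) :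
    (fun n => h n ^ d) =O[atTop] fun n => ∏ k, side n k := by
  have := IsBigO.finsetProd (s := (Finset.univ : Finset (Fin d))) (f := fun _ n => h n)
    (g := fun k n => side n k) (l := atTop) fun k _ => H k
  simpa using this

theorem sum_sq_isBigO {d : ℕ} {h : ℕ → ℝ} {side : ℕ → Fin d → ℝ}
    (H : ∀ k, (fun n => side n k) =O[atTop] h) :
    (fun n => ∑ k, side n k ^ 2) =O[atTop] fun n => h n ^ 2 :=
  IsBigO.fun_sum fun k _ => (H k).pow 2

/-! ### The sparse and the dense regime -/

namespace FunctionalModel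

variable {p : ℕ} {Ω S : Type*} [MeasurableSpace Ω] [MeasurableSpace S]
  {m : FunctionalModel p Ω S} {P : Measure Ω} [IsProbabilityMeasure P]

theorem sqrt_mul_div_self {π ρ : ℝ} (hπ : 0 < π) : √(π * ρ) / π = √(ρ / π) := by
  nth_rewrite 2 [← Real.sqrt_sq hπ.le]
  rw [← Real.sqrt_div' _ (sq_nonneg π)]
  congr 1
  field_simp

theorem _root_.HasUniformRate.mono {muhat : ℕ → Ω → ℝ → (Fin p → ℝ) → ℝ} {f g : ℕ → ℝ}
    (hf : ∀ n, 0 ≤ f n) (hg : ∀ n, 0 ≤ g n) (hfg : f =O[atTop] g)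
    (h : HasUniformRate m P muhat f) : HasUniformRate m P muhat g := by
  obtain ⟨D, hD, hfg⟩ := hfg.exists_pos
  filter_upwards [h] with ω ⟨C, hC⟩
  refine ⟨max C 0 * D, ?_⟩
  filter_upwards [hC, hfg.bound] with n h1 h2
  rw [Real.norm_of_nonneg (hf n), Real.norm_of_nonneg (hg n)] at h2
  refine h1.trans (ENNReal.ofReal_le_ofReal ?_)
  calc C * f n ≤ max C 0 * f n := mul_le_mul_of_nonneg_right (le_max_left _ _) (hf n)
    _ ≤ max C 0 * (D * g n) := by gcongr
    _ = _ := by ring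

/-- Boundedly many observations per subject. -/
theorem IsEigenAdjusted.hasUniformRate_sparse (hm : m.IsEigenAdjusted P) (A1 : m.DensityRegular)
    (B1 : m.MeanRegular) {K : ℝ → ℝ} (A2 : IsKernel K) {N : ℕ → ℕ → ℕ}
    (hN : ∀ n, ∀ i < n, 1 ≤ N n i) {ht : ℕ → ℝ} {hz : ℕ → Fin p → ℝ}
    (ht_pos : ∀ n, 0 < ht n) (hz_pos : ∀ n k, 0 < hz n k) (B2 : MomentBandwidth m P N ht hz)
    {muhat : ℕ → Ω → ℝ → (Fin p → ℝ) → ℝ} (hmu : IsLocalLinearEstimator m K N ht hz muhat)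
    {M : ℕ} (hM : ∀ n, ∀ i < n, N n i ≤ M) {h : ℕ → ℝ} (hh : ∀ n, 0 < h n)
    (hth : ht =Θ[atTop] h) (hzh : ∀ k, (fun n => hz n k) =Θ[atTop] h) :
    HasUniformRate m P muhat (sparseRate p h) := by
  obtain ⟨r, hr, hU, hX, hht, hband⟩ := B2
  have hspos : ∀ n k, 0 < sides ht hz n k := sides_pos ht_pos hz_pos
  have hh0 : Tendsto h atTop (𝓝 0) := hth.2.trans_tendsto hht
  have hlim := tendsto_sides hht fun k => (hzh k).1.trans_tendsto hh0
  have hsides : ∀ k, (fun n => sides ht hz n k) =Θ[atTop] h := fun k => by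
    refine Fin.cases ?_ (fun k => ?_) k
    · simpa [sides] using hth
    · simpa [sides] using hzh k
  have hv0 : ∀ n, 0 < ∏ k, sides ht hz n k := fun n => Finset.prod_pos fun k _ => hspos n k
  have hlevel : ∃ C, ∀ᶠ n : ℕ in atTop,
      truncLevel r n ^ 2 * logRatio n ≤ C * ∏ k, sides ht hz n k := by
    -- One unit for each summand: eventually `ht n ^ 2 ≤ ht n`, and the mean of `1 / N` is at most
    -- 1.
    refine truncLevel_sq_mul_le ht_pos hz_pos hband (C := 2) ?_
    filter_upwards [hht.eventually_le_const zero_lt_one, eventually_gt_atTop 0] with n hn h0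
    have hπ : 0 < ∏ k, hz n k := Finset.prod_pos fun k _ => hz_pos n k
    have ht0 := ht_pos n
    have hmean : 1 / (n : ℝ) * ∑ i ∈ Finset.range n, 1 / (N n i : ℝ) ≤ 1 :=
      one_div_mul_sum_le zero_le_one fun i hi => by
        have : (1 : ℝ) ≤ N n i := by exact_mod_cast hN n i hi
        rw [div_le_one (by linarith)]; exact this
    rw [prod_sides, two_mul]
    refine add_le_add ?_ (mul_le_of_le_one_right (by positivity) hmean)
    refine mul_le_mul_of_nonneg_right ?_ hπ.le
    rw [sq]
    exact mul_le_of_le_one_left ht0.le hn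
  have hle : ∀ᶠ n in atTop, ∏ k, sides ht hz n k ≤ ∏ k, sides ht hz n k :=
    Eventually.of_forall fun n => le_rfl
  have hd := hm.isBoxDesign A1 hr hspos hlim hv0 hle hlevel (hm.count_le A1 N hspos)
  have hr1 : 1 ≤ r := by linarith
  refine hm.hasUniformRate A1 B1 A2 hN ht_pos hz_pos hlim hU hX hd
    (fun s hs => hm.ae_err_excess_le_of_bounded hM hr1
      (hm.memLp_err B1.continuousOn hr1 hU hX) hs)
    (tendsto_sqrt_div_prod hr hspos hv0 hle hlevel) hmu (sparseRate_nonneg p h) ?_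
  simp only [sqrt_mul_div_self (hv0 _)]
  have h1 := isBigO_sqrt_div (ρ := logRatio) (fun n => pow_pos (hh n) (p + 1)) hv0 logRatio_nonneg
    (pow_isBigO_prod fun k => (hsides k).2)
  have h2 := sum_sq_isBigO fun k => (hsides k).1
  refine IsBigO.add (h1.trans ?_) (h2.trans ?_)
  · refine IsBigO.of_bound 1 (Eventually.of_forall fun n => ?_)
    rw [one_mul, Real.norm_of_nonneg (Real.sqrt_nonneg _),
      Real.norm_of_nonneg (sparseRate_nonneg p h n), sparseRate_eq]
    exact le_add_of_nonneg_left (sq_nonneg _)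
  · refine IsBigO.of_bound 1 (Eventually.of_forall fun n => ?_)
    rw [one_mul, Real.norm_of_nonneg (sq_nonneg _),
      Real.norm_of_nonneg (sparseRate_nonneg p h n), sparseRate_eq]
    exact le_add_of_nonneg_right (Real.sqrt_nonneg _)

/-- Densely observed subjects. -/
theorem IsEigenAdjusted.hasUniformRate_dense (hm : m.IsEigenAdjusted P) (A1 : m.DensityRegular)
    (B1 : m.MeanRegular) {K : ℝ → ℝ} (A2 : IsKernel K) {N : ℕ → ℕ → ℕ}
    (hN : ∀ n, ∀ i < n, 1 ≤ N n i) {ht : ℕ → ℝ} {hz : ℕ → Fin p → ℝ}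
    (ht_pos : ∀ n, 0 < ht n) (hz_pos : ∀ n k, 0 < hz n k) (B2 : MomentBandwidth m P N ht hz)
    {muhat : ℕ → Ω → ℝ → (Fin p → ℝ) → ℝ} (hmu : IsLocalLinearEstimator m K N ht hz muhat)
    (hpair : PairDensityBounded m P) {Mmin : ℕ → ℝ} (hMpos : ∀ n, 0 < Mmin n)
    (hM : ∀ n, ∀ i < n, Mmin n ≤ N n i) (hMt : (fun n => (Mmin n)⁻¹) =O[atTop] ht)
    (hth : ht =O[atTop] fun n => logRatio n ^ (1 / ((p : ℝ) + 4)))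
    (hzh : ∀ k, (fun n => hz n k) =Θ[atTop] fun n => logRatio n ^ (1 / ((p : ℝ) + 4))) :
    HasUniformRate m P muhat (fun n => logRatio n ^ (2 / ((p : ℝ) + 4))) := by
  obtain ⟨r, hr, hU, hX, hht, hband⟩ := B2
  have hp4 : (0 : ℝ) < p + 4 := by positivity
  have ha : 0 < 1 / ((p : ℝ) + 4) := by positivity
  have hspos : ∀ n k, 0 < sides ht hz n k := sides_pos ht_pos hz_pos
  have hh0 : Tendsto (fun n => logRatio n ^ (1 / ((p : ℝ) + 4))) atTop (𝓝 0) := by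
    have := tendsto_logRatio.rpow_const (p := 1 / ((p : ℝ) + 4)) (Or.inr ha.le)
    rwa [Real.zero_rpow ha.ne'] at this
  have hlim := tendsto_sides hht fun k => (hzh k).1.trans_tendsto hh0
  have hsides : ∀ k, (fun n => sides ht hz n k) =O[atTop]
      fun n => logRatio n ^ (1 / ((p : ℝ) + 4)) := fun k => by
    refine Fin.cases ?_ (fun k => ?_) k
    · simpa [sides] using hth
    · simpa [sides] using (hzh k).1
  have hπ0 : ∀ n, 0 < ∏ k, sides ht hz n k := fun n => Finset.prod_pos fun k _ => hspos n k
  have hv0 : ∀ n, 0 < sides ht hz n 0 * ∏ k, sides ht hz n k := fun n =>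
    mul_pos (hspos n 0) (hπ0 n)
  obtain ⟨D, hD, hMt'⟩ := hMt.exists_pos
  have hNinv : ∀ᶠ n : ℕ in atTop, ∀ i < n, 1 / (N n i : ℝ) ≤ D * sides ht hz n 0 := by
    filter_upwards [hMt'.bound] with n hn i hi
    rw [Real.norm_of_nonneg (inv_nonneg.2 (hMpos n).le), Real.norm_of_nonneg (ht_pos n).le] at hn
    refine le_trans ?_ hn
    rw [← one_div]
    exact one_div_le_one_div_of_le (hMpos n) (hM n i hi)
  have hlevel : ∃ C, ∀ᶠ n : ℕ in atTop,
      truncLevel r n ^ 2 * logRatio n ≤ C * (sides ht hz n 0 * ∏ k, sides ht hz n k) := by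
    refine truncLevel_sq_mul_le ht_pos hz_pos hband (C := 1 + D) ?_
    filter_upwards [hNinv] with n hn
    have hπ : 0 < ∏ k, hz n k := Finset.prod_pos fun k _ => hz_pos n k
    have ht0 := ht_pos n
    have hs0 : sides ht hz n 0 = ht n := rfl
    have hmean : 1 / (n : ℝ) * ∑ i ∈ Finset.range n, 1 / (N n i : ℝ) ≤ D * ht n :=
      one_div_mul_sum_le (by positivity) hn
    rw [prod_sides, hs0]
    calc _ ≤ ht n ^ 2 * ∏ k, hz n k + ht n * (∏ k, hz n k) * (D * ht n) := by gcongr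
      _ = _ := by ring
  have hle : ∀ᶠ n in atTop, sides ht hz n 0 * ∏ k, sides ht hz n k ≤ ∏ k, sides ht hz n k := by
    filter_upwards [hht.eventually_le_const zero_lt_one] with n hn
    exact mul_le_of_le_one_left (hπ0 n).le hn
  have hd := hm.isBoxDesign A1 hr hspos hlim hv0 hle hlevel
    (hm.count_le_of_pairDensity A1 hpair hspos hNinv)
  have hr1 : 1 ≤ r := by linarith
  obtain ⟨E, hE, hMh⟩ := (hMt.trans hth).exists_pos
  -- The counts grow at least like a power of n / log n, since 1 / N = O(h_t) and h_t is at most of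
  -- the order of h_z. This is the input for the excess of the errors.
  have hNlow : ∀ᶠ n : ℕ in atTop, ∀ i < n,
      E⁻¹ * logRatio n ^ (-(1 / ((p : ℝ) + 4))) ≤ N n i := by
    filter_upwards [hMh.bound, eventually_ge_atTop 2] with n hn h2 i hi
    have hρ := logRatio_pos h2
    rw [Real.norm_of_nonneg (inv_nonneg.2 (hMpos n).le), Real.norm_of_nonneg (by positivity)] at hn
    refine le_trans ?_ (hM n i hi)
    rw [Real.rpow_neg hρ.le, ← mul_inv]
    exact inv_le_of_inv_le₀ (hMpos n) hn
  refine hm.hasUniformRate A1 B1 A2 hN ht_pos hz_pos hlim hU hX hd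
    (fun s hs => hm.ae_err_excess_le_of_dense hN (inv_pos.2 hE) ha hNlow hr
      (hm.memLp_err B1.continuousOn hr1 hU hX) hs)
    (tendsto_sqrt_div_prod hr hspos hv0 hle hlevel) hmu
    (fun n => Real.rpow_nonneg (logRatio_nonneg n) _) ?_
  have hz0 : ∀ n, 0 < ∏ k, hz n k := fun n => Finset.prod_pos fun k _ => hz_pos n k
  -- The time bandwidth cancels: the variance factor is its square times the product of the
  -- covariate bandwidths.
  have e1 : ∀ n, √(sides ht hz n 0 * (∏ k, sides ht hz n k) * logRatio n) /
      ∏ k, sides ht hz n k = √(logRatio n / ∏ k, hz n k) := fun n => by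
    have hs0 : sides ht hz n 0 = ht n := rfl
    have h1 := ht_pos n
    have h2 := hz0 n
    rw [hs0, prod_sides, show ht n * (ht n * ∏ k, hz n k) * logRatio n =
      ht n ^ 2 * ((∏ k, hz n k) * logRatio n) by ring, Real.sqrt_mul (sq_nonneg _),
      Real.sqrt_sq h1.le, mul_div_mul_left _ _ h1.ne', sqrt_mul_div_self h2]
  simp only [e1]
  have hpow : ∀ n, logRatio n ^ (2 / ((p : ℝ) + 4)) = (logRatio n ^ (1 / ((p : ℝ) + 4))) ^ 2 :=
    fun n => by rw [rpow_one_div_pow (logRatio_nonneg n)]; norm_num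
  refine IsBigO.add ?_ ?_
  · have h1 : (fun n => (logRatio n ^ (1 / ((p : ℝ) + 4))) ^ p) =O[atTop] fun n => ∏ k, hz n k :=
      pow_isBigO_prod fun k => (hzh k).2
    obtain ⟨C, hC, h2⟩ := h1.exists_pos
    refine IsBigO.of_bound (√C) ?_
    filter_upwards [h2.bound, eventually_ge_atTop 2] with n h3 hn
    have hρ := logRatio_pos hn
    have hzn := hz0 n
    rw [Real.norm_of_nonneg (by positivity), Real.norm_of_nonneg hzn.le] at h3
    rw [Real.norm_of_nonneg (Real.sqrt_nonneg _), Real.norm_of_nonneg (by positivity)]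
    set g := logRatio n ^ (1 / ((p : ℝ) + 4)) with hg
    have hg0 : 0 < g := by positivity
    -- Of these factors `p` are absorbed by the product of the covariate bandwidths; the remaining
    -- `g ^ 4` has square root `g ^ 2`, the order of the bias.
    have hρg : logRatio n = g ^ (p + 4) := by
      rw [hg, rpow_one_div_pow hρ.le]
      push_cast
      rw [div_self hp4.ne', Real.rpow_one]
    have : logRatio n / ∏ k, hz n k ≤ C * (g ^ 2) ^ 2 := by
      rw [div_le_iff₀ hzn, hρg]
      calc g ^ (p + 4) = g ^ p * g ^ 4 := pow_add _ _ _
        _ ≤ C * (∏ k, hz n k) * g ^ 4 := by gcongr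
        _ = _ := by ring
    refine (Real.sqrt_le_sqrt this).trans (le_of_eq ?_)
    rw [Real.sqrt_mul hC.le, Real.sqrt_sq (sq_nonneg g), hpow]
  · simp only [hpow]
    exact sum_sq_isBigO hsides

end FunctionalModel

/-! ### The two regimes and the optimal order together -/

theorem corollary1 {p : ℕ} (hp : 0 < p) {Ω S : Type*} [MeasurableSpace Ω] [MeasurableSpace S]
    (P : Measure Ω) [IsProbabilityMeasure P]
    (m : FunctionalModel p Ω S) (hm : m.IsEigenAdjusted P)
    (N : ℕ → ℕ → ℕ) (hN : ∀ n, ∀ i < n, 1 ≤ N n i)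
    -- bandwidths: `hz n k` for the `k`-th covariate, all of the same order as `hz₀ n`
    (ht : ℕ → ℝ) (hz : ℕ → Fin p → ℝ) (hz₀ : ℕ → ℝ)
    (ht_pos : ∀ n, 0 < ht n) (hz_pos : ∀ n k, 0 < hz n k) (hz₀_pos : ∀ n, 0 < hz₀ n)
    (hz_order : ∀ k, (fun n => hz n k) =Θ[atTop] hz₀)
    (K : ℝ → ℝ)
    (A1 : m.DensityRegular) (A2 : IsKernel K) (B1 : m.MeanRegular)
    (B2 : MomentBandwidth m P N ht hz)
    (muhat : ℕ → Ω → ℝ → (Fin p → ℝ) → ℝ)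
    (hmu : IsLocalLinearEstimator m K N ht hz muhat) :
    -- (a) boundedly many observations per subject
    ((∃ Mmax : ℕ, ∀ n, ∀ i < n, N n i ≤ Mmax) →
      ∀ h : ℕ → ℝ, (∀ n, 0 < h n) → ht =Θ[atTop] hz₀ → hz₀ =Θ[atTop] h →
        HasUniformRate m P muhat (sparseRate p h) ∧
        (h =Θ[atTop] (fun n => logRatio n ^ (1 / ((p : ℝ) + 5))) →
          HasUniformRate m P muhat (fun n => logRatio n ^ (2 / ((p : ℝ) + 5))))) ∧
    -- the optimal order of the rate in (a), over all bandwidth sequences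
    ((∀ h : ℕ → ℝ, (∀ n, 0 < h n) →
        (fun n => logRatio n ^ (2 / ((p : ℝ) + 5))) =O[atTop] sparseRate p h) ∧
      ∀ h : ℕ → ℝ, (∀ n, 0 < h n) →
        (sparseRate p h =Θ[atTop] (fun n => logRatio n ^ (2 / ((p : ℝ) + 5))) ↔
          h =Θ[atTop] (fun n => logRatio n ^ (1 / ((p : ℝ) + 5))))) ∧
    -- (b) densely observed subjects
    (PairDensityBounded m P →
      ∀ Mmin : ℕ → ℝ, (∀ n, 0 < Mmin n) → (∀ n, ∀ i < n, Mmin n ≤ N n i) →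
        (fun n => (Mmin n)⁻¹) =Θ[atTop] ht → ht =O[atTop] hz₀ →
        hz₀ =Θ[atTop] (fun n => logRatio n ^ (1 / ((p : ℝ) + 4))) →
        HasUniformRate m P muhat (fun n => logRatio n ^ (2 / ((p : ℝ) + 4)))) := by
  refine ⟨?_, ⟨fun h hh => rpow_isBigO_sparseRate hh, fun h hh => sparseRate_isTheta_iff hh⟩, ?_⟩
  · rintro ⟨M, hM⟩ h hh htz hzh
    have hrate := hm.hasUniformRate_sparse A1 B1 A2 hN ht_pos hz_pos B2 hmu hM hh (htz.trans hzh)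
      fun k => (hz_order k).trans hzh
    exact ⟨hrate, fun H => HasUniformRate.mono (sparseRate_nonneg p h)
      (fun n => Real.rpow_nonneg (logRatio_nonneg n) _) (sparseRate_isBigO_of_isTheta hh H) hrate⟩
  · intro hpair Mmin hMpos hM hMt htz hzρ
    exact hm.hasUniformRate_dense A1 B1 A2 hN ht_pos hz_pos B2 hmu hpair hMpos hM hMt.1
      (htz.trans hzρ.1) fun k => (hz_order k).trans hzρ
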